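/- **Theorem (TYZ expansion).** Let $n\ge2$, let $\mathbb H=\{z\in\mathbb C^{n+1}: z_1^2+\dots+z_{n+1}^2=0,\ z\ne0\}$ be the Kepler manifold, and let $\mu$ be the unique $O(n+1,\mathbb R)$-invariant probability measure on $\{z\in\mathbb H:|z|=1\}$. For constants $c,m>0$ and $s>0$ put $$d\rho(t)=2cm\,e^{-st^{2m}}\,t^{2mn-1}\,dt\quad\text{on }(0,\infty),\qquad \int_{\mathbb H} f\,d(\rho\otimes\mu)=\int_0^\infty\!\int f(t\zeta)\,d\mu(\zeta)\,d\rho(t),$$ and let $K_s$ be the reproducing kernel of the Bergman space of all functions that are holomorphic on $\mathbb H$ and belong to $L^2(\rho\otimes\mu)$ (this kernel exists for every $s>0$). Then there are constants $b_j=b_j(n,m)$, depending on $m$ and $n$ only, with $$b_0=1,\qquad b_1=\frac{(1-n)(mn-n+1)}{2m},$$ such that, as $s\to+\infty$, $$e^{-s|z|^{2m}}K_s(z,z)=\frac{2m^n}{(n-1)!\,c}\,s^n\sum_{j=0}^{n-1}\frac{b_j}{s^j|z|^{2mj}}+R_s(z),\qquad z\in\mathbb H,$$ where $R_s(z)=O(e^{-\delta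 s|z|^{2m}})$ for some $\delta>0$. Here $\delta$ does not depend on $z$, and the estimate is uniform on $\{z\in\mathbb H:|z|\ge r\}$ for every $r>0$: there are $C,s_0$, depending on $r$ but not on $z$ or $s$, with $|R_s(z)|\le Ce^{-\delta s|z|^{2m}}$ for all $s\ge s_0$ and all $z\in\mathbb H$ with $|z|\ge r$. Moreover, for $m=\frac12$ one has $b_{n-1}=0$, and with the choice $c=2^{1-n}/(n-1)!$ the expansion takes the form found by Gramchev and Loi: $$e^{-s|z|}K_s(z,z)=s^n+\frac{(n-2)(n-1)}{2|z|}\,s^{n-1}+\sum_{k=2}^{n-2}\frac{b_k}{|z|^k}\,s^{n-k}+R_s(z),$$ with $R_s(z)=O(e^{-\delta s|z|})$ for some $\delta>0$, in the same sense. -/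

import Mathlib

open MeasureTheory Filter Topology Set

noncomputable section

/-- The ambient Hermitian space `ℂ^(n+1)`. -/
abbrev KSpace (n : ℕ) : Type := EuclideanSpace ℂ (Fin (n + 1))

/-- The Kepler manifold `{z ∈ ℂ^(n+1) : z₁² + ⋯ + z_{n+1}² = 0, z ≠ 0}`. -/
def keplerManifold (n : ℕ) : Set (KSpace n) :=
  {z | ∑ i, z i * z i = 0 ∧ z ≠ 0}

/-- The real orthogonal group `O(k, ℝ)` (the star operation on `ℝ` is trivial, so these are the
real matrices `A` with `Aᵀ A = A Aᵀ = 1`). -/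
abbrev RealOrthogonal (k : ℕ) : Type := Matrix.unitaryGroup (Fin k) ℝ

instance instMeasurableSpaceRealOrthogonal (k : ℕ) : MeasurableSpace (RealOrthogonal k) :=
  borel _

instance instBorelSpaceRealOrthogonal (k : ℕ) : BorelSpace (RealOrthogonal k) := ⟨rfl⟩

instance instCompactSpaceRealOrthogonal (k : ℕ) : CompactSpace (RealOrthogonal k) := by
  have hK : IsCompact (Set.univ.pi fun _ : Fin k => Set.univ.pi fun _ : Fin k =>
      Set.Icc (-1 : ℝ) 1) :=
    isCompact_univ_pi fun _ => isCompact_univ_pi fun _ => isCompact_Icc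
  have hU : IsCompact (Matrix.unitaryGroup (Fin k) ℝ : Set (Matrix (Fin k) (Fin k) ℝ)) := by
    refine IsCompact.of_isClosed_subset (X := Matrix (Fin k) (Fin k) ℝ) hK isClosed_unitary ?_
    intro A hA i _ j _
    exact abs_le.mp (entry_norm_bound_of_unitary hA i j)
  exact isCompact_iff_compactSpace.mp hU

/-- The action of a real orthogonal matrix on `ℂ^(n+1)`. -/
def orthAct (n : ℕ) (g : RealOrthogonal (n + 1)) (z : KSpace n) : KSpace n :=
  WithLp.toLp 2 fun i => ∑ j, ((g.1 i j : ℝ) : ℂ) * z j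

/-- The base point `(1, i, 0, …, 0) / √2`, of norm one, on the Kepler manifold. -/
def basePoint (n : ℕ) : KSpace n :=
  WithLp.toLp 2 fun k =>
    if (k : ℕ) = 0 then ((Real.sqrt 2)⁻¹ : ℂ)
    else if (k : ℕ) = 1 then ((Real.sqrt 2)⁻¹ : ℂ) * Complex.I
    else 0

/-- The `O(n+1, ℝ)`-invariant probability measure on `{z ∈ keplerManifold n : ‖z‖ = 1}`: the image
of the normalized Haar measure of `O(n+1, ℝ)` under the orbit map of the base point. -/
def sphereMeasure (n : ℕ) : Measure (KSpace n) :=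
  (Measure.haarMeasure (⊤ : TopologicalSpace.PositiveCompacts (RealOrthogonal (n + 1)))).map
    fun g => orthAct n g (basePoint n)

/-- The measure `ρ ⊗ μ`, with
`∫ f d(ρ ⊗ μ) = ∫_0^∞ ∫ f(t ζ) dμ(ζ) dρ(t)`, where `ρ` is a measure on `(0, ∞)`
(regarded as a measure on `ℝ`) and `μ` is the invariant measure above. -/
def coneMeasure (n : ℕ) (ρ : Measure ℝ) : Measure (KSpace n) :=
  (ρ.prod (sphereMeasure n)).map fun p => (p.1 : ℂ) • p.2

/-- The domain `{z ∈ keplerManifold n : ‖z‖ < R}`, `R = sup (supp ρ) ∈ (0, ∞]`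
(all of the Kepler manifold if `R = ∞`). -/
def bergmanDomain (n : ℕ) (ρ : Measure ℝ) : Set (KSpace n) :=
  {z | z ∈ keplerManifold n ∧ ∃ t ∈ ρ.support, ‖z‖ < t}

/-- Holomorphy on a relatively open subset `Ω` of the Kepler manifold (a complex submanifold of
`ℂ^(n+1) ∖ {0}`): near every point of `Ω`, `f` is the restriction of a holomorphic function on an
open subset of `ℂ^(n+1)`. -/
def HolomorphicOnKepler (n : ℕ) (Ω : Set (KSpace n)) (f : KSpace n → ℂ) : Prop :=
  ∀ z ∈ Ω, ∃ U : Set (KSpace n), IsOpen U ∧ z ∈ U ∧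
    ∃ F : KSpace n → ℂ, DifferentiableOn ℂ F U ∧ EqOn F f (U ∩ Ω)

/-- The weighted Bergman space `A²` of `ρ ⊗ μ`: the functions holomorphic on `bergmanDomain n ρ`
and square integrable there. Only the values on `bergmanDomain n ρ` matter. -/
def bergmanSpace (n : ℕ) (ρ : Measure ℝ) : Set (KSpace n → ℂ) :=
  {f | HolomorphicOnKepler n (bergmanDomain n ρ) f ∧
    MemLp f 2 ((coneMeasure n ρ).restrict (bergmanDomain n ρ))}

/-- `K` is a reproducing kernel of the Bergman space. -/
def IsBergmanKernel (n : ℕ) (ρ : Measure ℝ) (K : KSpace n → KSpace n → ℂ) : Prop :=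
  (∀ y ∈ bergmanDomain n ρ, (fun x => K x y) ∈ bergmanSpace n ρ) ∧
  (∀ x ∈ bergmanDomain n ρ, ∀ y ∈ bergmanDomain n ρ, K y x = starRingEnd ℂ (K x y)) ∧
  (∀ f ∈ bergmanSpace n ρ, ∀ z ∈ bergmanDomain n ρ,
    f z = ∫ w in bergmanDomain n ρ, f w * K z w ∂(coneMeasure n ρ))

open Classical in
/-- The reproducing kernel of the Bergman space (its values on
`bergmanDomain n ρ × bergmanDomain n ρ` are uniquely determined). -/
def bergmanKernel (n : ℕ) (ρ : Measure ℝ) : KSpace n → KSpace n → ℂ :=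
  if h : ∃ K, IsBergmanKernel n ρ K then h.choose else 0

/-- The measure `dρ(t) = 2 c m exp(-s t^(2m)) t^(2mn-1) dt` on `(0, ∞)`. -/
def radialMeasure (n : ℕ) (m c s : ℝ) : Measure ℝ :=
  (volume.restrict (Ioi (0 : ℝ))).withDensity fun t =>
    ENNReal.ofReal (2 * c * m * Real.exp (-s * t ^ (2 * m)) * t ^ (2 * m * n - 1))

/-- The function `ε_s(z) = exp(-s ‖z‖^(2m)) K_s(z, z)`. -/
def distortion (n : ℕ) (m c s : ℝ) (z : KSpace n) : ℂ :=
  (Real.exp (-s * ‖z‖ ^ (2 * m)) : ℂ) * bergmanKernel n (radialMeasure n m c s) z z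

/-- `R_s(z) = O(exp(-δ s ‖z‖^(2m)))` as `s → +∞` for some `δ > 0` (one `δ` for all `z`),
uniformly for `z` in the Kepler manifold bounded away from the origin. -/
def ExpSmallRemainder (n : ℕ) (m : ℝ) (R : ℝ → KSpace n → ℂ) : Prop :=
  ∃ δ : ℝ, 0 < δ ∧ ∀ r : ℝ, 0 < r → ∃ C s₀ : ℝ, ∀ s : ℝ, s₀ ≤ s →
    ∀ z ∈ keplerManifold n, r ≤ ‖z‖ → ‖R s z‖ ≤ C * Real.exp (-δ * s * ‖z‖ ^ (2 * m))

end

noncomputable section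

/-! Write `n = k + 2`. The Bergman kernel is a power series in the inner product: the coefficient of
degree `l` is `keplerDim k l` divided by the moment `∫ t^(2l) dρ = c Γ(l/m + n) / s^(l/m + n)`. With
`T = s‖z‖^(2m)` the diagonal value becomes `(s^n/c) ∑ T^(l/m) keplerDim k l / Γ(l/m + n)`.

As a function of `x = l/m`, `keplerDim` is a polynomial of degree `n - 1`. Expanding it in the
products `(x + j + 1) ⋯ (x + n - 1)` turns each quotient by `Γ(x + n)` into a multiple of `1/Γ(x + j
+ 1)`, so the series is a combination of `T^(-j)` times Mittag-Leffler functions with parameters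
`(1/m, j + 1)`. Each of these equals `m e^T` up to `O(e^(aT))` with `a < 1`
(`mittagLeffler_asymptotics`): it is an inverse Laplace integral of `s^(-β)/(1 - s^(-α))`, whose
only pole to the right of a line `Re s = a` is `s = 1`. The coefficients of the polynomial expansion
are the `b_j`. The first two are read off from the top coefficients, the last one from the value at
`x = -(n - 1)`, which is a root when `m = 1/2` (`exists_keplerDim_expansion`).

The formula for the kernel is proved without decomposing the space into representations. Let `e` be
the base point and `G` the entire function extending `t ↦ f(t e)`. Conics on the cone, combined with
the circle action and the mean value property, replace `f(tζ)` by `G(t⟨e, ζ⟩)` under the invariant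
integral, so pairing with a power of the inner product isolates one Taylor coefficient
(`integral_sphere_reproducing_base`). The remaining constant `∫ |⟨e, ζ⟩|^(2l) dμ = 1 / keplerDim k
l` follows from a recursion obtained by differentiating invariant integrals along rotations
(`integral_V_pow`). Transitivity of the group carries the result from `e` to every point, and
`RadialWeight.integral_mul_keplerKernel` integrates the series term by term. -/

/-! ### Laplace transform of powers and its inversion on the line `Re s = 2`. -/

theorem hasDerivAt_laplace_rpow {a : ℝ} (ha : 0 < a) {s : ℂ} (hs : 0 < s.re) :
    HasDerivAt (fun z : ℂ => ∫ x in Ioi (0 : ℝ), ((x ^ (a - 1) : ℝ) : ℂ) * Complex.exp (-(z * x)))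
      (∫ x in Ioi (0 : ℝ), ((x ^ (a - 1) : ℝ) : ℂ) * (Complex.exp (-(s * x)) * (-x))) s := by
  have meas : ∀ z : ℂ, AEStronglyMeasurable
      (fun x : ℝ => ((x ^ (a - 1) : ℝ) : ℂ) * Complex.exp (-(z * x)))
      (volume.restrict (Ioi (0 : ℝ))) := fun z => by
    apply Measurable.aestronglyMeasurable
    fun_prop
  have hint : ∀ {b ε : ℝ}, 0 < b → 0 < ε → IntegrableOn
      (fun x : ℝ => x ^ (b - 1) * Real.exp (-ε * x)) (Ioi 0) := fun {b ε} hb hε => by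
    have := integrableOn_rpow_mul_exp_neg_mul_rpow (p := 1) (s := b - 1) (b := ε) (by linarith)
      one_pos hε
    simpa using this
  have hnorm : ∀ (z : ℂ) (x : ℝ), ‖Complex.exp (-(z * x))‖ = Real.exp (-z.re * x) := fun z x => by
    rw [Complex.norm_exp]; simp
  have hball : ∀ z ∈ Metric.ball s (s.re / 2), s.re / 2 < z.re := fun z hz => by
    have h1 := Complex.abs_re_le_norm (z - s)
    rw [Metric.mem_ball, dist_eq_norm] at hz
    have := abs_le.1 h1
    simp at this
    linarith
  refine (hasDerivAt_integral_of_dominated_loc_of_deriv_le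
    (F := fun (z : ℂ) (x : ℝ) => ((x ^ (a - 1) : ℝ) : ℂ) * Complex.exp (-(z * x)))
    (F' := fun (z : ℂ) (x : ℝ) => ((x ^ (a - 1) : ℝ) : ℂ) * (Complex.exp (-(z * x)) * (-x)))
    -- On the ball of radius `Re s / 2` the real part stays above `Re s / 2`. The exponent is left
    -- as `(a + 1) - 1` so that `hint` applies with `b = a + 1`.
    (bound := fun x : ℝ => x ^ ((a + 1) - 1) * Real.exp (-(s.re / 2) * x))
    (Metric.ball_mem_nhds s (half_pos hs)) (Eventually.of_forall meas) ?_ ?_ ?_ ?_ ?_).2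
  · refine (hint ha hs).mono' (meas s) ?_
    filter_upwards [ae_restrict_mem measurableSet_Ioi] with x hx
    rw [norm_mul, hnorm, Complex.norm_real, Real.norm_of_nonneg (Real.rpow_nonneg (le_of_lt hx) _)]
  · apply Measurable.aestronglyMeasurable
    fun_prop
  · filter_upwards [ae_restrict_mem measurableSet_Ioi] with x hx z hz
    have hx' : (0 : ℝ) < x := hx
    rw [norm_mul, norm_mul, hnorm, Complex.norm_real, norm_neg, Complex.norm_real,
      Real.norm_of_nonneg (Real.rpow_nonneg (le_of_lt hx) _), Real.norm_of_nonneg hx'.le,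
      add_sub_cancel_right, show x ^ a = x ^ (a - 1) * x by
        rw [← Real.rpow_add_one hx'.ne', sub_add_cancel]]
    have : Real.exp (-z.re * x) ≤ Real.exp (-(s.re / 2) * x) := by
      gcongr
      exact (hball z hz).le
    calc _ = x ^ (a - 1) * x * Real.exp (-z.re * x) := by ring
      _ ≤ _ := by gcongr
  · exact hint (by linarith) (by linarith)
  · filter_upwards with x z _
    have := ((((hasDerivAt_id z).mul_const (x : ℂ)).neg).cexp).const_mul ((x ^ (a - 1) : ℝ) : ℂ)
    simpa using this

/-- Both sides are analytic on the right half-plane and agree for real `s > 0` by the Gamma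
integral, so the identity theorem applies. -/
theorem laplace_rpow {a : ℝ} (ha : 0 < a) {s : ℂ} (hs : 0 < s.re) :
    ∫ x in Ioi (0 : ℝ), ((x ^ (a - 1) : ℝ) : ℂ) * Complex.exp (-(s * x)) =
      s ^ (-a : ℂ) * Real.Gamma a := by
  have hU : IsOpen {z : ℂ | 0 < z.re} := isOpen_lt continuous_const Complex.continuous_re
  have hconn : IsPreconnected {z : ℂ | 0 < z.re} :=
    (convex_halfSpace_re_gt 0).isPreconnected
  have h1 : AnalyticOnNhd ℂ (fun z : ℂ => ∫ x in Ioi (0 : ℝ),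
      ((x ^ (a - 1) : ℝ) : ℂ) * Complex.exp (-(z * x))) {z : ℂ | 0 < z.re} :=
    DifferentiableOn.analyticOnNhd
      (fun z hz => (hasDerivAt_laplace_rpow ha hz).differentiableAt.differentiableWithinAt) hU
  have h2 : AnalyticOnNhd ℂ (fun z : ℂ => z ^ (-a : ℂ) * Real.Gamma a) {z : ℂ | 0 < z.re} := by
    refine DifferentiableOn.analyticOnNhd (fun z hz => ?_) hU
    have : z ∈ Complex.slitPlane := Or.inl hz
    exact ((differentiableAt_id.cpow_const this).mul_const _).differentiableWithinAt
  have hreal : ∀ r : ℝ, 0 < r → ∫ x in Ioi (0 : ℝ),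
      ((x ^ (a - 1) : ℝ) : ℂ) * Complex.exp (-((r : ℂ) * x)) =
        (r : ℂ) ^ (-a : ℂ) * Real.Gamma a := fun r hr => by
    have h := Complex.integral_cpow_mul_exp_neg_mul_Ioi (a := a) (r := r) (by simpa using ha) hr
    rw [Complex.Gamma_ofReal, one_div, Complex.inv_cpow, ← Complex.cpow_neg] at h
    · rw [← h]
      refine setIntegral_congr_fun measurableSet_Ioi fun x hx => ?_
      have hx' : (0 : ℝ) < x := hx
      simp only [Complex.ofReal_cpow hx'.le, Complex.ofReal_sub, Complex.ofReal_one]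
    · rw [Complex.arg_ofReal_of_nonneg hr.le]; exact Real.pi_pos.ne
  refine h1.eqOn_of_preconnected_of_frequently_eq h2 hconn (z₀ := 1) (by simp) ?_ hs
  -- Real points `1 + 1/(k+1)` accumulate at `1` without reaching it.
  have hseq : Tendsto (fun k : ℕ => ((1 + 1 / ((k : ℝ) + 1) : ℝ) : ℂ)) atTop (𝓝[≠] 1) := by
    refine tendsto_nhdsWithin_iff.2 ⟨?_, Eventually.of_forall fun k => ?_⟩
    · have h : Tendsto (fun k : ℕ => 1 + 1 / ((k : ℝ) + 1)) atTop (𝓝 (1 + 0)) :=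
        tendsto_const_nhds.add tendsto_one_div_add_atTop_nhds_zero_nat
      rw [add_zero] at h
      simpa [Function.comp_def] using (Complex.continuous_ofReal.tendsto 1).comp h
    · have : (0 : ℝ) < 1 / ((k : ℝ) + 1) := by positivity
      intro h
      have h' : (1 + 1 / ((k : ℝ) + 1) : ℝ) = 1 := Complex.ofReal_injective (by simpa using h)
      linarith
  exact hseq.frequently (Frequently.of_forall fun k => hreal _ (by positivity))

/-- A parametrization of the vertical line `Re s = 2`. -/
def vline (x : ℝ) (ξ : ℝ) : ℂ := x + 2 * Real.pi * ξ * Complex.I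

@[simp] theorem vline_re (x ξ : ℝ) : (vline x ξ).re = x := by simp [vline]

@[simp] theorem vline_im (x ξ : ℝ) : (vline x ξ).im = 2 * Real.pi * ξ := by simp [vline]

theorem continuous_vline (x : ℝ) : Continuous (vline x) := by unfold vline; fun_prop

theorem vline_ne_zero {x : ℝ} (hx : 0 < x) (ξ : ℝ) : vline x ξ ≠ 0 := fun h => by
  have := congrArg Complex.re h
  simp at this
  exact hx.ne' this

theorem one_add_sq_le_normSq_vline_two (ξ : ℝ) : 1 + ξ ^ 2 ≤ ‖vline 2 ξ‖ ^ 2 := by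
  rw [Complex.sq_norm, Complex.normSq_apply, vline_re, vline_im]
  nlinarith [Real.pi_gt_three, sq_nonneg ξ, mul_nonneg (sq_nonneg ξ)
    (by nlinarith [Real.pi_gt_three] : (0 : ℝ) ≤ 4 * Real.pi ^ 2 - 1)]

theorem two_le_norm_vline_two (ξ : ℝ) : 2 ≤ ‖vline 2 ξ‖ := by
  simpa using Complex.re_le_norm (vline 2 ξ)

theorem norm_vline_cpow {x : ℝ} (hx : 0 < x) (ξ b : ℝ) :
    ‖vline x ξ ^ (b : ℂ)‖ = ‖vline x ξ‖ ^ b := by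
  rw [Complex.norm_cpow_of_ne_zero (vline_ne_zero hx ξ)]
  simp

/-- Split `|s|^(-b) = |s|^(2-b) |s|^(-2)`: the second factor is integrable along the line, and the
constant `2^(2-b)` decays geometrically in `b`, which later allows summation over `l`. -/
theorem norm_vline_two_cpow_le {b : ℝ} (hb : 2 ≤ b) (ξ : ℝ) :
    ‖vline 2 ξ ^ (-b : ℂ)‖ ≤ (2 : ℝ) ^ (2 - b) * (1 + ξ ^ 2)⁻¹ := by
  have h2 := two_le_norm_vline_two ξ
  have h0 : 0 < ‖vline 2 ξ‖ := by linarith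
  have := norm_vline_cpow two_pos ξ (-b)
  push_cast at this
  rw [this, show -b = (2 - b) + (-2 : ℝ) by ring, Real.rpow_add h0, Real.rpow_neg h0.le,
    Real.rpow_two]
  gcongr ?_ * ?_
  · exact Real.rpow_le_rpow_of_nonpos two_pos h2 (by linarith)
  · exact inv_anti₀ (by positivity) (one_add_sq_le_normSq_vline_two ξ)

theorem continuous_vline_cpow {x : ℝ} (hx : 0 < x) (b : ℂ) :
    Continuous fun ξ => vline x ξ ^ b :=
  (continuous_vline x).cpow continuous_const fun ξ => Or.inl (by simpa using hx)

theorem integrable_vline_two_cpow {b : ℝ} (hb : 2 ≤ b) :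
    Integrable fun ξ => vline 2 ξ ^ (-b : ℂ) :=
  (integrable_inv_one_add_sq.const_mul ((2 : ℝ) ^ (2 - b))).mono'
    (continuous_vline_cpow two_pos _).aestronglyMeasurable
    (Eventually.of_forall fun ξ => norm_vline_two_cpow_le hb ξ)

/-- Fourier inversion for `x^(b-1) e^(-2x)` on the half-line, whose transform is `Γ(b) s^(-b)` on
`Re s = 2`. The condition `b ≥ 2` makes the transform integrable. -/
theorem rpow_div_Gamma_eq_integral {b t : ℝ} (hb : 2 ≤ b) (ht : 0 < t) :
    ((t ^ (b - 1) / Real.Gamma b : ℝ) : ℂ) =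
      ∫ ξ : ℝ, vline 2 ξ ^ (-b : ℂ) * Complex.exp (vline 2 ξ * t) := by
  have hb0 : 0 < b := by linarith
  set f : ℝ → ℂ := (Ioi (0 : ℝ)).indicator
    fun x => ((x ^ (b - 1) : ℝ) : ℂ) * Complex.exp (-(2 * x)) with hf
  have hF : ∀ ξ, FourierTransform.fourier f ξ = vline 2 ξ ^ (-b : ℂ) * Real.Gamma b := fun ξ => by
    rw [← laplace_rpow hb0 (s := vline 2 ξ) (by simp), Real.fourier_eq',
      ← integral_indicator measurableSet_Ioi]
    congr 1 with x
    by_cases hx : x ∈ Ioi (0 : ℝ)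
    · rw [hf, indicator_of_mem hx, indicator_of_mem hx, smul_eq_mul, mul_left_comm,
        ← Complex.exp_add]
      congr 2
      simp [vline]
      ring
    · rw [hf, indicator_of_notMem hx, indicator_of_notMem hx, smul_zero]
  have hFeq : FourierTransform.fourier f = fun ξ => vline 2 ξ ^ (-b : ℂ) * Real.Gamma b :=
    funext hF
  have hfi : Integrable f := by
    rw [hf, integrable_indicator_iff measurableSet_Ioi]
    have := integrableOn_rpow_mul_exp_neg_mul_rpow (p := 1) (s := b - 1) (b := 2) (by linarith)
      one_pos two_pos
    have h := Integrable.ofReal (𝕜 := ℂ) this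
    refine h.congr (Eventually.of_forall fun x => ?_)
    simp
  have hFi : Integrable (FourierTransform.fourier f) := by
    rw [hFeq]; exact (integrable_vline_two_cpow hb).mul_const _
  have hc : ContinuousAt f t := by
    have : f =ᶠ[𝓝 t] fun x => ((x ^ (b - 1) : ℝ) : ℂ) * Complex.exp (-(2 * x)) := by
      filter_upwards [Ioi_mem_nhds ht] with x hx
      rw [hf, indicator_of_mem hx]
    rw [continuousAt_congr this]
    have h1 : ContinuousAt (fun x : ℝ => x ^ (b - 1)) t :=
      Real.continuousAt_rpow_const _ _ (Or.inl ht.ne')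
    exact (Complex.continuous_ofReal.continuousAt.comp h1).mul (by fun_prop)
  have key := hfi.fourierInv_fourier_eq hFi hc
  rw [Real.fourierInv_eq', hFeq] at key
  have hft : f t = ((t ^ (b - 1) : ℝ) : ℂ) * Complex.exp (-(2 * t)) := by
    rw [hf, indicator_of_mem (mem_Ioi.2 ht)]
  have hG : (Real.Gamma b : ℂ) ≠ 0 := by exact_mod_cast (Real.Gamma_pos_of_pos hb0).ne'
  have e1 : (∫ ξ : ℝ, vline 2 ξ ^ (-b : ℂ) * Complex.exp (vline 2 ξ * t)) =
      Complex.exp (2 * t) / Real.Gamma b * f t := by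
    rw [← key, ← integral_const_mul]
    congr 1 with ξ
    rw [smul_eq_mul, show vline 2 ξ * t = 2 * t + (2 * Real.pi * inner ℝ ξ t : ℝ) * Complex.I by
      simp [vline]; ring, Complex.exp_add]
    field_simp
  rw [e1, hft, Complex.exp_neg]
  field_simp [Complex.exp_ne_zero]
  push_cast
  field_simp

/-- Sum the inversion formula over `b = αl + β`. Since `|s| ≥ 2` on the line, the integrands form a
geometric series of ratio `s^(-α)`, and sum and integral may be exchanged. -/
theorem hasSum_rpow_div_Gamma {α β t : ℝ} (hα : 0 < α) (hβ : 2 ≤ β) (ht : 0 < t) :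
    HasSum (fun l : ℕ => ((t ^ (α * l + β - 1) / Real.Gamma (α * l + β) : ℝ) : ℂ))
      (∫ ξ : ℝ, vline 2 ξ ^ (-β : ℂ) / (1 - vline 2 ξ ^ (-α : ℂ)) *
        Complex.exp (vline 2 ξ * t)) := by
  set F : ℕ → ℝ → ℂ := fun l ξ => vline 2 ξ ^ (-(α * l + β : ℝ) : ℂ) * Complex.exp (vline 2 ξ * t)
    with hFdef
  have hge : ∀ l : ℕ, 2 ≤ α * l + β := fun l => by
    have : 0 ≤ α * l := by positivity
    linarith
  have hexp : ∀ ξ, ‖Complex.exp (vline 2 ξ * t)‖ = Real.exp (2 * t) := fun ξ => by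
    rw [Complex.norm_exp]; simp
  have hFn : ∀ l ξ, ‖F l ξ‖ ≤ (2 : ℝ) ^ (2 - (α * l + β)) * Real.exp (2 * t) * (1 + ξ ^ 2)⁻¹ :=
    fun l ξ => by
      rw [hFdef, norm_mul, hexp]
      have := norm_vline_two_cpow_le (hge l) ξ
      calc _ ≤ (2 : ℝ) ^ (2 - (α * l + β)) * (1 + ξ ^ 2)⁻¹ * Real.exp (2 * t) := by gcongr
        _ = _ := by ring
  have hFc : ∀ l, Continuous (F l) := fun l =>
    (continuous_vline_cpow two_pos _).mul
      (Complex.continuous_exp.comp ((continuous_vline 2).mul continuous_const))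
  have hFi : ∀ l, Integrable (F l) := fun l =>
    (integrable_inv_one_add_sq.const_mul _).mono' (hFc l).aestronglyMeasurable
      (Eventually.of_forall (hFn l))
  have hsum : Summable fun l : ℕ => ∫ ξ, ‖F l ξ‖ := by
    have hg : Summable fun l : ℕ => ((2 : ℝ) ^ (2 - β) * Real.exp (2 * t) *
        ∫ ξ : ℝ, (1 + ξ ^ 2)⁻¹) * ((2 : ℝ) ^ (-α)) ^ l :=
      (summable_geometric_of_lt_one (by positivity)
        (Real.rpow_lt_one_of_one_lt_of_neg one_lt_two (by linarith))).mul_left _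
    refine Summable.of_nonneg_of_le (fun l => integral_nonneg fun _ => norm_nonneg _)
      (fun l => ?_) hg
    calc _ ≤ ∫ ξ : ℝ, (2 : ℝ) ^ (2 - (α * l + β)) * Real.exp (2 * t) * (1 + ξ ^ 2)⁻¹ :=
          integral_mono (hFi l).norm (integrable_inv_one_add_sq.const_mul _) (hFn l)
      _ = _ := by
          rw [integral_const_mul, ← Real.rpow_natCast, ← Real.rpow_mul two_pos.le,
            show 2 - (α * l + β) = (2 - β) + -α * l by ring, Real.rpow_add two_pos]
          ring
  have h := hasSum_integral_of_summable_integral_norm hFi hsum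
  have e : ∀ ξ, ∑' l, F l ξ = vline 2 ξ ^ (-β : ℂ) / (1 - vline 2 ξ ^ (-α : ℂ)) *
      Complex.exp (vline 2 ξ * t) := fun ξ => by
    have hne := vline_ne_zero two_pos ξ
    have hlt : ‖vline 2 ξ ^ (-α : ℂ)‖ < 1 := by
      have := norm_vline_cpow two_pos ξ (-α)
      push_cast at this
      rw [this]
      exact Real.rpow_lt_one_of_one_lt_of_neg (by linarith [two_le_norm_vline_two ξ]) (by linarith)
    have hF' : ∀ l, F l ξ = vline 2 ξ ^ (-β : ℂ) * Complex.exp (vline 2 ξ * t) *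
        (vline 2 ξ ^ (-α : ℂ)) ^ l := fun l => by
      simp only [hFdef]
      rw [← Complex.cpow_nat_mul,
        show (-(α * l + β : ℝ) : ℂ) = (-β : ℂ) + l * (-α : ℂ) by push_cast; ring,
        Complex.cpow_add _ _ hne]
      ring
    simp_rw [hF']
    rw [tsum_mul_left, tsum_geometric_of_norm_lt_one hlt]
    ring
  simp_rw [e] at h
  have hl : (fun l : ℕ => ((t ^ (α * l + β - 1) / Real.Gamma (α * l + β) : ℝ) : ℂ)) =
      fun l => ∫ ξ, F l ξ := funext fun l => rpow_div_Gamma_eq_integral (hge l) ht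
  rw [hl]
  exact h

/-! ### Shifting the line of integration past the pole at `1`. -/

/-- Cauchy's theorem on rectangles of half-height `Y`: the quadratic decay of `D` makes the
horizontal sides vanish as `Y → ∞`. -/
theorem integral_vline_eq_integral_vline {D : ℂ → ℂ} {a b C : ℝ} (hab : a ≤ b) (t : ℝ)
    (hD : DifferentiableOn ℂ D {s | s.re ∈ Icc a b})
    (hC : ∀ s : ℂ, s.re ∈ Icc a b → ‖D s‖ ≤ C * (1 + s.im ^ 2)⁻¹) :
    ∫ ξ : ℝ, D (vline b ξ) * Complex.exp (vline b ξ * t) =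
      ∫ ξ : ℝ, D (vline a ξ) * Complex.exp (vline a ξ * t) := by
  have hpi : (0 : ℝ) < 2 * Real.pi := by positivity
  have hC0 : 0 ≤ C := by
    have := (norm_nonneg _).trans (hC (a : ℂ) (by simpa using hab))
    simpa using this
  -- Rescaling by `2π` makes `vline` a unit-speed vertical line, the form in which the rectangle
  -- theorem is stated.
  set f : ℂ → ℂ := fun z => D (2 * Real.pi * z) * Complex.exp (2 * Real.pi * z * t) with hf
  set a' : ℝ := a / (2 * Real.pi)
  set b' : ℝ := b / (2 * Real.pi)
  have hab' : a' ≤ b' := div_le_div_of_nonneg_right hab hpi.le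
  have ha' : 2 * Real.pi * a' = a := mul_div_cancel₀ _ hpi.ne'
  have hb' : 2 * Real.pi * b' = b := mul_div_cancel₀ _ hpi.ne'
  have hre : ∀ z : ℂ, (2 * Real.pi * z : ℂ).re = 2 * Real.pi * z.re := fun z => by
    simp [Complex.mul_re]
  have him : ∀ z : ℂ, (2 * Real.pi * z : ℂ).im = 2 * Real.pi * z.im := fun z => by
    simp [Complex.mul_im]
  have hstrip : ∀ z : ℂ, z.re ∈ Icc a' b' → (2 * Real.pi * z : ℂ).re ∈ Icc a b := fun z hz => by
    rw [hre, ← ha', ← hb']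
    exact ⟨mul_le_mul_of_nonneg_left hz.1 hpi.le, mul_le_mul_of_nonneg_left hz.2 hpi.le⟩
  have hfd : DifferentiableOn ℂ f {z | z.re ∈ Icc a' b'} := by
    refine DifferentiableOn.mul (hD.comp (by fun_prop) fun z hz => hstrip z hz) (by fun_prop)
  set M : ℝ := max (Real.exp (a * t)) (Real.exp (b * t))
  have hM0 : 0 ≤ M := (Real.exp_pos _).le.trans (le_max_left _ _)
  have hfb : ∀ z : ℂ, z.re ∈ Icc a' b' → ‖f z‖ ≤ C * M * (1 + z.im ^ 2)⁻¹ := fun z hz => by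
    have h1 := hC _ (hstrip z hz)
    have h2 : (1 + (2 * Real.pi * z : ℂ).im ^ 2)⁻¹ ≤ (1 + z.im ^ 2)⁻¹ := by
      refine inv_anti₀ (by positivity) ?_
      rw [him]
      nlinarith [Real.pi_gt_three, sq_nonneg z.im, mul_nonneg (sq_nonneg z.im)
        (by nlinarith [Real.pi_gt_three] : (0 : ℝ) ≤ 4 * Real.pi ^ 2 - 1)]
    have h3 : ‖Complex.exp (2 * Real.pi * z * t)‖ ≤ M := by
      rw [Complex.norm_exp, Complex.re_mul_ofReal]
      obtain ⟨h4, h5⟩ := hstrip z hz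
      rcases le_total 0 t with ht | ht
      · exact (Real.exp_le_exp.2 (mul_le_mul_of_nonneg_right h5 ht)).trans (le_max_right _ _)
      · exact (Real.exp_le_exp.2 (mul_le_mul_of_nonpos_right h4 ht)).trans (le_max_left _ _)
    rw [hf, norm_mul]
    calc _ ≤ (C * (1 + z.im ^ 2)⁻¹) * M := by
          refine mul_le_mul (h1.trans (by gcongr)) h3 (norm_nonneg _) (by positivity)
      _ = _ := by ring
  have hline : ∀ x ∈ Icc a' b', Integrable fun y : ℝ => f (x + y * Complex.I) := fun x hx => by
    refine (integrable_inv_one_add_sq.const_mul (C * M)).mono' ?_ (Eventually.of_forall fun y => ?_)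
    · refine Continuous.aestronglyMeasurable ?_
      refine hfd.continuousOn.comp_continuous (by fun_prop) fun y => ?_
      simpa using hx
    · simpa using hfb (x + y * Complex.I) (by simpa using hx)
  have hlim : ∀ x ∈ Icc a' b', Tendsto (fun Y : ℝ => ∫ y in (-Y)..Y, f (x + y * Complex.I)) atTop
      (𝓝 (∫ y : ℝ, f (x + y * Complex.I))) := fun x hx =>
    intervalIntegral_tendsto_integral (hline x hx) tendsto_neg_atTop_atBot tendsto_id
  have hrect : ∀ Y : ℝ, ‖(∫ y in (-Y)..Y, f (b' + y * Complex.I)) -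
      (∫ y in (-Y)..Y, f (a' + y * Complex.I))‖ ≤ 2 * (C * M * (1 + Y ^ 2)⁻¹ * |b' - a'|) := by
    intro Y
    have h := Complex.integral_boundary_rect_eq_zero_of_differentiableOn f
      (a' + (-Y : ℝ) * Complex.I) (b' + (Y : ℝ) * Complex.I) (hfd.mono fun z hz => by
        have := hz.1
        simp only [mem_preimage, Complex.add_re, Complex.ofReal_re, Complex.mul_re, Complex.I_re,
          Complex.ofReal_im, Complex.I_im, mul_zero, mul_one, sub_self, add_zero,
          uIcc_of_le hab'] at this
        exact this)
    simp only [Complex.add_re, Complex.ofReal_re, Complex.mul_re, Complex.I_re,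
      Complex.ofReal_im, Complex.I_im, mul_zero, mul_one, sub_self, add_zero, Complex.add_im,
      Complex.mul_im, zero_add] at h
    have hhor : ∀ y : ℝ, y ^ 2 = Y ^ 2 → ‖∫ x : ℝ in a'..b', f (x + y * Complex.I)‖ ≤
        C * M * (1 + Y ^ 2)⁻¹ * |b' - a'| := fun y hy => by
      refine intervalIntegral.norm_integral_le_of_norm_le_const fun x hx => ?_
      rw [uIoc_of_le hab'] at hx
      have := hfb (x + y * Complex.I) (by simpa using ⟨hx.1.le, hx.2⟩)
      simpa [hy] using this
    have e : (∫ y in (-Y)..Y, f (b' + y * Complex.I)) - (∫ y in (-Y)..Y, f (a' + y * Complex.I)) =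
        Complex.I * ((∫ x : ℝ in a'..b', f (x + (-Y : ℝ) * Complex.I)) -
          ∫ x : ℝ in a'..b', f (x + Y * Complex.I)) := by
      simp only [smul_eq_mul] at h
      linear_combination (-Complex.I) * h + ((∫ y in (-Y)..Y, f (b' + y * Complex.I)) -
        (∫ y in (-Y)..Y, f (a' + y * Complex.I))) * Complex.I_mul_I
    rw [e, norm_mul, Complex.norm_I, one_mul]
    refine (norm_sub_le _ _).trans ?_
    linarith [hhor (-Y) (by ring), hhor Y rfl]
  have hz : Tendsto (fun Y : ℝ => 2 * (C * M * (1 + Y ^ 2)⁻¹ * |b' - a'|)) atTop (𝓝 0) := by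
    have h1 : Tendsto (fun Y : ℝ => (1 + Y ^ 2)⁻¹) atTop (𝓝 0) :=
      (tendsto_atTop_add_const_left _ _ (tendsto_pow_atTop two_ne_zero)).inv_tendsto_atTop
    have := ((h1.const_mul (C * M)).mul_const |b' - a'|).const_mul 2
    simpa using this
  have hdiff := (hlim b' ⟨hab', le_rfl⟩).sub (hlim a' ⟨le_rfl, hab'⟩)
  have h0 := tendsto_nhds_unique hdiff (squeeze_zero_norm hrect hz)
  have hv : ∀ x : ℝ, ∀ ξ : ℝ, vline x ξ = 2 * Real.pi * (((x / (2 * Real.pi) : ℝ) : ℂ) +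
      ξ * Complex.I) := fun x ξ => by
    have : (Real.pi : ℂ) ≠ 0 := by exact_mod_cast Real.pi_ne_zero
    simp [vline]
    field_simp
  have := sub_eq_zero.1 h0
  simp only [hv]
  exact this

/-- If `s^(-α) = 1` then `|s| = 1` and `α arg s ∈ 2πℤ`. A solution other than `1` has `|arg s| ≥
2π/α`, so its real part is bounded away from `1`. -/
theorem exists_lt_one_forall_cpow_eq_one (α : ℝ) (hα : 0 < α) :
    ∃ σ : ℝ, 0 < σ ∧ σ < 1 ∧ ∀ s : ℂ, σ < s.re → s ^ (-α : ℂ) = 1 → s = 1 := by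
  -- The cap at `π` keeps `θ` where the cosine decreases.
  set θ : ℝ := min (2 * Real.pi / α) Real.pi
  have hθ : 0 < θ := lt_min (by positivity) Real.pi_pos
  have hθ1 : Real.cos θ < 1 := by
    rw [← Real.cos_zero]
    exact Real.cos_lt_cos_of_nonneg_of_le_pi le_rfl (min_le_right _ _) hθ
  -- The lower bound `1/2` guarantees `σ > 0`, hence `s ≠ 0` and no branch cut.
  refine ⟨max (1 / 2) (Real.cos θ), lt_of_lt_of_le (by norm_num) (le_max_left _ _),
    max_lt (by norm_num) hθ1, fun s hs h => ?_⟩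
  have hs0 : 0 < s.re := lt_of_lt_of_le (by norm_num) ((le_max_left _ _).trans hs.le)
  have hne : s ≠ 0 := fun h0 => by simp [h0] at hs0
  rw [Complex.cpow_def_of_ne_zero hne, Complex.exp_eq_one_iff] at h
  obtain ⟨k, hk⟩ := h
  have hre := congrArg Complex.re hk
  have him := congrArg Complex.im hk
  simp [Complex.log_re, Complex.log_im, hα.ne'] at hre him
  have hnorm : ‖s‖ = 1 := by
    rcases hre with h1 | h1 | h1
    · exact absurd h1 hne
    · exact h1
    · linarith [norm_nonneg s]
  by_cases hk0 : k = 0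
  · have harg : s.arg = 0 := by
      simpa [hk0, hα.ne'] using him
    rw [← Complex.norm_mul_exp_arg_mul_I s, hnorm, harg]
    simp
  · exfalso
    have habs : 2 * Real.pi / α ≤ |s.arg| := by
      have h1 : |s.arg| * α = |(k : ℝ)| * (2 * Real.pi) := by
        have h2 := congrArg abs him
        rwa [abs_neg, abs_mul, abs_mul, abs_of_pos hα, abs_of_pos Real.two_pi_pos] at h2
      have h2 : (1 : ℝ) ≤ |(k : ℝ)| := by exact_mod_cast Int.one_le_abs hk0
      rw [div_le_iff₀ hα, h1]
      nlinarith [Real.two_pi_pos]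
    have hcos : Real.cos |s.arg| ≤ Real.cos θ :=
      Real.cos_le_cos_of_nonneg_of_le_pi hθ.le (Complex.abs_arg_le_pi s)
        ((min_le_left _ _).trans habs)
    have hre' : s.re = Real.cos s.arg := by
      rw [Complex.cos_arg hne, hnorm, div_one]
    rw [Real.cos_abs, ← hre'] at hcos
    exact absurd (hcos.trans (le_max_right _ _)) (not_le.2 hs)

theorem norm_cpow_neg_le_inv_sq {β : ℝ} (hβ : 2 ≤ β) {s : ℂ} (hs : 1 ≤ ‖s‖) :
    ‖s ^ (-β : ℂ)‖ ≤ (‖s‖ ^ 2)⁻¹ := by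
  have hne : s ≠ 0 := norm_pos_iff.1 (by linarith)
  have h1 : ‖s ^ (-β : ℂ)‖ = ‖s‖ ^ (-β) := by
    rw [Complex.norm_cpow_of_ne_zero hne]; simp
  rw [h1, ← Real.rpow_two, ← Real.rpow_neg (norm_nonneg s)]
  exact Real.rpow_le_rpow_of_exponent_le hs (by linarith)

/-- The function `s^(-β)/(1 - s^(-α))` has a simple pole at `1` with residue `1/α`. So does `1/α`
times the same function with parameters `(1, 2)`, which equals `1/(s(s-1))`. Their difference is
analytic on a strip reaching to the left of `Re s = 1`. -/
theorem exists_analytic_pole_subtraction {α β : ℝ} (hα : 0 < α) (hβ : 2 ≤ β) :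
    ∃ (D : ℂ → ℂ) (a C : ℝ), 0 < a ∧ a < 1 ∧ DifferentiableOn ℂ D {s | s.re ∈ Icc a 2} ∧
      (∀ s : ℂ, s.re ∈ Icc a 2 → ‖D s‖ ≤ C * (1 + s.im ^ 2)⁻¹) ∧
      ∀ s : ℂ, s.re = 2 → D s = s ^ (-β : ℂ) / (1 - s ^ (-α : ℂ)) -
        (α : ℂ)⁻¹ * (s ^ (-(2 : ℝ) : ℂ) / (1 - s ^ (-(1 : ℝ) : ℂ))) := by
  obtain ⟨σ, hσ0, hσ1, hσ⟩ := exists_lt_one_forall_cpow_eq_one α hα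
  set U : Set ℂ := {s | σ < s.re} with hU
  have hUo : IsOpen U := isOpen_lt continuous_const Complex.continuous_re
  have h1U : (1 : ℂ) ∈ U := by simpa [hU] using hσ1
  have hUn : U ∈ 𝓝 (1 : ℂ) := hUo.mem_nhds h1U
  have hsl : ∀ s ∈ U, s ∈ Complex.slitPlane := fun s hs => Or.inl (hσ0.trans hs)
  have hne0 : ∀ s ∈ U, s ≠ 0 := fun s hs => Complex.slitPlane_ne_zero (hsl s hs)
  set g : ℂ → ℂ := fun s => 1 - s ^ (-α : ℂ) with hg
  have hgd : DifferentiableOn ℂ g U := fun s hs =>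
    ((differentiableAt_id.cpow_const (hsl s hs)).const_sub 1).differentiableWithinAt
  have hg1 : g 1 = 0 := by simp [hg]
  -- Factor `1 - s^(-α) = (s - 1) q(s)`, where `q` has no zero on `U` and `q(1) = α`.
  set q : ℂ → ℂ := dslope g 1 with hq
  have hqd : DifferentiableOn ℂ q U := (Complex.differentiableOn_dslope hUn).2 hgd
  have hq1 : q 1 = α := by
    rw [hq, dslope_same]
    have := ((hasDerivAt_id (1 : ℂ)).cpow_const (c := (-α : ℂ)) (by simp)).const_sub 1
    have h2 := this.deriv
    simp only [id_eq, Complex.one_cpow, mul_one, neg_neg] at h2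
    exact h2
  have hqg : ∀ s, (s - 1) * q s = g s := fun s => by
    have := sub_smul_dslope g 1 s
    simpa [hg1] using this
  have hqne : ∀ s ∈ U, q s ≠ 0 := fun s hs h0 => by
    by_cases h1 : s = 1
    · rw [h1, hq1] at h0
      exact hα.ne' (by exact_mod_cast h0)
    · have := hqg s
      rw [h0, mul_zero, hg] at this
      exact h1 (hσ s hs (sub_eq_zero.1 this.symm).symm)
  set P : ℂ → ℂ := fun s => s ^ (-β : ℂ) / q s - s⁻¹ / α with hP
  have hα' : (α : ℂ) ≠ 0 := by exact_mod_cast hα.ne'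
  have hPd : DifferentiableOn ℂ P U := fun s hs => by
    have h1 : DifferentiableWithinAt ℂ (fun s : ℂ => s ^ (-β : ℂ)) U s :=
      (differentiableAt_id.cpow_const (hsl s hs)).differentiableWithinAt
    have h2 : DifferentiableWithinAt ℂ (fun s : ℂ => s⁻¹) U s :=
      (differentiableAt_inv (hne0 s hs)).differentiableWithinAt
    exact (h1.div (hqd s hs) (hqne s hs)).sub (h2.div_const _)
  have hP1 : P 1 = 0 := by simp [hP, hq1]
  -- The difference of the two functions is `P(s)/(s - 1)` with `P(1) = 0`, and `dslope` fills in
  -- the removable singularity.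
  set D : ℂ → ℂ := dslope P 1 with hD
  have hDd : DifferentiableOn ℂ D U := (Complex.differentiableOn_dslope hUn).2 hPd
  have hDform : ∀ s ∈ U, s ≠ 1 → D s = s ^ (-β : ℂ) / (1 - s ^ (-α : ℂ)) -
      (α : ℂ)⁻¹ * (s⁻¹ * (s - 1)⁻¹) := fun s hs h1 => by
    have hs1 : s - 1 ≠ 0 := sub_ne_zero.2 h1
    have h2 := sub_smul_dslope P 1 s
    rw [hP1, sub_zero, smul_eq_mul] at h2
    have h3 : g s = 1 - s ^ (-α : ℂ) := rfl
    rw [← h3, ← hqg s]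
    have hqs := hqne s hs
    have hs0 := hne0 s hs
    apply mul_left_cancel₀ hs1
    rw [hD, h2]
    simp only [hP]
    field_simp
  set a : ℝ := (σ + 1) / 2 with ha
  have hsub : {s : ℂ | s.re ∈ Icc a 2} ⊆ U := fun s hs => by
    have := hs.1
    show σ < s.re
    linarith
  -- Above height `Y` one has `|s|^α ≥ 2`, so the denominator has norm at least `1/2`; below it, the
  -- strip is compact.
  set Y : ℝ := max ((2 : ℝ) ^ (1 / α)) 1 with hY
  have hY1 : 1 ≤ Y := le_max_right _ _
  have hK : IsCompact (Icc a 2 ×ℂ Icc (-Y) Y) := isCompact_Icc.reProdIm isCompact_Icc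
  obtain ⟨B, hB⟩ := hK.exists_bound_of_continuousOn
    (f := D) (hDd.continuousOn.mono fun s hs => hsub hs.1)
  have hB0 : 0 ≤ B := (norm_nonneg _).trans (hB 1 (by
    refine ⟨?_, ?_⟩ <;> simp <;> linarith))
  refine ⟨D, a, max (B * (1 + Y ^ 2)) (2 * (2 + α⁻¹)), by positivity, by linarith,
    hDd.mono hsub, fun s hs => ?_, fun s hs => ?_⟩
  · rcases le_or_gt |s.im| Y with him | him
    · have h1 := hB s ⟨hs, abs_le.1 him⟩
      have h2 : s.im ^ 2 ≤ Y ^ 2 := sq_le_sq' (abs_le.1 him).1 (abs_le.1 him).2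
      rw [← div_eq_mul_inv, le_div_iff₀ (by positivity)]
      refine le_trans ?_ (le_max_left _ _)
      gcongr
    · have hsU := hsub hs
      have hn : |s.im| ≤ ‖s‖ := Complex.abs_im_le_norm s
      have hn1 : |s.im| ≤ ‖s - 1‖ := by simpa using Complex.abs_im_le_norm (s - 1)
      have him1 : 1 < |s.im| := hY1.trans_lt him
      have him0 : 0 < |s.im| := by linarith
      have hne1 : s ≠ 1 := fun h => by simp [h] at him1; linarith
      have hne := hne0 s hsU
      have hsmall : ‖s ^ (-α : ℂ)‖ ≤ 1 / 2 := by
        have h1 : ‖s ^ (-α : ℂ)‖ = ‖s‖ ^ (-α) := by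
          rw [Complex.norm_cpow_of_ne_zero hne]; simp
        have h2 : (2 : ℝ) ^ (1 / α) ≤ ‖s‖ := (le_max_left _ _).trans (him.le.trans hn)
        rw [h1]
        calc ‖s‖ ^ (-α) ≤ ((2 : ℝ) ^ (1 / α)) ^ (-α) :=
              Real.rpow_le_rpow_of_nonpos (by positivity) h2 (by linarith)
          _ = 1 / 2 := by
              rw [← Real.rpow_mul two_pos.le]
              have : 1 / α * -α = -1 := by field_simp
              rw [this, Real.rpow_neg_one]; norm_num
      have hden : 1 / 2 ≤ ‖1 - s ^ (-α : ℂ)‖ := by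
        have := norm_sub_norm_le (1 : ℂ) (s ^ (-α : ℂ))
        rw [norm_one] at this
        linarith
      have hnum := norm_cpow_neg_le_inv_sq hβ (him1.le.trans hn)
      have h5 : (‖s‖ ^ 2)⁻¹ ≤ (|s.im| ^ 2)⁻¹ := by gcongr
      have h6 : ‖D s‖ ≤ (2 + α⁻¹) * (|s.im| ^ 2)⁻¹ := by
        rw [hDform s hsU hne1]
        refine (norm_sub_le _ _).trans ?_
        rw [norm_div, norm_mul, norm_mul, norm_inv, norm_inv, norm_inv, Complex.norm_real,
          Real.norm_of_nonneg hα.le]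
        have h7 : ‖s ^ (-β : ℂ)‖ / ‖1 - s ^ (-α : ℂ)‖ ≤ (|s.im| ^ 2)⁻¹ / (1 / 2) := by
          gcongr
          exact hnum.trans h5
        have h8 : ‖s‖⁻¹ * ‖s - 1‖⁻¹ ≤ |s.im|⁻¹ * |s.im|⁻¹ := by gcongr
        have h9 := mul_le_mul_of_nonneg_left h8 (inv_nonneg.2 hα.le)
        calc _ ≤ (|s.im| ^ 2)⁻¹ / (1 / 2) + α⁻¹ * (|s.im|⁻¹ * |s.im|⁻¹) := add_le_add h7 h9
          _ = _ := by field_simp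
      refine h6.trans ?_
      rw [sq_abs]
      have h10 : (s.im ^ 2)⁻¹ ≤ 2 * (1 + s.im ^ 2)⁻¹ := by
        have : 1 ≤ s.im ^ 2 := by rw [← sq_abs]; nlinarith
        rw [← div_eq_mul_inv, inv_eq_one_div, div_le_div_iff₀ (by positivity) (by positivity)]
        linarith
      calc (2 + α⁻¹) * (s.im ^ 2)⁻¹ ≤ (2 + α⁻¹) * (2 * (1 + s.im ^ 2)⁻¹) := by gcongr
        _ = (2 * (2 + α⁻¹)) * (1 + s.im ^ 2)⁻¹ := by ring
        _ ≤ _ := by gcongr; exact le_max_right _ _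
  · have hsU : s ∈ U := hsub (show s.re ∈ Icc a 2 from ⟨by linarith, hs.le⟩)
    have hne1 : s ≠ 1 := fun h => by rw [h] at hs; norm_num at hs
    have hne := hne0 s hsU
    rw [hDform s hsU hne1]
    congr 2
    have e2 : s ^ (-(2 : ℝ) : ℂ) = (s ^ 2)⁻¹ := by
      rw [Complex.cpow_neg]; norm_num
    have e1 : s ^ (-(1 : ℝ) : ℂ) = s⁻¹ := by
      rw [Complex.cpow_neg]; norm_num
    rw [e1, e2]
    have hs1 : s - 1 ≠ 0 := sub_ne_zero.2 hne1
    have hs2 : 1 - s⁻¹ ≠ 0 := by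
      intro h
      apply hne1
      have := sub_eq_zero.1 h
      field_simp at this
      exact this
    field_simp

/-! ### Mittag-Leffler functions and their exponential asymptotics. -/

/-- `∑ t^(αl+β-1) / Γ(αl+β)`, a Mittag-Leffler function. -/
def mittagLeffler (α β t : ℝ) : ℝ := ∑' l : ℕ, t ^ (α * l + β - 1) / Real.Gamma (α * l + β)

theorem summable_mittagLeffler_of_two_le {α β t : ℝ} (hα : 0 < α) (hβ : 2 ≤ β) (ht : 0 < t) :
    Summable fun l : ℕ => t ^ (α * l + β - 1) / Real.Gamma (α * l + β) :=
  Complex.summable_ofReal.1 (hasSum_rpow_div_Gamma hα hβ ht).summable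

/-- The explicit comparison function carrying the pole. The terms are `t^(l+1)/(l+1)!`, so only the
constant term of the exponential is missing; `β = 2` is taken because the integral representation
requires `β ≥ 2`. -/
theorem mittagLeffler_one_two (t : ℝ) : mittagLeffler 1 2 t = Real.exp t - 1 := by
  have h := NormedSpace.expSeries_div_hasSum_exp t
  rw [← Real.exp_eq_exp_ℝ] at h
  rw [← hasSum_nat_add_iff' 1] at h
  simp only [Finset.range_one, Finset.sum_singleton, pow_zero, Nat.factorial_zero, Nat.cast_one,
    div_one] at h
  rw [← h.tsum_eq, mittagLeffler]
  congr 1 with l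
  have : Real.Gamma (1 * (l : ℝ) + 2) = (l + 1).factorial := by
    rw [← Real.Gamma_nat_eq_factorial]; congr 1; push_cast; ring
  rw [this, ← Real.rpow_natCast]
  congr 2
  push_cast; ring

theorem integrable_vline_kernel {α β : ℝ} (hα : 0 < α) (hβ : 2 ≤ β) (t : ℝ) :
    Integrable fun ξ : ℝ =>
      vline 2 ξ ^ (-β : ℂ) / (1 - vline 2 ξ ^ (-α : ℂ)) * Complex.exp (vline 2 ξ * t) := by
  have hlt : (2 : ℝ) ^ (-α) < 1 :=
    Real.rpow_lt_one_of_one_lt_of_neg one_lt_two (by linarith)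
  have hden : ∀ ξ : ℝ, 1 - (2 : ℝ) ^ (-α) ≤ ‖1 - vline 2 ξ ^ (-α : ℂ)‖ := fun ξ => by
    have h1 := norm_sub_norm_le (1 : ℂ) (vline 2 ξ ^ (-α : ℂ))
    have h2 := norm_vline_cpow two_pos ξ (-α)
    push_cast at h2
    rw [norm_one, h2] at h1
    have h3 : ‖vline 2 ξ‖ ^ (-α) ≤ (2 : ℝ) ^ (-α) :=
      Real.rpow_le_rpow_of_nonpos two_pos (two_le_norm_vline_two ξ) (by linarith)
    linarith
  have hpos : 0 < 1 - (2 : ℝ) ^ (-α) := by linarith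
  have hne : ∀ ξ : ℝ, 1 - vline 2 ξ ^ (-α : ℂ) ≠ 0 := fun ξ =>
    norm_pos_iff.1 (hpos.trans_le (hden ξ))
  refine ((integrable_inv_one_add_sq.const_mul ((2 : ℝ) ^ (2 - β))).mul_const
    ((1 - (2 : ℝ) ^ (-α))⁻¹ * Real.exp (2 * t))).mono' ?_ (Eventually.of_forall fun ξ => ?_)
  · exact (((continuous_vline_cpow two_pos _).div
      (continuous_const.sub (continuous_vline_cpow two_pos _)) hne).mul
      (Complex.continuous_exp.comp ((continuous_vline 2).mul
        continuous_const))).aestronglyMeasurable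
  · rw [norm_mul, norm_div, Complex.norm_exp, Complex.re_mul_ofReal, vline_re, div_eq_mul_inv,
      mul_assoc]
    gcongr
    · exact norm_vline_two_cpow_le hβ ξ
    · exact hden ξ

/-- After subtracting `(e^t - 1)/α`, the integrand over `Re s = 2` is `D(s) e^(st)`. It can be moved
to `Re s = a < 1`, where it is bounded by `e^(at)` times an integrable function. -/
theorem mittagLeffler_asymptotics_of_two_le {α β : ℝ} (hα : 0 < α) (hβ : 2 ≤ β) :
    ∃ a C : ℝ, 0 < a ∧ a < 1 ∧ 0 ≤ C ∧ ∀ t : ℝ, 0 < t →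
      |mittagLeffler α β t - Real.exp t / α| ≤ C * Real.exp (a * t) := by
  obtain ⟨D, a, C, ha0, ha1, hDd, hDC, hD⟩ := exists_analytic_pole_subtraction hα hβ
  have hC0 : 0 ≤ C := by
    have := (norm_nonneg _).trans (hDC (a : ℂ) (by simpa using by linarith))
    simpa using this
  set J : ℝ := ∫ ξ : ℝ, C * (1 + ξ ^ 2)⁻¹ with hJ
  have hJ0 : 0 ≤ J := integral_nonneg fun ξ => by positivity
  -- The extra `1/α` absorbs the constant in `e^t - 1`.
  refine ⟨a, J + 1 / α, ha0, ha1, by positivity, fun t ht => ?_⟩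
  have h1 := hasSum_rpow_div_Gamma hα hβ ht
  have h2 := hasSum_rpow_div_Gamma one_pos (le_refl (2 : ℝ)) ht
  have hshift := integral_vline_eq_integral_vline (by linarith : a ≤ 2) t hDd hDC
  set I1 := ∫ ξ : ℝ, vline 2 ξ ^ (-β : ℂ) / (1 - vline 2 ξ ^ (-α : ℂ)) *
        Complex.exp (vline 2 ξ * t) with hI1
  have e1 : I1 = (mittagLeffler α β t : ℂ) := by
    rw [← h1.tsum_eq, mittagLeffler, Complex.ofReal_tsum]
  have e2 : (∫ ξ : ℝ, vline 2 ξ ^ (-(2 : ℝ) : ℂ) / (1 - vline 2 ξ ^ (-(1 : ℝ) : ℂ)) *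
        Complex.exp (vline 2 ξ * t)) = (Real.exp t - 1 : ℝ) := by
    rw [← h2.tsum_eq, ← mittagLeffler_one_two t, mittagLeffler, Complex.ofReal_tsum]
  have e3 : ∫ ξ : ℝ, D (vline 2 ξ) * Complex.exp (vline 2 ξ * t) =
      I1 - (α : ℂ)⁻¹ * (Real.exp t - 1 : ℝ) := by
    rw [← e2, hI1, ← integral_const_mul, ← integral_sub (integrable_vline_kernel hα hβ t)
      ((integrable_vline_kernel one_pos le_rfl t).const_mul _)]
    congr 1 with ξ
    rw [hD _ (vline_re 2 ξ)]
    ring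
  have hbound : ‖∫ ξ : ℝ, D (vline a ξ) * Complex.exp (vline a ξ * t)‖ ≤ J * Real.exp (a * t) := by
    rw [hJ, ← integral_mul_const]
    refine norm_integral_le_of_norm_le ((integrable_inv_one_add_sq.const_mul C).mul_const _)
      (Eventually.of_forall fun ξ => ?_)
    rw [norm_mul, Complex.norm_exp, Complex.re_mul_ofReal, vline_re]
    have h := hDC (vline a ξ) (by simpa using by linarith)
    have h' : (1 + (vline a ξ).im ^ 2)⁻¹ ≤ (1 + ξ ^ 2)⁻¹ := by
      refine inv_anti₀ (by positivity) ?_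
      rw [vline_im]
      nlinarith [Real.pi_gt_three, sq_nonneg ξ, mul_nonneg (sq_nonneg ξ)
        (by nlinarith [Real.pi_gt_three] : (0 : ℝ) ≤ 4 * Real.pi ^ 2 - 1)]
    gcongr
    exact h.trans (by gcongr)
  rw [← hshift, e3, e1] at hbound
  have hb : |mittagLeffler α β t - α⁻¹ * (Real.exp t - 1)| ≤ J * Real.exp (a * t) := by
    rw [← Complex.ofReal_inv, ← Complex.ofReal_mul, ← Complex.ofReal_sub, 
      Complex.norm_real] at hbound
    exact hbound
  have h1e : 1 ≤ Real.exp (a * t) := Real.one_le_exp (by positivity)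
  have e4 : mittagLeffler α β t - Real.exp t / α =
      (mittagLeffler α β t - α⁻¹ * (Real.exp t - 1)) + -(1 / α) := by ring
  rw [e4]
  refine (abs_add_le _ _).trans ?_
  rw [abs_neg, abs_of_pos (by positivity : 0 < 1 / α), add_mul]
  refine add_le_add hb ?_
  exact le_mul_of_one_le_right (by positivity) h1e

theorem exists_rpow_le_exp {p σ : ℝ} (hσ : 0 < σ) :
    ∃ C : ℝ, 0 ≤ C ∧ ∀ t : ℝ, 1 ≤ t → t ^ p ≤ C * Real.exp (σ * t) := by
  obtain ⟨N, hN⟩ := exists_nat_ge p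
  refine ⟨N.factorial / σ ^ N, by positivity, fun t ht => ?_⟩
  have h1 : t ^ p ≤ t ^ N := by
    rw [← Real.rpow_natCast]
    exact Real.rpow_le_rpow_of_exponent_le ht hN
  have h2 := Real.pow_div_factorial_le_exp (σ * t) (by positivity) N
  rw [div_le_iff₀ (by positivity), mul_pow] at h2
  rw [div_mul_eq_mul_div, le_div_iff₀ (by positivity)]
  nlinarith [pow_pos hσ N]

/-- Dropping `k` initial terms replaces `β` by `β + αk`, which reduces any real `β` to the case `β ≥
2`. -/
theorem mittagLeffler_shift {α β t : ℝ} (k : ℕ) :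
    (fun l : ℕ => t ^ (α * (l + k : ℕ) + β - 1) / Real.Gamma (α * (l + k : ℕ) + β)) =
      fun l : ℕ => t ^ (α * l + (β + α * k) - 1) / Real.Gamma (α * l + (β + α * k)) := by
  funext l
  have : α * ((l + k : ℕ) : ℝ) + β = α * l + (β + α * k) := by push_cast; ring
  rw [this]

theorem exists_nat_two_le_add_mul {α : ℝ} (hα : 0 < α) (β : ℝ) : ∃ k : ℕ, 2 ≤ β + α * k := by
  obtain ⟨k, hk⟩ := exists_nat_ge ((2 - β) / α)
  refine ⟨k, ?_⟩
  rw [div_le_iff₀ hα] at hk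
  linarith

theorem summable_mittagLeffler {α t : ℝ} (hα : 0 < α) (β : ℝ) (ht : 0 < t) :
    Summable fun l : ℕ => t ^ (α * l + β - 1) / Real.Gamma (α * l + β) := by
  obtain ⟨k, hk⟩ := exists_nat_two_le_add_mul hα β
  rw [← summable_nat_add_iff k, mittagLeffler_shift]
  exact summable_mittagLeffler_of_two_le hα hk ht

/-- The Mittag-Leffler function is `exp t / α` up to an exponentially smaller error. -/
theorem mittagLeffler_asymptotics {α : ℝ} (hα : 0 < α) (β : ℝ) :
    ∃ a C : ℝ, 0 < a ∧ a < 1 ∧ 0 ≤ C ∧ ∀ t : ℝ, 1 ≤ t →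
      |mittagLeffler α β t - Real.exp t / α| ≤ C * Real.exp (a * t) := by
  obtain ⟨k, hk⟩ := exists_nat_two_le_add_mul hα β
  obtain ⟨a, C, ha0, ha1, hC0, h⟩ := mittagLeffler_asymptotics_of_two_le hα hk
  -- The dropped terms are powers of `t`, possibly negative ones; for `t ≥ 1` each is dominated by
  -- `e^(at)`.
  choose B hB0 hB using fun l : ℕ => exists_rpow_le_exp (p := α * l + β - 1) ha0
  refine ⟨a, (∑ l ∈ Finset.range k, B l * |(Real.Gamma (α * l + β))⁻¹|) + C, ha0, ha1,
    add_nonneg (Finset.sum_nonneg fun l _ => mul_nonneg (hB0 l) (abs_nonneg _)) hC0,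
    fun t ht => ?_⟩
  have ht0 : 0 < t := by linarith
  have e : mittagLeffler α β t = (∑ l ∈ Finset.range k,
      t ^ (α * l + β - 1) / Real.Gamma (α * l + β)) + mittagLeffler α (β + α * k) t := by
    rw [mittagLeffler, mittagLeffler, ← mittagLeffler_shift,
      (summable_mittagLeffler hα β ht0).sum_add_tsum_nat_add k]
  rw [e, add_sub_assoc, add_mul, Finset.sum_mul]
  refine (abs_add_le _ _).trans (add_le_add ?_ (h t ht0))
  refine (Finset.abs_sum_le_sum_abs _ _).trans (Finset.sum_le_sum fun l _ => ?_)
  rw [div_eq_mul_inv, abs_mul, abs_of_nonneg (Real.rpow_nonneg ht0.le _), mul_right_comm]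
  gcongr
  exact hB l t ht

/-! ### The dimension polynomial and the coefficients `b_j`. -/

open Polynomial in
/-- Expansion of a polynomial of degree at most `d` in the basis
`(x + j + 1) ⋯ (x + d)`, `0 ≤ j ≤ d`. -/
theorem exists_shifted_factorial_expansion (d : ℕ) : ∀ P : ℝ[X], P.natDegree ≤ d →
    ∃ b : ℕ → ℝ,
      (∀ x : ℝ, P.eval x =
        ∑ j ∈ Finset.range (d + 1), b j * ∏ i ∈ Finset.Ico (j + 1) (d + 1), (x + i)) ∧
      b 0 = P.coeff d ∧
      (1 ≤ d → P.coeff (d - 1) = b 1 + b 0 * (d * (d + 1) / 2)) ∧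
      b d = P.eval (-(d : ℝ)) := by
  induction d with
  | zero =>
    intro P hP
    refine ⟨fun _ => P.coeff 0, fun x => ?_, rfl, by simp, ?_⟩
    · rw [eq_C_of_natDegree_le_zero hP]; simp
    · rw [eq_C_of_natDegree_le_zero hP]; simp
  | succ d ih =>
    intro P hP
    set c : ℝ := ((d + 1 : ℕ) : ℝ) with hc
    set e : ℝ := P.eval (-c) with he
    -- Division by `X + (d+1)`: the remainder is the new last coefficient, and multiplying the
    -- expansion of the quotient by `x + d + 1` appends the missing factor to each product.
    set Q : ℝ[X] := P /ₘ (X - C (-c)) with hQ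
    have hPQ : P = (X + C c) * Q + C e := by
      have h := modByMonic_add_div P (X - C (-c))
      rw [modByMonic_X_sub_C_eq_C_eval] at h
      rw [← hQ, ← he, C_neg, sub_neg_eq_add] at h
      rw [← h]
      ring
    have hQd : Q.natDegree ≤ d := by
      rw [hQ, natDegree_divByMonic _ (monic_X_sub_C _), natDegree_X_sub_C]
      omega
    obtain ⟨b, hb, hb0, hb1, -⟩ := ih Q hQd
    have hcoef : ∀ i, P.coeff (i + 1) = Q.coeff i + c * Q.coeff (i + 1) := fun i => by
      rw [hPQ]
      simp [add_mul]
    have hQ0 : Q.coeff (d + 1) = 0 := coeff_eq_zero_of_natDegree_lt (by omega)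
    refine ⟨fun j => if j = d + 1 then e else b j, fun x => ?_, ?_, fun _ => ?_, ?_⟩
    · rw [Finset.sum_range_succ]
      simp only [if_true, Finset.Ico_self, Finset.prod_empty, mul_one]
      have : ∀ j ∈ Finset.range (d + 1), (if j = d + 1 then e else b j) *
          ∏ i ∈ Finset.Ico (j + 1) (d + 1 + 1), (x + (i : ℝ)) =
          (x + c) * (b j * ∏ i ∈ Finset.Ico (j + 1) (d + 1), (x + (i : ℝ))) := fun j hj => by
        have hj' := Finset.mem_range.1 hj
        rw [if_neg (by omega), Finset.prod_Ico_succ_top (by omega)]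
        ring
      rw [Finset.sum_congr rfl this, ← Finset.mul_sum, ← hb x]
      conv_lhs => rw [hPQ]
      simp
    · show (if 0 = d + 1 then e else b 0) = _
      rw [if_neg (by omega), hb0, hcoef, hQ0]; simp
    -- For `d = 0` the coefficient of index `1` is the remainder itself, so the inductive formula
    -- says nothing there.
    · rcases Nat.eq_zero_or_pos d with rfl | hd
      · simp only [zero_add, if_true, zero_ne_one, if_false, hb0]
        have h0 : P.coeff 0 = c * Q.coeff 0 + e := by
          conv_lhs => rw [hPQ]
          simp [mul_coeff_zero]
        simp [h0, hc]
        ring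
      · have h1 := hb1 hd
        obtain ⟨d', rfl⟩ : ∃ d', d = d' + 1 := ⟨d - 1, by omega⟩
        have hn0 : ¬ (0 = d' + 1 + 1) := by omega
        have hn1 : ¬ (1 = d' + 1 + 1) := by omega
        simp only [Nat.add_sub_cancel, if_neg hn0, if_neg hn1] at h1 ⊢
        rw [hcoef, h1, ← hb0, hc]
        push_cast
        ring
    · simp [he]

/-- The dimension of the space of homogeneous polynomials of degree `l` on the Kepler manifold
in `ℂ^(k+3)`. -/
def keplerDim (k l : ℕ) : ℝ :=
  (2 * l + k + 1) * (∏ i ∈ Finset.range k, ((l : ℝ) + (i + 1))) / (k + 1).factorial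

theorem keplerDim_pos (k l : ℕ) : 0 < keplerDim k l := by
  unfold keplerDim
  have : 0 < ∏ i ∈ Finset.range k, ((l : ℝ) + (i + 1)) := Finset.prod_pos fun i _ => by positivity
  positivity

-- In `x = l/m` the dimension is a constant times a monic `∏ (x + a_i)`. Its next coefficient is `∑
-- a_i = (k+1)²/(2m)`, and subtracting `1 + ⋯ + (k+1)` gives `b 1`. The factor `2l + k + 1` has the
-- root `x = -(k+1)/(2m)`; for `m = 1/2` this is `-(k+1)`, the point at which evaluation yields the
-- last coefficient.
open Polynomial in
theorem exists_keplerDim_expansion (k : ℕ) {m : ℝ} (hm : 0 < m) :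
    ∃ b : ℕ → ℝ,
      (∀ l : ℕ, keplerDim k l = 2 * m ^ (k + 1) / (k + 1).factorial *
        ∑ j ∈ Finset.range (k + 2), b j * ∏ i ∈ Finset.Ico (j + 1) (k + 2), (l / m + i)) ∧
      b 0 = 1 ∧
      b 1 = ((k : ℝ) + 1) ^ 2 / (2 * m) - (k + 1) * (k + 2) / 2 ∧
      (m = 1 / 2 → b (k + 1) = 0) := by
  -- Index `k` holds the exceptional factor `2l + k + 1`; the others come from the product in
  -- `keplerDim`.
  set a : ℕ → ℝ := fun i => if i = k then (k + 1) / (2 * m) else (i + 1) / m with ha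
  set P : ℝ[X] := ∏ i ∈ Finset.range (k + 1), (X + C (a i)) with hP
  have hmon : P.Monic := monic_prod_of_monic _ _ fun i _ => monic_X_add_C _
  have hdeg : P.natDegree = k + 1 := by
    rw [hP, natDegree_prod_of_monic _ _ fun i _ => monic_X_add_C _]
    simp
  have hnext : P.coeff k = ∑ i ∈ Finset.range (k + 1), a i := by
    have h1 : P.nextCoeff = ∑ i ∈ Finset.range (k + 1), (X + C (a i)).nextCoeff :=
      Monic.nextCoeff_prod _ _ fun i _ => monic_X_add_C _
    rw [nextCoeff_of_natDegree_pos (by omega), hdeg] at h1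
    simpa using h1
  have hpi : ∀ x : ℝ, P.eval x = (x + (k + 1) / (2 * m)) *
      ∏ i ∈ Finset.range k, (x + (i + 1) / m) := fun x => by
    rw [hP, eval_prod, Finset.prod_range_succ, mul_comm]
    congr 1
    · simp [ha]
    · refine Finset.prod_congr rfl fun i hi => ?_
      have : i ≠ k := (Finset.mem_range.1 hi).ne
      simp [ha, this]
  obtain ⟨b, hb, hb0, hb1, hbd⟩ := exists_shifted_factorial_expansion (k + 1) P hdeg.le
  have hb0' : b 0 = 1 := by rw [hb0, ← hdeg]; exact hmon
  refine ⟨b, fun l => ?_, hb0', ?_, fun hm2 => ?_⟩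
  · rw [← hb, hpi, keplerDim]
    have : ∀ i ∈ Finset.range k, ((l : ℝ) / m + (i + 1) / m) = m⁻¹ * (l + (i + 1)) :=
      fun i _ => by field_simp
    rw [Finset.prod_congr rfl this, Finset.prod_mul_distrib, Finset.prod_const, Finset.card_range,
      inv_pow, pow_succ]
    field_simp
    ring
  · have h1 := hb1 (by omega)
    rw [Nat.add_sub_cancel, hnext, hb0', Finset.sum_range_succ] at h1
    have h2 : ∑ i ∈ Finset.range k, a i = k * (k + 1) / 2 / m := by
      have : ∀ i ∈ Finset.range k, a i = ((i + 1 : ℕ) : ℝ) / m := fun i hi => by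
        have : i ≠ k := (Finset.mem_range.1 hi).ne
        simp [ha, this]
      rw [Finset.sum_congr rfl this, ← Finset.sum_div]
      congr 1
      clear * -
      induction k with
      | zero => simp
      | succ k ih => rw [Finset.sum_range_succ, ih]; push_cast; ring
    rw [h2] at h1
    have h3 : b 1 = k * (k + 1) / 2 / m + a k - 1 * ((k + 1 : ℕ) * ((k + 1 : ℕ) + 1) / 2) := by
      linarith
    rw [h3]
    simp only [ha, if_true]
    push_cast
    field_simp
    ring
  · rw [hbd, hpi, hm2]
    push_cast
    ring

theorem Gamma_add_eq_prod_Ico {p : ℝ} (hp : 0 ≤ p) (j d : ℕ) (hjd : j ≤ d) :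
    Real.Gamma (p + (d + 1)) =
      (∏ i ∈ Finset.Ico (j + 1) (d + 1), (p + i)) * Real.Gamma (p + (j + 1)) := by
  induction d, hjd using Nat.le_induction with
  | base => simp
  | succ d hd ih =>
    rw [Finset.prod_Ico_succ_top (by omega)]
    have : p + (((d + 1 : ℕ) : ℝ) + 1) = (p + (d + 1)) + 1 := by push_cast; ring
    rw [this, Real.Gamma_add_one (by positivity), ih]
    push_cast
    ring

/-- The reason for the choice of basis: each product is the quotient `Γ(x + k + 2)/Γ(x + j + 1)` at
`x = l/m`. -/
theorem keplerDim_div_Gamma {k : ℕ} {m : ℝ} (hm : 0 < m) {b : ℕ → ℝ} {l : ℕ}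
    (hb : keplerDim k l = 2 * m ^ (k + 1) / (k + 1).factorial *
        ∑ j ∈ Finset.range (k + 2), b j * ∏ i ∈ Finset.Ico (j + 1) (k + 2), (l / m + i)) :
    keplerDim k l / Real.Gamma (l / m + (k + 2)) = 2 * m ^ (k + 1) / (k + 1).factorial *
      ∑ j ∈ Finset.range (k + 2), b j / Real.Gamma (l / m + (j + 1)) := by
  rw [hb, mul_div_assoc, Finset.sum_div]
  congr 1
  refine Finset.sum_congr rfl fun j hj => ?_
  have hj' := Finset.mem_range.1 hj
  have h := Gamma_add_eq_prod_Ico (p := l / m) (by positivity) j (k + 1) (by omega)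
  have e : (l : ℝ) / m + (k + 2) = l / m + ((k + 1 : ℕ) + 1) := by push_cast; ring
  have h0 : 0 < ∏ i ∈ Finset.Ico (j + 1) (k + 2), ((l : ℝ) / m + i) :=
    Finset.prod_pos fun i hi => by
      have : 1 ≤ i := by have := (Finset.mem_Ico.1 hi).1; omega
      positivity
  have hG : 0 < Real.Gamma ((l : ℝ) / m + (j + 1)) := Real.Gamma_pos_of_pos (by positivity)
  rw [e, h, mul_comm (∏ i ∈ _, _), mul_div_mul_right _ _ h0.ne']

/-- Writing `T^(l/m) = T^(-j) T^(l/m + j)` produces Mittag-Leffler terms with `α = 1/m` and `β = j +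
1`. -/
theorem hasSum_keplerDim_series {k : ℕ} {m T : ℝ} (hm : 0 < m) (hT : 0 < T) {b : ℕ → ℝ}
    (hb : ∀ l : ℕ, keplerDim k l = 2 * m ^ (k + 1) / (k + 1).factorial *
        ∑ j ∈ Finset.range (k + 2), b j * ∏ i ∈ Finset.Ico (j + 1) (k + 2), (l / m + i)) :
    HasSum (fun l : ℕ => T ^ ((l : ℝ) / m) * (keplerDim k l / Real.Gamma (l / m + (k + 2))))
      (2 * m ^ (k + 1) / (k + 1).factorial *
        ∑ j ∈ Finset.range (k + 2), b j / T ^ j * mittagLeffler m⁻¹ (j + 1) T) := by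
  have h : ∀ j ∈ Finset.range (k + 2), HasSum
      (fun l : ℕ => b j / T ^ j * (T ^ (m⁻¹ * l + ((j : ℝ) + 1) - 1) /
        Real.Gamma (m⁻¹ * l + (j + 1)))) (b j / T ^ j * mittagLeffler m⁻¹ (j + 1) T) :=
    fun j _ => (summable_mittagLeffler (inv_pos.2 hm) _ hT).hasSum.mul_left _
  have hterm : (fun l : ℕ => T ^ ((l : ℝ) / m) *
      (keplerDim k l / Real.Gamma (l / m + (k + 2)))) = fun l : ℕ =>
      2 * m ^ (k + 1) / (k + 1).factorial * ∑ j ∈ Finset.range (k + 2), b j / T ^ j *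
        (T ^ (m⁻¹ * l + ((j : ℝ) + 1) - 1) / Real.Gamma (m⁻¹ * l + (j + 1))) := by
    funext l
    rw [keplerDim_div_Gamma hm (hb l), mul_left_comm, Finset.mul_sum]
    congr 1
    refine Finset.sum_congr rfl fun j _ => ?_
    have e1 : m⁻¹ * (l : ℝ) + ((j : ℝ) + 1) - 1 = l / m + j := by ring
    have e2 : m⁻¹ * (l : ℝ) + ((j : ℝ) + 1) = l / m + (j + 1) := by ring
    rw [e1, e2, Real.rpow_add hT, Real.rpow_natCast]
    field_simp
  rw [hterm]
  exact (hasSum_sum h).mul_left _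

/-- Asymptotics of the Kepler series, with exponentially small remainder. -/
theorem keplerDim_series_asymptotics {k : ℕ} {m : ℝ} (hm : 0 < m) {b : ℕ → ℝ}
    (hb : ∀ l : ℕ, keplerDim k l = 2 * m ^ (k + 1) / (k + 1).factorial *
        ∑ j ∈ Finset.range (k + 2), b j * ∏ i ∈ Finset.Ico (j + 1) (k + 2), (l / m + i)) :
    ∃ a C : ℝ, 0 < a ∧ a < 1 ∧ 0 ≤ C ∧ ∀ T : ℝ, 1 ≤ T →
      |(∑' l : ℕ, T ^ ((l : ℝ) / m) * (keplerDim k l / Real.Gamma (l / m + (k + 2)))) -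
        2 * m ^ (k + 2) / (k + 1).factorial * Real.exp T *
          ∑ j ∈ Finset.range (k + 2), b j / T ^ j| ≤ C * Real.exp (a * T) := by
  choose a C ha0 ha1 hC0 h using fun j : ℕ => mittagLeffler_asymptotics (inv_pos.2 hm) ((j : ℝ) + 1)
  -- The worst of the finitely many rates is still below `1`.
  set A : ℝ := (Finset.range (k + 2)).sup' ⟨0, by simp⟩ a with hA
  have haA : ∀ j ∈ Finset.range (k + 2), a j ≤ A := fun j hj => Finset.le_sup' a hj
  have hA1 : A < 1 := (Finset.sup'_lt_iff _).2 fun j _ => ha1 j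
  have hA0 : 0 < A := (ha0 0).trans_le (haA 0 (by simp))
  set c0 : ℝ := 2 * m ^ (k + 1) / (k + 1).factorial with hc0
  have hc0' : 0 ≤ c0 := by positivity
  refine ⟨A, c0 * ∑ j ∈ Finset.range (k + 2), |b j| * C j, hA0, hA1,
    mul_nonneg hc0' (Finset.sum_nonneg fun j _ => mul_nonneg (abs_nonneg _) (hC0 j)),
    fun T hT => ?_⟩
  have hT0 : 0 < T := by linarith
  rw [(hasSum_keplerDim_series hm hT0 hb).tsum_eq]
  -- Dividing `e^T` by `α = m⁻¹` supplies the additional factor `m` in the leading constant.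
  have e : c0 * (∑ j ∈ Finset.range (k + 2), b j / T ^ j * mittagLeffler m⁻¹ (j + 1) T) -
      2 * m ^ (k + 2) / (k + 1).factorial * Real.exp T * ∑ j ∈ Finset.range (k + 2), b j / T ^ j =
      c0 * ∑ j ∈ Finset.range (k + 2), b j / T ^ j *
        (mittagLeffler m⁻¹ (j + 1) T - Real.exp T / m⁻¹) := by
    simp_rw [mul_sub, Finset.sum_sub_distrib, ← Finset.sum_mul]
    rw [hc0]
    field_simp
    ring
  rw [e, abs_mul, abs_of_nonneg hc0', mul_assoc, Finset.sum_mul]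
  refine mul_le_mul_of_nonneg_left ?_ hc0'
  refine (Finset.abs_sum_le_sum_abs _ _).trans (Finset.sum_le_sum fun j hj => ?_)
  rw [abs_mul, abs_div, abs_of_pos (pow_pos hT0 j), mul_assoc]
  have h1 : |b j| / T ^ j ≤ |b j| := div_le_self (abs_nonneg _) (one_le_pow₀ hT)
  refine mul_le_mul h1 ((h j T hT).trans ?_) (abs_nonneg _) (abs_nonneg _)
  have := haA j hj
  have := hC0 j
  gcongr

/-! ### The orthogonal group action -/

theorem orthAct_apply {n : ℕ} (g : RealOrthogonal (n + 1)) (z : KSpace n) (i : Fin (n + 1)) :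
    orthAct n g z i = ∑ j, ((g.1 i j : ℝ) : ℂ) * z j := rfl

theorem orthAct_eq_mulVec {n : ℕ} (g : RealOrthogonal (n + 1)) (z : KSpace n) :
    orthAct n g z = WithLp.toLp 2 ((g.1.map (algebraMap ℝ ℂ)).mulVec z.ofLp) := rfl

theorem orthAct_mul {n : ℕ} (g h : RealOrthogonal (n + 1)) (z : KSpace n) :
    orthAct n (g * h) z = orthAct n g (orthAct n h z) := by
  simp only [orthAct_eq_mulVec, Matrix.mulVec_mulVec]
  rw [← Matrix.map_mul]
  rfl

theorem orthAct_one {n : ℕ} (z : KSpace n) : orthAct n 1 z = z := by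
  rw [orthAct_eq_mulVec]
  simp

theorem orthAct_add {n : ℕ} (g : RealOrthogonal (n + 1)) (z w : KSpace n) :
    orthAct n g (z + w) = orthAct n g z + orthAct n g w := by
  simp only [orthAct_eq_mulVec, WithLp.ofLp_add, Matrix.mulVec_add, WithLp.toLp_add]

theorem orthAct_smul {n : ℕ} (g : RealOrthogonal (n + 1)) (c : ℂ) (z : KSpace n) :
    orthAct n g (c • z) = c • orthAct n g z := by
  simp only [orthAct_eq_mulVec, WithLp.ofLp_smul, Matrix.mulVec_smul, WithLp.toLp_smul]

theorem orthAct_dotProduct {n : ℕ} (g : RealOrthogonal (n + 1)) (z w : KSpace n) :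
    ∑ i, orthAct n g z i * orthAct n g w i = ∑ i, z i * w i := by
  have h : (g.1.map (algebraMap ℝ ℂ)).transpose * g.1.map (algebraMap ℝ ℂ) = 1 := by
    have h1 : star g.1 * g.1 = 1 := (Unitary.mem_iff.1 g.2).1
    rw [Matrix.star_eq_conjTranspose, Matrix.conjTranspose_eq_transpose_of_trivial] at h1
    rw [← Matrix.transpose_map, ← Matrix.map_mul, h1]
    simp
  change (g.1.map (algebraMap ℝ ℂ)).mulVec z.ofLp ⬝ᵥ (g.1.map (algebraMap ℝ ℂ)).mulVec w.ofLp = _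
  rw [Matrix.dotProduct_mulVec, Matrix.vecMul_mulVec, h, Matrix.vecMul_one]
  rfl

theorem orthAct_conj {n : ℕ} (g : RealOrthogonal (n + 1)) (z : KSpace n) (i : Fin (n + 1)) :
    starRingEnd ℂ (orthAct n g z i) =
      orthAct n g (WithLp.toLp 2 fun j => starRingEnd ℂ (z j)) i := by
  simp [orthAct_apply]

/-- Real matrices commute with conjugation, so the Hermitian product reduces to the invariant
bilinear form. -/
theorem inner_orthAct {n : ℕ} (g : RealOrthogonal (n + 1)) (z w : KSpace n) :
    inner ℂ (orthAct n g z) (orthAct n g w) = inner ℂ z w := by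
  simp only [PiLp.inner_apply, RCLike.inner_apply, orthAct_conj]
  rw [orthAct_dotProduct]

theorem norm_orthAct {n : ℕ} (g : RealOrthogonal (n + 1)) (z : KSpace n) :
    ‖orthAct n g z‖ = ‖z‖ := by
  rw [@norm_eq_sqrt_re_inner ℂ, @norm_eq_sqrt_re_inner ℂ _ _ _ _ z, inner_orthAct]

theorem continuous_orthAct {n : ℕ} (z : KSpace n) : Continuous fun g => orthAct n g z := by
  unfold orthAct
  refine (PiLp.continuous_toLp 2 _).comp (continuous_pi fun i => ?_)
  refine continuous_finsetSum _ fun j _ => ?_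
  have : Continuous fun g : RealOrthogonal (n + 1) => g.1 i j :=
    (continuous_apply j).comp ((continuous_apply i).comp continuous_subtype_val)
  exact (Complex.continuous_ofReal.comp this).mul continuous_const

theorem differentiable_orthAct {n : ℕ} (g : RealOrthogonal (n + 1)) :
    Differentiable ℂ (orthAct n g) := by
  let L : KSpace n →ₗ[ℂ] KSpace n :=
    { toFun := orthAct n g, map_add' := orthAct_add g, map_smul' := orthAct_smul g }
  exact (LinearMap.toContinuousLinearMap L).differentiable

theorem orthAct_mem_keplerManifold {n : ℕ} (g : RealOrthogonal (n + 1)) {z : KSpace n}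
    (hz : z ∈ keplerManifold n) : orthAct n g z ∈ keplerManifold n :=
  ⟨(orthAct_dotProduct g z z).trans hz.1, fun h => hz.2 (by
    rw [← norm_eq_zero, ← norm_orthAct g, h, norm_zero])⟩

theorem smul_mem_keplerManifold {n : ℕ} {c : ℂ} (hc : c ≠ 0) {z : KSpace n}
    (hz : z ∈ keplerManifold n) : c • z ∈ keplerManifold n := by
  refine ⟨?_, smul_ne_zero hc hz.2⟩
  have : ∀ i, (c • z) i * (c • z) i = c ^ 2 * (z i * z i) := fun i => by
    simp only [PiLp.smul_apply, smul_eq_mul]; ring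
  rw [Finset.sum_congr rfl fun i _ => this i, ← Finset.mul_sum, hz.1, mul_zero]

/-! ### Rotations in coordinate planes -/

/-- The rotation by the angle `t` in the plane of the coordinates `p`, `q`, as a matrix. -/
def planeRotation {N : ℕ} (p q : Fin N) (t : ℝ) : Matrix (Fin N) (Fin N) ℝ :=
  1 + (Real.cos t - 1) • (Matrix.single p p 1 + Matrix.single q q 1) +
    Real.sin t • (Matrix.single q p 1 - Matrix.single p q 1)

theorem planeRotation_mul {N : ℕ} {p q : Fin N} (hpq : p ≠ q) (s t : ℝ) :
    planeRotation p q s * planeRotation p q t = planeRotation p q (s + t) := by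
  have hqp := hpq.symm
  simp only [planeRotation, Real.cos_add, Real.sin_add, add_mul, mul_add, one_mul, mul_one,
    Matrix.smul_mul, Matrix.mul_smul, mul_sub, sub_mul, Matrix.single_mul_single_same,
    Matrix.single_mul_single_of_ne _ _ _ _ hpq, Matrix.single_mul_single_of_ne _ _ _ _ hqp,
    smul_add, smul_sub]
  module

theorem planeRotation_zero {N : ℕ} (p q : Fin N) : planeRotation p q 0 = 1 := by
  simp [planeRotation]

theorem planeRotation_transpose {N : ℕ} (p q : Fin N) (t : ℝ) :
    (planeRotation p q t).transpose = planeRotation p q (-t) := by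
  simp only [planeRotation, Matrix.transpose_add, Matrix.transpose_smul, Matrix.transpose_sub,
    Matrix.transpose_single, Matrix.transpose_one, Real.cos_neg, Real.sin_neg]
  module

/-- The rotation by the angle `t` in the plane of the coordinates `p`, `q`. -/
def orthRotation {N : ℕ} (p q : Fin N) (hpq : p ≠ q) (t : ℝ) : RealOrthogonal N :=
  ⟨planeRotation p q t, by
    rw [Unitary.mem_iff, Matrix.star_eq_conjTranspose,
      Matrix.conjTranspose_eq_transpose_of_trivial, planeRotation_transpose,
      planeRotation_mul hpq, planeRotation_mul hpq]
    simp [planeRotation_zero]⟩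

theorem orthRotation_add {N : ℕ} {p q : Fin N} (hpq : p ≠ q) (s t : ℝ) :
    orthRotation p q hpq (s + t) = orthRotation p q hpq s * orthRotation p q hpq t :=
  Subtype.ext (planeRotation_mul hpq s t).symm

theorem orthRotation_zero {N : ℕ} {p q : Fin N} (hpq : p ≠ q) :
    orthRotation p q hpq 0 = 1 :=
  Subtype.ext (planeRotation_zero p q)

theorem orthAct_orthRotation {n : ℕ} {p q : Fin (n + 1)} (hpq : p ≠ q) (t : ℝ) (z : KSpace n)
    (i : Fin (n + 1)) : orthAct n (orthRotation p q hpq t) z i =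
      if i = p then Real.cos t * z p - Real.sin t * z q
      else if i = q then Real.sin t * z p + Real.cos t * z q else z i := by
  have hqp := hpq.symm
  rw [orthAct_apply]
  have : ∀ j, (((orthRotation p q hpq t).1 i j : ℝ) : ℂ) * z j =
      (if i = j then z j else 0) + (Real.cos t - 1) * ((if p = j then (if p = i then z j else 0)
        else 0) + if q = j then (if q = i then z j else 0) else 0) +
      Real.sin t * ((if p = j then (if q = i then z j else 0) else 0) -
        if q = j then (if p = i then z j else 0) else 0) := fun j => by
    simp only [orthRotation, planeRotation, Matrix.add_apply, Matrix.smul_apply, Matrix.sub_apply,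
      Matrix.single_apply, Matrix.one_apply, smul_eq_mul]
    split_ifs <;> simp_all <;> ring
  simp_rw [this, Finset.sum_add_distrib, ← Finset.mul_sum, Finset.sum_sub_distrib,
    Finset.sum_add_distrib, Finset.sum_ite_eq, Finset.mem_univ, if_true]
  by_cases h1 : i = p
  · subst h1
    simp [hqp]; ring
  · by_cases h2 : i = q
    · subst h2
      simp [hpq, h1]; ring
    · simp [h1, h2, Ne.symm h1, Ne.symm h2]

theorem hasDerivAt_orthRotation {n : ℕ} {p q : Fin (n + 1)} (hpq : p ≠ q) (z : KSpace n)
    (i : Fin (n + 1)) : HasDerivAt (fun t : ℝ => orthAct n (orthRotation p q hpq t) z i)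
      (if i = p then -z q else if i = q then z p else 0) 0 := by
  simp only [orthAct_orthRotation]
  have hc : HasDerivAt (fun t : ℝ => ((Real.cos t : ℝ) : ℂ)) 0 0 := by
    simpa using (Real.hasDerivAt_cos 0).ofReal_comp
  have hs : HasDerivAt (fun t : ℝ => ((Real.sin t : ℝ) : ℂ)) 1 0 := by
    simpa using (Real.hasDerivAt_sin 0).ofReal_comp
  split_ifs
  · simpa using (hc.mul_const (z p)).fun_sub (hs.mul_const (z q))
  · simpa using (hs.mul_const (z p)).fun_add (hc.mul_const (z q))
  · exact hasDerivAt_const _ _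

/-! ### Haar measure -/

instance secondCountableTopology_realOrthogonal (N : ℕ) :
    SecondCountableTopology (RealOrthogonal N) :=
  have : SecondCountableTopology (Matrix (Fin N) (Fin N) ℝ) :=
    inferInstanceAs (SecondCountableTopology (Fin N → Fin N → ℝ))
  Topology.IsInducing.subtypeVal.secondCountableTopology

/-- The normalized Haar measure of the real orthogonal group. -/
abbrev orthHaar (N : ℕ) : Measure (RealOrthogonal N) :=
  Measure.haarMeasure (⊤ : TopologicalSpace.PositiveCompacts (RealOrthogonal N))

instance isProbabilityMeasure_orthHaar (N : ℕ) : IsProbabilityMeasure (orthHaar N) :=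
  ⟨by simpa using Measure.haarMeasure_self (K₀ := (⊤ : TopologicalSpace.PositiveCompacts
    (RealOrthogonal N)))⟩

/-- A right translate is again a left-invariant probability measure, hence equal to the original by
uniqueness. Right invariance is what gives invariance under phases later. -/
instance isMulRightInvariant_orthHaar (N : ℕ) : (orthHaar N).IsMulRightInvariant := ⟨fun g => by
  have hm : Measurable fun x : RealOrthogonal N => x * g := (continuous_mul_const g).measurable
  have : IsProbabilityMeasure ((orthHaar N).map (· * g)) :=
    Measure.isProbabilityMeasure_map hm.aemeasurable
  have h := Measure.haarMeasure_unique ((orthHaar N).map (· * g)) ⊤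
  rw [h]
  simp⟩

/-- A point of the orbit of the base point. -/
def orbitPoint (n : ℕ) (g : RealOrthogonal (n + 1)) : KSpace n := orthAct n g (basePoint n)

theorem continuous_orbitPoint (n : ℕ) : Continuous (orbitPoint n) := continuous_orthAct _

theorem integral_orbitPoint_orthAct {n : ℕ} (F : KSpace n → ℂ) (h : RealOrthogonal (n + 1)) :
    ∫ g, F (orthAct n h (orbitPoint n g)) ∂orthHaar (n + 1) =
      ∫ g, F (orbitPoint n g) ∂orthHaar (n + 1) := by
  simp only [orbitPoint, ← orthAct_mul]
  exact integral_mul_left_eq_self (fun g => F (orthAct n g (basePoint n))) h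

theorem integrable_orthHaar {N : ℕ} {F : RealOrthogonal N → ℂ} (hF : Continuous F) :
    Integrable F (orthHaar N) :=
  hF.integrable_of_hasCompactSupport (HasCompactSupport.of_compactSpace F)

theorem norm_basePoint (k : ℕ) : ‖basePoint (k + 1)‖ = 1 := by
  rw [EuclideanSpace.norm_eq, Fin.sum_univ_succ, Fin.sum_univ_succ]
  simp [basePoint]
  norm_num

theorem norm_orbitPoint (k : ℕ) (g : RealOrthogonal (k + 2)) : ‖orbitPoint (k + 1) g‖ = 1 := by
  rw [orbitPoint, norm_orthAct, norm_basePoint]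

/-- By invariance the integral of `F` over the rotated orbit does not depend on `t`, and its
derivative at `0` is the integral of `F'`. -/
theorem integral_orthRotation_deriv_eq_zero {k : ℕ} {p q : Fin (k + 2)} (hpq : p ≠ q)
    {F F' : KSpace (k + 1) → ℂ} (hF : Continuous F) (hF' : Continuous F')
    (hderiv : ∀ w, HasDerivAt (fun t : ℝ => F (orthAct (k + 1) (orthRotation p q hpq t) w))
      (F' w) 0) :
    ∫ g, F' (orbitPoint (k + 1) g) ∂orthHaar (k + 2) = 0 := by
  -- The group law transports the derivative from `0` to every `t`.
  have hderiv' : ∀ (t : ℝ) w, HasDerivAt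
      (fun t : ℝ => F (orthAct (k + 1) (orthRotation p q hpq t) w))
      (F' (orthAct (k + 1) (orthRotation p q hpq t) w)) t := fun t w => by
    have h := hderiv (orthAct (k + 1) (orthRotation p q hpq t) w)
    rw [← sub_self t] at h
    have h2 := h.comp_sub_const t t
    refine HasDerivAt.congr_of_eventuallyEq h2 (Eventually.of_forall fun x => ?_)
    simp only [← orthAct_mul, ← orthRotation_add, sub_add_cancel]
  obtain ⟨C, hC⟩ := (isCompact_closedBall (0 : KSpace (k + 1)) 1).exists_bound_of_continuousOn
    hF'.continuousOn
  have hcomp : ∀ (t : ℝ), Continuous fun g =>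
      orthAct (k + 1) (orthRotation p q hpq t) (orbitPoint (k + 1) g) := fun t => by
    simp only [orbitPoint, ← orthAct_mul]
    exact (continuous_orthAct _).comp (continuous_const_mul _)
  have h := (hasDerivAt_integral_of_dominated_loc_of_deriv_le (μ := orthHaar (k + 2))
    (F := fun (t : ℝ) g => F (orthAct (k + 1) (orthRotation p q hpq t) (orbitPoint (k + 1) g)))
    (F' := fun (t : ℝ) g => F' (orthAct (k + 1) (orthRotation p q hpq t) (orbitPoint (k + 1) g)))
    (x₀ := 0) (bound := fun _ => C) (Metric.ball_mem_nhds 0 one_pos)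
    (Eventually.of_forall fun t => (hF.comp (hcomp t)).aestronglyMeasurable)
    (integrable_orthHaar (hF.comp (hcomp 0)))
    (hF'.comp (hcomp 0)).aestronglyMeasurable
    (Eventually.of_forall fun g t _ => hC _ (by
      rw [mem_closedBall_zero_iff, norm_orthAct, norm_orbitPoint]))
    (integrable_const _)
    (Eventually.of_forall fun g t _ => hderiv' t _)).2
  simp only [integral_orbitPoint_orthAct F, orthRotation_zero, orthAct_one] at h
  exact h.unique (hasDerivAt_const _ _)

/-! ### Isotropic coordinates -/

/-- The coordinate `(w₀ + i w₁) / √2`. -/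
def isoU {k : ℕ} (w : KSpace (k + 2)) : ℂ := (w 0 + Complex.I * w 1) * (Real.sqrt 2 : ℂ)⁻¹

/-- The coordinate `(w₀ - i w₁) / √2`, the inner product with the base point. -/
def isoV {k : ℕ} (w : KSpace (k + 2)) : ℂ := (w 0 - Complex.I * w 1) * (Real.sqrt 2 : ℂ)⁻¹

/-- The remaining coordinates. -/
def isoXi {k : ℕ} (j : Fin (k + 1)) (w : KSpace (k + 2)) : ℂ := w j.succ.succ

theorem zero_ne_succ_succ {k : ℕ} (j : Fin (k + 1)) : (0 : Fin (k + 3)) ≠ j.succ.succ :=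
  (Fin.succ_ne_zero _).symm

theorem one_ne_succ_succ {k : ℕ} (j : Fin (k + 1)) : (1 : Fin (k + 3)) ≠ j.succ.succ := by
  rw [← Fin.succ_zero_eq_one]
  exact fun h => Fin.succ_ne_zero j (Fin.succ_injective _ h).symm

theorem sqrt_two_inv_sq : ((Real.sqrt 2 : ℝ) : ℂ)⁻¹ * ((Real.sqrt 2 : ℝ) : ℂ)⁻¹ = 1 / 2 := by
  rw [← mul_inv, ← Complex.ofReal_mul, Real.mul_self_sqrt two_pos.le]
  norm_num

@[fun_prop]
theorem continuous_isoU {k : ℕ} : Continuous (isoU (k := k)) := by unfold isoU; fun_prop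

@[fun_prop]
theorem continuous_isoV {k : ℕ} : Continuous (isoV (k := k)) := by unfold isoV; fun_prop

@[fun_prop]
theorem continuous_isoXi {k : ℕ} (j : Fin (k + 1)) : Continuous (isoXi j) := by
  unfold isoXi; fun_prop

theorem sum_sq_eq_iso {k : ℕ} (w : KSpace (k + 2)) :
    ∑ i, w i * w i = 2 * isoU w * isoV w + ∑ j, isoXi j w ^ 2 := by
  rw [Fin.sum_univ_succ, Fin.sum_univ_succ, isoU, isoV, ← add_assoc]
  congr 1
  · simp only [Fin.succ_zero_eq_one]
    linear_combination (-2 * (w 0 + Complex.I * w 1) * (w 0 - Complex.I * w 1)) * sqrt_two_inv_sq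
      + w 1 * w 1 * Complex.I_mul_I
  · simp [isoXi, sq]

theorem norm_sq_eq_iso {k : ℕ} (w : KSpace (k + 2)) :
    ((‖w‖ ^ 2 : ℝ) : ℂ) = isoU w * starRingEnd ℂ (isoU w) + isoV w * starRingEnd ℂ (isoV w) +
      ∑ j, isoXi j w * starRingEnd ℂ (isoXi j w) := by
  rw [EuclideanSpace.norm_sq_eq, Fin.sum_univ_succ, Fin.sum_univ_succ, ← add_assoc]
  push_cast
  congr 1
  · simp only [Fin.succ_zero_eq_one, isoU, isoV, map_mul, map_add, map_sub, Complex.conj_I,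
      map_inv₀, Complex.conj_ofReal, ← Complex.mul_conj']
    linear_combination (-2 * (w 0 * starRingEnd ℂ (w 0) - Complex.I ^ 2 *
      w 1 * starRingEnd ℂ (w 1))) * sqrt_two_inv_sq +
      w 1 * starRingEnd ℂ (w 1) * Complex.I_mul_I
  · simp [isoXi, Complex.mul_conj']

/-- Two integrals over the orbit vanish: combination of the two rotations mixing `j` with the
first two coordinates. -/
theorem integral_lowering_eq_zero {k : ℕ} (j : Fin (k + 1)) {F F₁ F₂ : KSpace (k + 2) → ℂ}
    (hF : Continuous F) (hF₁ : Continuous F₁) (hF₂ : Continuous F₂)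
    (h₁ : ∀ w, HasDerivAt (fun t : ℝ => F (orthAct (k + 2)
      (orthRotation 0 j.succ.succ (zero_ne_succ_succ j) t) w)) (F₁ w) 0)
    (h₂ : ∀ w, HasDerivAt (fun t : ℝ => F (orthAct (k + 2)
      (orthRotation 1 j.succ.succ (one_ne_succ_succ j) t) w)) (F₂ w) 0) :
    ∫ g, (F₁ (orbitPoint (k + 2) g) + Complex.I * F₂ (orbitPoint (k + 2) g)) ∂orthHaar (k + 3)
      = 0 := by
  have i₁ : Integrable (fun g => F₁ (orbitPoint (k + 2) g)) (orthHaar (k + 3)) :=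
    integrable_orthHaar (hF₁.comp (continuous_orbitPoint _))
  have i₂ : Integrable (fun g => F₂ (orbitPoint (k + 2) g)) (orthHaar (k + 3)) :=
    integrable_orthHaar (hF₂.comp (continuous_orbitPoint _))
  rw [integral_add i₁ (i₂.const_mul _), integral_const_mul]
  rw [integral_orthRotation_deriv_eq_zero _ hF hF₁ h₁,
    integral_orthRotation_deriv_eq_zero _ hF hF₂ h₂]
  simp

section Derivatives

variable {k : ℕ} (j : Fin (k + 1)) (w : KSpace (k + 2))

theorem hasDerivAt_rotation_zero_isoU : HasDerivAt (fun t : ℝ => isoU (orthAct (k + 2)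
    (orthRotation 0 j.succ.succ (zero_ne_succ_succ j) t) w))
    (-isoXi j w * (Real.sqrt 2 : ℂ)⁻¹) 0 := by
  have h := fun i => hasDerivAt_orthRotation (zero_ne_succ_succ j) w i
  have h0 := h 0
  have h1 := h 1
  rw [if_pos rfl] at h0
  rw [if_neg one_ne_zero, if_neg (one_ne_succ_succ j)] at h1
  simpa [isoU, isoXi] using (h0.fun_add (h1.const_mul Complex.I)).mul_const ((Real.sqrt 2 : ℂ)⁻¹)

theorem hasDerivAt_rotation_zero_isoV : HasDerivAt (fun t : ℝ => isoV (orthAct (k + 2)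
    (orthRotation 0 j.succ.succ (zero_ne_succ_succ j) t) w))
    (-isoXi j w * (Real.sqrt 2 : ℂ)⁻¹) 0 := by
  have h := fun i => hasDerivAt_orthRotation (zero_ne_succ_succ j) w i
  have h0 := h 0
  have h1 := h 1
  rw [if_pos rfl] at h0
  rw [if_neg one_ne_zero, if_neg (one_ne_succ_succ j)] at h1
  simpa [isoV, isoXi] using (h0.fun_sub (h1.const_mul Complex.I)).mul_const ((Real.sqrt 2 : ℂ)⁻¹)

theorem hasDerivAt_rotation_zero_isoXi : HasDerivAt (fun t : ℝ => isoXi j (orthAct (k + 2)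
    (orthRotation 0 j.succ.succ (zero_ne_succ_succ j) t) w))
    ((isoU w + isoV w) * (Real.sqrt 2 : ℂ)⁻¹) 0 := by
  have h := hasDerivAt_orthRotation (zero_ne_succ_succ j) w j.succ.succ
  rw [if_neg (zero_ne_succ_succ j).symm, if_pos rfl] at h
  have e : (isoU w + isoV w) * (Real.sqrt 2 : ℂ)⁻¹ = w 0 := by
    rw [isoU, isoV]
    linear_combination (2 * w 0) * sqrt_two_inv_sq
  rw [e]
  exact h

theorem hasDerivAt_rotation_one_isoU : HasDerivAt (fun t : ℝ => isoU (orthAct (k + 2)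
    (orthRotation 1 j.succ.succ (one_ne_succ_succ j) t) w))
    (-Complex.I * isoXi j w * (Real.sqrt 2 : ℂ)⁻¹) 0 := by
  have h := fun i => hasDerivAt_orthRotation (one_ne_succ_succ j) w i
  have h0 := h 0
  have h1 := h 1
  rw [if_pos rfl] at h1
  rw [if_neg zero_ne_one, if_neg (zero_ne_succ_succ j)] at h0
  simpa [isoU, isoXi] using (h0.fun_add (h1.const_mul Complex.I)).mul_const ((Real.sqrt 2 : ℂ)⁻¹)

theorem hasDerivAt_rotation_one_isoV : HasDerivAt (fun t : ℝ => isoV (orthAct (k + 2)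
    (orthRotation 1 j.succ.succ (one_ne_succ_succ j) t) w))
    (Complex.I * isoXi j w * (Real.sqrt 2 : ℂ)⁻¹) 0 := by
  have h := fun i => hasDerivAt_orthRotation (one_ne_succ_succ j) w i
  have h0 := h 0
  have h1 := h 1
  rw [if_pos rfl] at h1
  rw [if_neg zero_ne_one, if_neg (zero_ne_succ_succ j)] at h0
  simpa [isoV, isoXi] using (h0.fun_sub (h1.const_mul Complex.I)).mul_const ((Real.sqrt 2 : ℂ)⁻¹)

theorem hasDerivAt_rotation_one_isoXi : HasDerivAt (fun t : ℝ => isoXi j (orthAct (k + 2)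
    (orthRotation 1 j.succ.succ (one_ne_succ_succ j) t) w))
    (-Complex.I * (isoU w - isoV w) * (Real.sqrt 2 : ℂ)⁻¹) 0 := by
  have h := hasDerivAt_orthRotation (one_ne_succ_succ j) w j.succ.succ
  rw [if_neg (one_ne_succ_succ j).symm, if_pos rfl] at h
  have e : -Complex.I * (isoU w - isoV w) * (Real.sqrt 2 : ℂ)⁻¹ = w 1 := by
    rw [isoU, isoV]
    linear_combination (-2 * Complex.I ^ 2 * w 1) * sqrt_two_inv_sq - w 1 * Complex.I_mul_I
  rw [e]
  exact h

end Derivatives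

/-! ### Moments of `|V|²` over the orbit. -/

theorem HasDerivAt.conj_complex {f : ℝ → ℂ} {f' : ℂ} {x : ℝ} (hf : HasDerivAt f f' x) :
    HasDerivAt (fun t => starRingEnd ℂ (f t)) (starRingEnd ℂ f') x := hf.star

/-- Let `L` be the first rotation derivative plus `i` times the second, and `r = 1/√2`. This
derivation sends `V ↦ -2rξ`, `ξ ↦ 2rU`, `U ↦ 0` and `V̄ ↦ 0`, `ξ̄ ↦ 2rV̄`, `Ū ↦ -2rξ̄`. Apply it to
`ξ̄ V^(l+1) V̄^l`, using that integrals of `L F` vanish. -/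
theorem integral_xi_sq_mul_V_pow {k : ℕ} (j : Fin (k + 1)) (l : ℕ) :
    ∫ g, (isoV (orbitPoint (k + 2) g) * starRingEnd ℂ (isoV (orbitPoint (k + 2) g))) ^ (l + 1)
        ∂orthHaar (k + 3) =
      (l + 1) * ∫ g, isoXi j (orbitPoint (k + 2) g) * starRingEnd ℂ (isoXi j (orbitPoint (k + 2) g)) *
        (isoV (orbitPoint (k + 2) g) * starRingEnd ℂ (isoV (orbitPoint (k + 2) g))) ^ l
        ∂orthHaar (k + 3) := by
  have hc : Continuous (starRingEnd ℂ) := Complex.continuous_conj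
  have hcU : Continuous fun w : KSpace (k + 2) => starRingEnd ℂ (isoU w) := hc.comp continuous_isoU
  have hcV : Continuous fun w : KSpace (k + 2) => starRingEnd ℂ (isoV w) := hc.comp continuous_isoV
  have hcX : Continuous fun w : KSpace (k + 2) => starRingEnd ℂ (isoXi j w) :=
    hc.comp (continuous_isoXi j)
  have h := integral_lowering_eq_zero (k := k) j
    (F := fun w => starRingEnd ℂ (isoXi j w) * (isoV w ^ (l + 1) * starRingEnd ℂ (isoV w) ^ l))
    (F₁ := fun w => starRingEnd ℂ ((isoU w + isoV w) * (Real.sqrt 2 : ℂ)⁻¹) *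
      (isoV w ^ (l + 1) * starRingEnd ℂ (isoV w) ^ l) + starRingEnd ℂ (isoXi j w) *
      (((l + 1 : ℕ) * isoV w ^ l * (-isoXi j w * (Real.sqrt 2 : ℂ)⁻¹)) *
        starRingEnd ℂ (isoV w) ^ l + isoV w ^ (l + 1) * (l * starRingEnd ℂ (isoV w) ^ (l - 1) *
        starRingEnd ℂ (-isoXi j w * (Real.sqrt 2 : ℂ)⁻¹))))
    (F₂ := fun w => starRingEnd ℂ (-Complex.I * (isoU w - isoV w) * (Real.sqrt 2 : ℂ)⁻¹) *
      (isoV w ^ (l + 1) * starRingEnd ℂ (isoV w) ^ l) + starRingEnd ℂ (isoXi j w) *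
      (((l + 1 : ℕ) * isoV w ^ l * (Complex.I * isoXi j w * (Real.sqrt 2 : ℂ)⁻¹)) *
        starRingEnd ℂ (isoV w) ^ l + isoV w ^ (l + 1) * (l * starRingEnd ℂ (isoV w) ^ (l - 1) *
        starRingEnd ℂ (Complex.I * isoXi j w * (Real.sqrt 2 : ℂ)⁻¹))))
    (by fun_prop)
    (by simp only [map_mul, map_add, map_neg]; fun_prop)
    (by simp only [map_mul, map_sub, map_neg]; fun_prop) (fun w => ?_) (fun w => ?_)
  · have e : ∀ w : KSpace (k + 2), starRingEnd ℂ ((isoU w + isoV w) * (Real.sqrt 2 : ℂ)⁻¹) *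
        (isoV w ^ (l + 1) * starRingEnd ℂ (isoV w) ^ l) + starRingEnd ℂ (isoXi j w) *
        (((l + 1 : ℕ) * isoV w ^ l * (-isoXi j w * (Real.sqrt 2 : ℂ)⁻¹)) *
          starRingEnd ℂ (isoV w) ^ l + isoV w ^ (l + 1) * (l * starRingEnd ℂ (isoV w) ^ (l - 1) *
          starRingEnd ℂ (-isoXi j w * (Real.sqrt 2 : ℂ)⁻¹))) + Complex.I *
        (starRingEnd ℂ (-Complex.I * (isoU w - isoV w) * (Real.sqrt 2 : ℂ)⁻¹) *
        (isoV w ^ (l + 1) * starRingEnd ℂ (isoV w) ^ l) + starRingEnd ℂ (isoXi j w) *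
        (((l + 1 : ℕ) * isoV w ^ l * (Complex.I * isoXi j w * (Real.sqrt 2 : ℂ)⁻¹)) *
          starRingEnd ℂ (isoV w) ^ l + isoV w ^ (l + 1) * (l * starRingEnd ℂ (isoV w) ^ (l - 1) *
          starRingEnd ℂ (Complex.I * isoXi j w * (Real.sqrt 2 : ℂ)⁻¹)))) =
        (2 * (Real.sqrt 2 : ℂ)⁻¹) * ((isoV w * starRingEnd ℂ (isoV w)) ^ (l + 1) -
          (l + 1) * (isoXi j w * starRingEnd ℂ (isoXi j w) *
            (isoV w * starRingEnd ℂ (isoV w)) ^ l)) := fun w => by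
      simp only [map_mul, map_add, map_sub, map_neg, map_inv₀, Complex.conj_ofReal, Complex.conj_I,
        mul_pow]
      push_cast
      linear_combination ((Real.sqrt 2 : ℂ)⁻¹ * (l + 1) * isoXi j w *
        starRingEnd ℂ (isoXi j w) * isoV w ^ l * starRingEnd ℂ (isoV w) ^ l +
        (starRingEnd ℂ (isoU w) - starRingEnd ℂ (isoV w)) * (Real.sqrt 2 : ℂ)⁻¹ *
        isoV w ^ (l + 1) * starRingEnd ℂ (isoV w) ^ l - starRingEnd ℂ (isoXi j w) ^ 2 *
        isoV w ^ (l + 1) * (l * starRingEnd ℂ (isoV w) ^ (l - 1)) * (Real.sqrt 2 : ℂ)⁻¹) *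
        Complex.I_mul_I
    simp only [e] at h
    have hs0 : (2 * (Real.sqrt 2 : ℂ)⁻¹) ≠ 0 := by simp
    rw [integral_const_mul, mul_eq_zero, or_iff_right hs0, integral_sub, sub_eq_zero,
      integral_const_mul] at h
    · exact h
    · refine integrable_orthHaar (Continuous.comp (g := fun w : KSpace (k + 2) =>
        (isoV w * starRingEnd ℂ (isoV w)) ^ (l + 1)) ?_ (continuous_orbitPoint _))
      fun_prop
    · refine integrable_orthHaar (Continuous.comp (g := fun w : KSpace (k + 2) =>
        ((l : ℂ) + 1) * (isoXi j w * starRingEnd ℂ (isoXi j w) *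
            (isoV w * starRingEnd ℂ (isoV w)) ^ l)) ?_ (continuous_orbitPoint _))
      fun_prop
  · have hX := (hasDerivAt_rotation_zero_isoXi j w).conj_complex
    have hV := hasDerivAt_rotation_zero_isoV j w
    have := hX.fun_mul ((hV.fun_pow (l + 1)).fun_mul (hV.conj_complex.fun_pow l))
    simpa only [orthRotation_zero, orthAct_one, Nat.add_sub_cancel] using this
  · have hX := (hasDerivAt_rotation_one_isoXi j w).conj_complex
    have hV := hasDerivAt_rotation_one_isoV j w
    have := hX.fun_mul ((hV.fun_pow (l + 1)).fun_mul (hV.conj_complex.fun_pow l))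
    simpa only [orthRotation_zero, orthAct_one, Nat.add_sub_cancel] using this

/-- The same derivation applied to `Ū V̄^l ξ V^l`. Summed over `j`, the last term simplifies because
`∑ ξ_j² = -2UV` on the cone. -/
theorem integral_U_sq_mul_V_pow_aux {k : ℕ} (j : Fin (k + 1)) (l : ℕ) :
    ∫ g, (isoXi j (orbitPoint (k + 2) g) * starRingEnd ℂ (isoXi j (orbitPoint (k + 2) g)) *
        (isoV (orbitPoint (k + 2) g) * starRingEnd ℂ (isoV (orbitPoint (k + 2) g))) ^ l -
      isoU (orbitPoint (k + 2) g) * starRingEnd ℂ (isoU (orbitPoint (k + 2) g)) *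
        (isoV (orbitPoint (k + 2) g) * starRingEnd ℂ (isoV (orbitPoint (k + 2) g))) ^ l +
      starRingEnd ℂ (isoU (orbitPoint (k + 2) g)) *
        starRingEnd ℂ (isoV (orbitPoint (k + 2) g)) ^ l *
        (l * isoV (orbitPoint (k + 2) g) ^ (l - 1)) * isoXi j (orbitPoint (k + 2) g) ^ 2)
        ∂orthHaar (k + 3) = 0 := by
  have hc : Continuous (starRingEnd ℂ) := Complex.continuous_conj
  have hcU : Continuous fun w : KSpace (k + 2) => starRingEnd ℂ (isoU w) := hc.comp continuous_isoU
  have hcV : Continuous fun w : KSpace (k + 2) => starRingEnd ℂ (isoV w) := hc.comp continuous_isoV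
  have hcX : Continuous fun w : KSpace (k + 2) => starRingEnd ℂ (isoXi j w) :=
    hc.comp (continuous_isoXi j)
  set r : ℂ := (Real.sqrt 2 : ℂ)⁻¹ with hr
  have hrc : starRingEnd ℂ r = r := by simp [hr]
  have h := integral_lowering_eq_zero (k := k) j
    (F := fun w => (starRingEnd ℂ (isoU w) * starRingEnd ℂ (isoV w) ^ l) *
      (isoXi j w * isoV w ^ l))
    (F₁ := fun w => (starRingEnd ℂ (-isoXi j w * r) * starRingEnd ℂ (isoV w) ^ l +
        starRingEnd ℂ (isoU w) * (l * starRingEnd ℂ (isoV w) ^ (l - 1) *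
        starRingEnd ℂ (-isoXi j w * r))) * (isoXi j w * isoV w ^ l) +
      (starRingEnd ℂ (isoU w) * starRingEnd ℂ (isoV w) ^ l) *
      (((isoU w + isoV w) * r) * isoV w ^ l + isoXi j w * (l * isoV w ^ (l - 1) *
        (-isoXi j w * r))))
    (F₂ := fun w => (starRingEnd ℂ (-Complex.I * isoXi j w * r) * starRingEnd ℂ (isoV w) ^ l +
        starRingEnd ℂ (isoU w) * (l * starRingEnd ℂ (isoV w) ^ (l - 1) *
        starRingEnd ℂ (Complex.I * isoXi j w * r))) * (isoXi j w * isoV w ^ l) +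
      (starRingEnd ℂ (isoU w) * starRingEnd ℂ (isoV w) ^ l) *
      ((-Complex.I * (isoU w - isoV w) * r) * isoV w ^ l + isoXi j w * (l * isoV w ^ (l - 1) *
        (Complex.I * isoXi j w * r))))
    (by fun_prop)
    (by simp only [map_mul, map_neg]; fun_prop)
    (by simp only [map_mul, map_neg]; fun_prop) (fun w => ?_) (fun w => ?_)
  · have e : ∀ w : KSpace (k + 2), (starRingEnd ℂ (-isoXi j w * r) * starRingEnd ℂ (isoV w) ^ l +
        starRingEnd ℂ (isoU w) * (l * starRingEnd ℂ (isoV w) ^ (l - 1) *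
        starRingEnd ℂ (-isoXi j w * r))) * (isoXi j w * isoV w ^ l) +
      (starRingEnd ℂ (isoU w) * starRingEnd ℂ (isoV w) ^ l) *
      (((isoU w + isoV w) * r) * isoV w ^ l + isoXi j w * (l * isoV w ^ (l - 1) *
        (-isoXi j w * r))) + Complex.I * ((starRingEnd ℂ (-Complex.I * isoXi j w * r) *
        starRingEnd ℂ (isoV w) ^ l +
        starRingEnd ℂ (isoU w) * (l * starRingEnd ℂ (isoV w) ^ (l - 1) *
        starRingEnd ℂ (Complex.I * isoXi j w * r))) * (isoXi j w * isoV w ^ l) +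
      (starRingEnd ℂ (isoU w) * starRingEnd ℂ (isoV w) ^ l) *
      ((-Complex.I * (isoU w - isoV w) * r) * isoV w ^ l + isoXi j w * (l * isoV w ^ (l - 1) *
        (Complex.I * isoXi j w * r)))) = (-2 * r) * (isoXi j w * starRingEnd ℂ (isoXi j w) *
        (isoV w * starRingEnd ℂ (isoV w)) ^ l -
        isoU w * starRingEnd ℂ (isoU w) * (isoV w * starRingEnd ℂ (isoV w)) ^ l +
        starRingEnd ℂ (isoU w) * starRingEnd ℂ (isoV w) ^ l *
        (l * isoV w ^ (l - 1)) * isoXi j w ^ 2) := fun w => by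
      simp only [map_mul, map_neg, hrc, Complex.conj_I, mul_pow]
      linear_combination (r * isoXi j w * starRingEnd ℂ (isoXi j w) * isoV w ^ l *
        starRingEnd ℂ (isoV w) ^ l - r * starRingEnd ℂ (isoU w) * starRingEnd ℂ (isoV w) ^ (l - 1) *
        l * starRingEnd ℂ (isoXi j w) * isoXi j w * isoV w ^ l -
        r * starRingEnd ℂ (isoU w) * starRingEnd ℂ (isoV w) ^ l * (isoU w - isoV w) * isoV w ^ l +
        r * starRingEnd ℂ (isoU w) * starRingEnd ℂ (isoV w) ^ l * isoXi j w ^ 2 * l *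
        isoV w ^ (l - 1)) * Complex.I_mul_I
    simp only [e] at h
    have hs0 : (-2 * r) ≠ 0 := by simp [hr]
    rwa [integral_const_mul, mul_eq_zero, or_iff_right hs0] at h
  · have hU := (hasDerivAt_rotation_zero_isoU j w).conj_complex
    have hX := hasDerivAt_rotation_zero_isoXi j w
    have hV := hasDerivAt_rotation_zero_isoV j w
    have := (hU.fun_mul (hV.conj_complex.fun_pow l)).fun_mul (hX.fun_mul (hV.fun_pow l))
    simpa only [orthRotation_zero, orthAct_one] using this
  · have hU := (hasDerivAt_rotation_one_isoU j w).conj_complex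
    have hX := hasDerivAt_rotation_one_isoXi j w
    have hV := hasDerivAt_rotation_one_isoV j w
    have := (hU.fun_mul (hV.conj_complex.fun_pow l)).fun_mul (hX.fun_mul (hV.fun_pow l))
    simpa only [orthRotation_zero, orthAct_one] using this

theorem basePoint_mem_keplerManifold (k : ℕ) : basePoint (k + 1) ∈ keplerManifold (k + 1) := by
  refine ⟨?_, fun h => by simpa [h] using norm_basePoint k⟩
  rw [Fin.sum_univ_succ, Fin.sum_univ_succ]
  simp only [basePoint, Fin.val_zero, if_true, Fin.val_succ]
  have : ∀ j : Fin k, ¬ ((j : ℕ) + 1 + 1 = 0) ∧ ¬ ((j : ℕ) + 1 + 1 = 1) := fun j => by omega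
  simp only [(this _).1, (this _).2, if_false, mul_zero, Finset.sum_const_zero, zero_add,
    one_ne_zero, add_zero]
  linear_combination ((Real.sqrt 2 : ℂ)⁻¹ * (Real.sqrt 2 : ℂ)⁻¹) * Complex.I_mul_I

theorem orbitPoint_mem_keplerManifold (k : ℕ) (g : RealOrthogonal (k + 2)) :
    orbitPoint (k + 1) g ∈ keplerManifold (k + 1) :=
  orthAct_mem_keplerManifold g (basePoint_mem_keplerManifold k)

theorem sum_isoXi_sq {k : ℕ} {w : KSpace (k + 2)} (hw : w ∈ keplerManifold (k + 2)) :
    ∑ j, isoXi j w ^ 2 = -(2 * isoU w * isoV w) := by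
  have := sum_sq_eq_iso w
  rw [hw.1] at this
  linear_combination -this

theorem continuous_conj_comp {X : Type*} [TopologicalSpace X] {f : X → ℂ} (hf : Continuous f) :
    Continuous fun x => starRingEnd ℂ (f x) := Complex.continuous_conj.comp hf

/-- Three linear relations among the integrals of `|V|^(2l)`, `|V|^(2l+2)`, `|U|²|V|^(2l)` and
`|ξ_j|²|V|^(2l)`: the norm is `1` on the orbit (`h2`), and the two identities from rotations are
summed over `j` (`h3`, `h4`). Eliminating the mixed integrals leaves the ratio of consecutive
moments. -/
theorem integral_V_pow_succ (k l : ℕ) :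
    (∫ g, (isoV (orbitPoint (k + 2) g) * starRingEnd ℂ (isoV (orbitPoint (k + 2) g))) ^ l
        ∂orthHaar (k + 3)) * ((l + 1) * (2 * l + k + 1)) =
    (∫ g, (isoV (orbitPoint (k + 2) g) * starRingEnd ℂ (isoV (orbitPoint (k + 2) g))) ^ (l + 1)
        ∂orthHaar (k + 3)) * ((2 * l + k + 3) * (l + k + 1)) := by
  have ho := continuous_orbitPoint (k + 2)
  have cU : Continuous fun g => isoU (orbitPoint (k + 2) g) := continuous_isoU.comp ho
  have cV : Continuous fun g => isoV (orbitPoint (k + 2) g) := continuous_isoV.comp ho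
  have cX : ∀ j, Continuous fun g => isoXi j (orbitPoint (k + 2) g) := fun j =>
    (continuous_isoXi j).comp ho
  have cU' := continuous_conj_comp cU
  have cV' := continuous_conj_comp cV
  have cX' := fun j => continuous_conj_comp (cX j)
  set A := ∫ g, (isoV (orbitPoint (k + 2) g) * starRingEnd ℂ (isoV (orbitPoint (k + 2) g))) ^ l
    ∂orthHaar (k + 3) with hA
  set A1 := ∫ g, (isoV (orbitPoint (k + 2) g) *
    starRingEnd ℂ (isoV (orbitPoint (k + 2) g))) ^ (l + 1) ∂orthHaar (k + 3) with hA1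
  set B := ∫ g, isoU (orbitPoint (k + 2) g) * starRingEnd ℂ (isoU (orbitPoint (k + 2) g)) *
    (isoV (orbitPoint (k + 2) g) * starRingEnd ℂ (isoV (orbitPoint (k + 2) g))) ^ l
    ∂orthHaar (k + 3) with hB
  set X : Fin (k + 1) → ℂ := fun j => ∫ g, isoXi j (orbitPoint (k + 2) g) *
    starRingEnd ℂ (isoXi j (orbitPoint (k + 2) g)) *
    (isoV (orbitPoint (k + 2) g) * starRingEnd ℂ (isoV (orbitPoint (k + 2) g))) ^ l
    ∂orthHaar (k + 3) with hX
  have h1 : ∀ j, A1 = (l + 1) * X j := fun j => integral_xi_sq_mul_V_pow j l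
  have iA : Integrable (fun g => (isoV (orbitPoint (k + 2) g) *
    starRingEnd ℂ (isoV (orbitPoint (k + 2) g))) ^ l) (orthHaar (k + 3)) :=
    integrable_orthHaar (by fun_prop)
  have iA1 : Integrable (fun g => (isoV (orbitPoint (k + 2) g) *
    starRingEnd ℂ (isoV (orbitPoint (k + 2) g))) ^ (l + 1)) (orthHaar (k + 3)) :=
    integrable_orthHaar (by fun_prop)
  have iB : Integrable (fun g => isoU (orbitPoint (k + 2) g) *
    starRingEnd ℂ (isoU (orbitPoint (k + 2) g)) * (isoV (orbitPoint (k + 2) g) *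
    starRingEnd ℂ (isoV (orbitPoint (k + 2) g))) ^ l) (orthHaar (k + 3)) :=
    integrable_orthHaar (by fun_prop)
  have iX : ∀ j, Integrable (fun g => isoXi j (orbitPoint (k + 2) g) *
    starRingEnd ℂ (isoXi j (orbitPoint (k + 2) g)) * (isoV (orbitPoint (k + 2) g) *
    starRingEnd ℂ (isoV (orbitPoint (k + 2) g))) ^ l) (orthHaar (k + 3)) := fun j =>
    integrable_orthHaar (by fun_prop)
  have iBA : Integrable (fun g => isoU (orbitPoint (k + 2) g) *
    starRingEnd ℂ (isoU (orbitPoint (k + 2) g)) * (isoV (orbitPoint (k + 2) g) *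
    starRingEnd ℂ (isoV (orbitPoint (k + 2) g))) ^ l + (isoV (orbitPoint (k + 2) g) *
    starRingEnd ℂ (isoV (orbitPoint (k + 2) g))) ^ (l + 1)) (orthHaar (k + 3)) := iB.add iA1
  have h2 : A = B + A1 + ∑ j, X j := by
    rw [hA, hB, hA1, hX, ← integral_finsetSum _ fun j _ => iX j, ← integral_add iB iA1,
      ← integral_add iBA (integrable_finsetSum _ fun j _ => iX j)]
    congr 1 with g
    have hn := norm_sq_eq_iso (orbitPoint (k + 2) g)
    rw [norm_orbitPoint] at hn
    simp only [← Finset.sum_mul]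
    push_cast at hn
    linear_combination (isoV (orbitPoint (k + 2) g) *
      starRingEnd ℂ (isoV (orbitPoint (k + 2) g))) ^ l * hn
  have h3 : ∑ j, X j = (2 * l + k + 1) * B := by
    have hs := Finset.sum_congr rfl fun j (_ : j ∈ Finset.univ) =>
      integral_U_sq_mul_V_pow_aux (k := k) j l
    rw [← integral_finsetSum _ fun j _ => integrable_orthHaar (by fun_prop)] at hs
    rw [Finset.sum_const_zero] at hs
    rw [← sub_eq_zero, ← hs, hB, ← integral_const_mul, hX, ← integral_finsetSum _ fun j _ => iX j,
      ← integral_sub (integrable_finsetSum _ fun j _ => iX j) (iB.const_mul _)]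
    congr 1 with g
    have hm := sum_isoXi_sq (orbitPoint_mem_keplerManifold (k + 1) g)
    rw [Finset.sum_add_distrib, Finset.sum_sub_distrib, Finset.sum_const, ← Finset.mul_sum, hm]
    -- The truncated exponent at `l = 0` is harmless because of the factor `l`.
    have hl : (l : ℂ) * isoV (orbitPoint (k + 2) g) ^ (l - 1) * isoV (orbitPoint (k + 2) g) =
        l * isoV (orbitPoint (k + 2) g) ^ l := by
      cases l with
      | zero => simp
      | succ l => rw [Nat.add_sub_cancel]; ring
    simp only [Finset.card_univ, Fintype.card_fin, nsmul_eq_mul, mul_pow]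
    push_cast
    linear_combination (2 * starRingEnd ℂ (isoU (orbitPoint (k + 2) g)) *
      starRingEnd ℂ (isoV (orbitPoint (k + 2) g)) ^ l * isoU (orbitPoint (k + 2) g)) * hl
  have h4 : (l + 1) * ∑ j, X j = (k + 1) * A1 := by
    rw [Finset.mul_sum, ← Finset.sum_congr rfl fun j _ => h1 j]
    simp
  rw [h2]
  linear_combination (-(l + 1) : ℂ) * h3 + (2 * l + k + 2) * h4

theorem keplerDim_succ (k l : ℕ) :
    keplerDim k (l + 1) * ((l + 1) * (2 * l + k + 1)) =
      keplerDim k l * ((2 * l + k + 3) * (l + k + 1)) := by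
  have h : (∏ i ∈ Finset.range k, (((l + 1 : ℕ) : ℝ) + (i + 1))) * (l + 1) =
      (∏ i ∈ Finset.range k, ((l : ℝ) + (i + 1))) * (l + k + 1) := by
    have h1 := Finset.prod_range_succ (fun i : ℕ => (l : ℝ) + (i + 1)) k
    have h2 := Finset.prod_range_succ' (fun i : ℕ => (l : ℝ) + (i + 1)) k
    rw [h1] at h2
    push_cast at h2 ⊢
    calc _ = (∏ i ∈ Finset.range k, ((l : ℝ) + (i + 1 + 1))) * (l + (0 + 1)) := by
          rw [zero_add]
          congr 1
          exact Finset.prod_congr rfl fun i _ => by ring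
      _ = _ := by rw [← h2]; ring
  unfold keplerDim
  rw [div_mul_eq_mul_div, div_mul_eq_mul_div]
  congr 1
  push_cast at h ⊢
  linear_combination (2 * (l : ℝ) + k + 3) * (2 * l + k + 1) * h

theorem keplerDim_zero (k : ℕ) : keplerDim k 0 = 1 := by
  have h : ∏ i ∈ Finset.range k, (((0 : ℕ) : ℝ) + (i + 1)) = k.factorial := by
    rw [← Finset.prod_range_add_one_eq_factorial]
    push_cast
    exact Finset.prod_congr rfl fun i _ => by ring
  have hk : (k.factorial : ℝ) ≠ 0 := by positivity
  rw [keplerDim, h, Nat.factorial_succ]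
  push_cast
  field_simp
  ring

/-- Both sides equal `1` at `l = 0` and satisfy the same recursion. -/
theorem integral_V_pow (k l : ℕ) :
    ∫ g, (isoV (orbitPoint (k + 2) g) * starRingEnd ℂ (isoV (orbitPoint (k + 2) g))) ^ l
        ∂orthHaar (k + 3) = ((keplerDim k l)⁻¹ : ℝ) := by
  induction l with
  | zero => simp [keplerDim_zero]
  | succ l ih =>
    have h := integral_V_pow_succ k l
    rw [ih] at h
    have h2 := keplerDim_succ k l
    have hne : ((2 * l + k + 3 : ℂ) * (l + k + 1)) ≠ 0 := by
      have : ((2 * l + k + 3 : ℝ) * (l + k + 1)) ≠ 0 := by positivity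
      exact_mod_cast this
    apply mul_right_cancel₀ hne
    rw [← h]
    have h0 := keplerDim_pos k l
    have h1 := keplerDim_pos k (l + 1)
    have h3 : (keplerDim k l)⁻¹ * ((l + 1) * (2 * l + k + 1)) =
        (keplerDim k (l + 1))⁻¹ * ((2 * l + k + 3) * (l + k + 1)) := by
      field_simp
      linear_combination h2
    exact_mod_cast h3

/-! ### The circle action and the rational curves -/

/-- The base point is an eigenvector of rotations in the first two coordinates, so right
multiplication by them realizes phases on the orbit. -/
theorem orthAct_rotation_basePoint (k : ℕ) (θ : ℝ) :
    orthAct (k + 2) (orthRotation 0 1 zero_ne_one θ) (basePoint (k + 2)) =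
      Complex.exp (-(θ * Complex.I)) • basePoint (k + 2) := by
  have hexp : Complex.exp (-(θ * Complex.I)) = Complex.cos θ - Complex.sin θ * Complex.I := by
    rw [← neg_mul, Complex.exp_mul_I, Complex.cos_neg, Complex.sin_neg]; ring
  ext i
  rw [orthAct_orthRotation, PiLp.smul_apply, smul_eq_mul, hexp]
  have b0 : basePoint (k + 2) 0 = (Real.sqrt 2 : ℂ)⁻¹ := by simp [basePoint]
  have b1 : basePoint (k + 2) 1 = (Real.sqrt 2 : ℂ)⁻¹ * Complex.I := by simp [basePoint]
  split_ifs with h0 h1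
  · rw [h0, b0, b1]; push_cast; ring
  · rw [h1, b0, b1]; push_cast
    linear_combination (Complex.sin θ * (Real.sqrt 2 : ℂ)⁻¹) * Complex.I_mul_I
  · have : basePoint (k + 2) i = 0 := by
      have h1' : (i : ℕ) ≠ 1 := fun h => h1 (Fin.ext (by simpa using h))
      simp [basePoint, h0, h1']
    rw [this, mul_zero]

theorem integral_orbitPoint_smul {k : ℕ} (F : KSpace (k + 2) → ℂ) (θ : ℝ) :
    ∫ g, F (Complex.exp (θ * Complex.I) • orbitPoint (k + 2) g) ∂orthHaar (k + 3) =
      ∫ g, F (orbitPoint (k + 2) g) ∂orthHaar (k + 3) := by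
  have h := integral_mul_right_eq_self (μ := orthHaar (k + 3))
    (fun g => F (orbitPoint (k + 2) g)) (orthRotation 0 1 zero_ne_one (-θ))
  rw [← h]
  congr 1 with g
  rw [orbitPoint, orbitPoint, orthAct_mul, orthAct_rotation_basePoint, orthAct_smul]
  simp

theorem isoV_orthAct_rotation {k : ℕ} (θ : ℝ) (w : KSpace (k + 2)) :
    isoV (orthAct (k + 2) (orthRotation 0 1 zero_ne_one θ) w) =
      Complex.exp (-(θ * Complex.I)) * isoV w := by
  have hexp : Complex.exp (-(θ * Complex.I)) = Complex.cos θ - Complex.sin θ * Complex.I := by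
    rw [← neg_mul, Complex.exp_mul_I, Complex.cos_neg, Complex.sin_neg]; ring
  rw [isoV, isoV, orthAct_orthRotation, orthAct_orthRotation, if_pos rfl, if_neg one_ne_zero,
    if_pos rfl, hexp]
  push_cast
  linear_combination (-Complex.sin θ * w 1 * (Real.sqrt 2 : ℂ)⁻¹) * Complex.I_mul_I

theorem isoU_orthAct_rotation {k : ℕ} (θ : ℝ) (w : KSpace (k + 2)) :
    isoU (orthAct (k + 2) (orthRotation 0 1 zero_ne_one θ) w) =
      Complex.exp (θ * Complex.I) * isoU w := by
  rw [isoU, isoU, orthAct_orthRotation, orthAct_orthRotation, if_pos rfl, if_neg one_ne_zero,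
    if_pos rfl, Complex.exp_mul_I]
  push_cast
  linear_combination (-Complex.sin θ * w 1 * (Real.sqrt 2 : ℂ)⁻¹) * Complex.I_mul_I

theorem isoXi_orthAct_rotation {k : ℕ} (θ : ℝ) (w : KSpace (k + 2)) (j : Fin (k + 1)) :
    isoXi j (orthAct (k + 2) (orthRotation 0 1 zero_ne_one θ) w) = isoXi j w := by
  rw [isoXi, isoXi, orthAct_orthRotation, if_neg (zero_ne_succ_succ j).symm,
    if_neg (one_ne_succ_succ j).symm]

/-- The point with prescribed isotropic coordinates. -/
def isoMk {k : ℕ} (a b : ℂ) (x : Fin (k + 1) → ℂ) : KSpace (k + 2) :=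
  WithLp.toLp 2 (Fin.cons ((a + b) * (Real.sqrt 2 : ℂ)⁻¹)
    (Fin.cons (-Complex.I * (a - b) * (Real.sqrt 2 : ℂ)⁻¹) x))

@[simp] theorem isoU_isoMk {k : ℕ} (a b : ℂ) (x : Fin (k + 1) → ℂ) : isoU (isoMk a b x) = a := by
  have h0 : isoMk a b x 0 = (a + b) * (Real.sqrt 2 : ℂ)⁻¹ := rfl
  have h1 : isoMk a b x 1 = -Complex.I * (a - b) * (Real.sqrt 2 : ℂ)⁻¹ := rfl
  rw [isoU, h0, h1]
  linear_combination (2 * a) * sqrt_two_inv_sq -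
    (a - b) * (Real.sqrt 2 : ℂ)⁻¹ * (Real.sqrt 2 : ℂ)⁻¹ * Complex.I_mul_I

@[simp] theorem isoV_isoMk {k : ℕ} (a b : ℂ) (x : Fin (k + 1) → ℂ) : isoV (isoMk a b x) = b := by
  have h0 : isoMk a b x 0 = (a + b) * (Real.sqrt 2 : ℂ)⁻¹ := rfl
  have h1 : isoMk a b x 1 = -Complex.I * (a - b) * (Real.sqrt 2 : ℂ)⁻¹ := rfl
  rw [isoV, h0, h1]
  linear_combination (2 * b) * sqrt_two_inv_sq +
    (a - b) * (Real.sqrt 2 : ℂ)⁻¹ * (Real.sqrt 2 : ℂ)⁻¹ * Complex.I_mul_I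

@[simp] theorem isoXi_isoMk {k : ℕ} (a b : ℂ) (x : Fin (k + 1) → ℂ) (j : Fin (k + 1)) :
    isoXi j (isoMk a b x) = x j := rfl

theorem iso_ext {k : ℕ} {w z : KSpace (k + 2)} (hU : isoU w = isoU z) (hV : isoV w = isoV z)
    (hX : ∀ j, isoXi j w = isoXi j z) : w = z := by
  have e0 : ∀ w : KSpace (k + 2), w 0 = (isoU w + isoV w) * (Real.sqrt 2 : ℂ)⁻¹ := fun w => by
    rw [isoU, isoV]; linear_combination (-2 * w 0) * sqrt_two_inv_sq
  have e1 : ∀ w : KSpace (k + 2), w 1 = -Complex.I * (isoU w - isoV w) * (Real.sqrt 2 : ℂ)⁻¹ :=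
    fun w => by
      rw [isoU, isoV]
      linear_combination (2 * Complex.I ^ 2 * w 1) * sqrt_two_inv_sq + w 1 * Complex.I_mul_I
  ext i
  refine Fin.cases ?_ (fun i => Fin.cases ?_ (fun j => hX j) i) i
  · rw [e0, e0 z, hU, hV]
  · rw [Fin.succ_zero_eq_one, e1, e1 z, hU, hV]

theorem isoMk_mem_keplerManifold {k : ℕ} {a b : ℂ} {x : Fin (k + 1) → ℂ}
    (h : 2 * a * b + ∑ j, x j ^ 2 = 0) (hne : a ≠ 0 ∨ b ≠ 0 ∨ ∃ j, x j ≠ 0) :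
    isoMk a b x ∈ keplerManifold (k + 2) := by
  refine ⟨by rw [sum_sq_eq_iso]; simpa using h, fun h0 => ?_⟩
  have hU : isoU (isoMk a b x) = isoU (0 : KSpace (k + 2)) := by rw [h0]
  have hV : isoV (isoMk a b x) = isoV (0 : KSpace (k + 2)) := by rw [h0]
  have hX : ∀ j, isoXi j (isoMk a b x) = isoXi j (0 : KSpace (k + 2)) := fun j => by rw [h0]
  have z0 : isoU (0 : KSpace (k + 2)) = 0 := by simp [isoU]
  have z1 : isoV (0 : KSpace (k + 2)) = 0 := by simp [isoV]
  have z2 : ∀ j, isoXi j (0 : KSpace (k + 2)) = 0 := fun j => rfl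
  rw [isoU_isoMk, z0] at hU
  rw [isoV_isoMk, z1] at hV
  simp only [isoXi_isoMk, z2] at hX
  rcases hne with h1 | h1 | ⟨j, h1⟩
  exacts [h1 hU, h1 hV, h1 (hX j)]

theorem differentiable_isoMk {k : ℕ} {a b : ℂ → ℂ} {x : ℂ → Fin (k + 1) → ℂ}
    (ha : Differentiable ℂ a) (hb : Differentiable ℂ b)
    (hx : ∀ j, Differentiable ℂ fun t => x t j) :
    Differentiable ℂ fun t => isoMk (a t) (b t) (x t) := by
  rw [differentiable_euclidean]
  refine fun i => Fin.cases ?_ (fun i => Fin.cases ?_ (fun j => hx j) i) i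
  · exact (ha.add hb).mul_const _
  · exact ((ha.sub hb).const_mul _).mul_const _

/-! ### Holomorphic functions on the Kepler manifold -/

theorem HolomorphicOnKepler.continuousOn {n : ℕ} {f : KSpace n → ℂ}
    (hf : HolomorphicOnKepler n (keplerManifold n) f) :
    ContinuousOn f (keplerManifold n) := fun z hz => by
  obtain ⟨U, hU, hzU, F, hF, hFf⟩ := hf z hz
  have h1 : ContinuousWithinAt F (keplerManifold n) z :=
    (hF.continuousOn.continuousAt (hU.mem_nhds hzU)).continuousWithinAt
  refine h1.congr_of_eventuallyEq ?_ (hFf ⟨hzU, hz⟩).symm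
  filter_upwards [mem_nhdsWithin_of_mem_nhds (hU.mem_nhds hzU), self_mem_nhdsWithin] with x hx hx'
  exact (hFf ⟨hx, hx'⟩).symm

theorem HolomorphicOnKepler.differentiableOn_comp {n : ℕ} {f : KSpace n → ℂ}
    (hf : HolomorphicOnKepler n (keplerManifold n) f) {γ : ℂ → KSpace n} {s : Set ℂ}
    (hs : IsOpen s) (hγ : Differentiable ℂ γ) (hmaps : MapsTo γ s (keplerManifold n)) :
    DifferentiableOn ℂ (fun t => f (γ t)) s := fun t ht => by
  obtain ⟨U, hU, hzU, F, hF, hFf⟩ := hf (γ t) (hmaps ht)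
  have h1 : DifferentiableAt ℂ (fun t => F (γ t)) t :=
    DifferentiableAt.comp t (hF.differentiableAt (hU.mem_nhds hzU)) (hγ t)
  refine (h1.congr_of_eventuallyEq ?_).differentiableWithinAt
  filter_upwards [(hγ.continuous.continuousAt).preimage_mem_nhds (hU.mem_nhds hzU),
    hs.mem_nhds ht] with x hx hx'
  exact (hFf ⟨hx, hmaps hx'⟩).symm

theorem HolomorphicOnKepler.comp_orthAct {n : ℕ} {f : KSpace n → ℂ}
    (hf : HolomorphicOnKepler n (keplerManifold n) f) (g : RealOrthogonal (n + 1)) :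
    HolomorphicOnKepler n (keplerManifold n) fun z => f (orthAct n g z) := fun z hz => by
  obtain ⟨U, hU, hzU, F, hF, hFf⟩ := hf _ (orthAct_mem_keplerManifold g hz)
  refine ⟨orthAct n g ⁻¹' U, hU.preimage (differentiable_orthAct g).continuous, hzU,
    fun z => F (orthAct n g z), ?_, fun x hx => hFf ⟨hx.1, orthAct_mem_keplerManifold g hx.2⟩⟩
  exact hF.comp (differentiable_orthAct g).differentiableOn fun x hx => hx

theorem continuous_isoMk {X : Type*} [TopologicalSpace X] {k : ℕ} {a b : X → ℂ}
    {x : X → Fin (k + 1) → ℂ} (ha : Continuous a) (hb : Continuous b)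
    (hx : ∀ j, Continuous fun t => x t j) : Continuous fun t => isoMk (a t) (b t) (x t) := by
  refine (PiLp.continuous_toLp 2 _).comp (continuous_pi fun i => ?_)
  refine Fin.cases ?_ (fun i => Fin.cases ?_ (fun j => hx j) i) i
  · exact (ha.add hb).mul_const _
  · exact (continuous_const.mul (ha.sub hb)).mul_const _

theorem isoU_smul {k : ℕ} (c : ℂ) (w : KSpace (k + 2)) : isoU (c • w) = c * isoU w := by
  simp only [isoU, PiLp.smul_apply, smul_eq_mul]; ring

theorem isoV_smul {k : ℕ} (c : ℂ) (w : KSpace (k + 2)) : isoV (c • w) = c * isoV w := by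
  simp only [isoV, PiLp.smul_apply, smul_eq_mul]; ring

theorem isoXi_smul {k : ℕ} (j : Fin (k + 1)) (c : ℂ) (w : KSpace (k + 2)) :
    isoXi j (c • w) = c * isoXi j w := by
  simp only [isoXi, PiLp.smul_apply, smul_eq_mul]

theorem isoMk_zero_one (k : ℕ) : (isoMk 0 1 0 : KSpace (k + 2)) = basePoint (k + 2) := by
  ext i
  refine Fin.cases ?_ (fun i => Fin.cases ?_ (fun j => ?_) i) i
  · simp [isoMk, basePoint]
  · simp [isoMk, basePoint, mul_comm]
  · simp [isoMk, basePoint]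

theorem isoMk_zero_zero {k : ℕ} (b : ℂ) :
    (isoMk 0 b 0 : KSpace (k + 2)) = b • basePoint (k + 2) := by
  rw [← isoMk_zero_one]
  refine iso_ext ?_ ?_ fun j => ?_
  · simp [isoU_smul]
  · simp [isoV_smul]
  · simp [isoXi_smul]

/-- The conic through `V(w)` times the base point and `w`. -/
def isoCurve {k : ℕ} (ζ : ℂ) (w : KSpace (k + 2)) : KSpace (k + 2) :=
  isoMk (ζ ^ 2 * isoU w) (isoV w) fun j => ζ * isoXi j w

/-- The weights `2, 0, 1` on `U, V, ξ` scale both terms of `2UV + ∑ ξ_j² = 0` by `ζ²`. The curve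
meets the vertex only if `ζ = 0` and `V = 0`. -/
theorem isoCurve_mem {k : ℕ} {ζ : ℂ} {w : KSpace (k + 2)} (hw : w ∈ keplerManifold (k + 2))
    (h : ζ ≠ 0 ∨ isoV w ≠ 0) : isoCurve ζ w ∈ keplerManifold (k + 2) := by
  refine isoMk_mem_keplerManifold ?_ ?_
  · simp_rw [mul_pow, ← Finset.mul_sum, sum_isoXi_sq hw]; ring
  · rcases eq_or_ne (isoV w) 0 with hV | hV
    · have hζ := h.resolve_right (not_not.2 hV)
      by_contra! hcon
      refine hw.2 (iso_ext ?_ ?_ fun j => ?_)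
      · simpa [isoU, hζ] using hcon.1
      · simp [hV]; simp [isoV]
      · exact (by simpa [hζ] using hcon.2.2 j : isoXi j w = 0)
    · exact Or.inr (Or.inl hV)

theorem isoCurve_zero {k : ℕ} (w : KSpace (k + 2)) : isoCurve 0 w = isoV w • basePoint (k + 2) := by
  rw [← isoMk_zero_zero, isoCurve]
  congr 1
  · simp
  · funext j; simp

/-- On the unit circle the conic is a phase times a rotation, so moving along it preserves integrals
over the orbit. -/
theorem isoCurve_exp {k : ℕ} (θ : ℝ) (w : KSpace (k + 2)) :
    isoCurve (Complex.exp (θ * Complex.I)) w = Complex.exp (θ * Complex.I) •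
      orthAct (k + 2) (orthRotation 0 1 zero_ne_one θ) w := by
  refine iso_ext ?_ ?_ fun j => ?_
  · rw [isoU_smul, isoU_orthAct_rotation, isoCurve, isoU_isoMk]; ring
  · rw [isoV_smul, isoV_orthAct_rotation, isoCurve, isoV_isoMk, ← mul_assoc, ← Complex.exp_add,
      add_neg_cancel, Complex.exp_zero, one_mul]
  · rw [isoXi_smul, isoXi_orthAct_rotation, isoCurve, isoXi_isoMk]

theorem Continuous.isoCurve {X : Type*} [TopologicalSpace X] {k : ℕ} {a : X → ℂ}
    {w : X → KSpace (k + 2)} (ha : Continuous a) (hw : Continuous w) :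
    Continuous fun x => isoCurve (a x) (w x) := by
  refine continuous_isoMk ?_ ?_ fun j => ?_
  · exact (ha.pow 2).mul (continuous_isoU.comp hw)
  · exact continuous_isoV.comp hw
  · exact ha.mul ((continuous_isoXi j).comp hw)

theorem differentiable_isoCurve {k : ℕ} (w : KSpace (k + 2)) :
    Differentiable ℂ fun ζ => isoCurve ζ w := by
  refine differentiable_isoMk ?_ ?_ fun j => ?_ <;> fun_prop

/-- A function holomorphic on the Kepler manifold extends, along a generator of the cone, to an
entire function. -/
theorem exists_entire_extension {k : ℕ} {f : KSpace (k + 2) → ℂ}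
    (hf : HolomorphicOnKepler (k + 2) (keplerManifold (k + 2)) f) :
    ∃ G : ℂ → ℂ, Differentiable ℂ G ∧ ∀ t : ℂ, t ≠ 0 → G t = f (t • basePoint (k + 2)) := by
  -- The map `(α, β) ↦ (U, V, ξ₀) = (-α²/2, β², αβ)` lands in the cone away from `(0, 0)`, and `ψ(0,
  -- β) = β² e` with `e` the base point. The maximum principle in `α` bounds `f(β² e)` by its values
  -- on `|α| = 1`, a compact set that includes `β = 0`; hence the singularity at the vertex is
  -- removable. A coordinate `ξ₀` exists because `n ≥ 2`.
  set ψ : ℂ × ℂ → KSpace (k + 2) := fun p =>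
    isoMk (-(p.1 ^ 2) / 2) (p.2 ^ 2) (Pi.single 0 (p.1 * p.2)) with hψ
  have hψc : Continuous ψ := by
    refine continuous_isoMk (by fun_prop) (by fun_prop) fun j => ?_
    rcases eq_or_ne j 0 with rfl | hj
    · simpa using
        (show Continuous fun t : ℂ × ℂ => t.1 * t.2 from continuous_fst.mul continuous_snd)
    · simpa [Pi.single_eq_of_ne hj] using continuous_const
  have hψm : ∀ p : ℂ × ℂ, p.1 ≠ 0 ∨ p.2 ≠ 0 → ψ p ∈ keplerManifold (k + 2) := fun p hp => by
    refine isoMk_mem_keplerManifold ?_ ?_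
    · rw [Finset.sum_eq_single 0]
      · simp; ring
      · intro j _ hj; simp [Pi.single_eq_of_ne hj]
      · simp
    · rcases hp with hp | hp
      · left; simp [hp]
      · right; left; simp [hp]
  have hcpt : IsCompact (Metric.sphere (0 : ℂ) 1 ×ˢ Metric.closedBall (0 : ℂ) 1) :=
    (isCompact_sphere _ _).prod (isCompact_closedBall _ _)
  obtain ⟨M, hM⟩ := hcpt.exists_bound_of_continuousOn (f := fun p => f (ψ p))
    (hf.continuousOn.comp hψc.continuousOn fun p hp => hψm p (Or.inl (by
      rintro h
      have := hp.1
      rw [h] at this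
      simp at this)))
  set h : ℂ → ℂ := fun t => f (t • basePoint (k + 2)) with hh
  have hhd : DifferentiableOn ℂ h {0}ᶜ :=
    hf.differentiableOn_comp isOpen_compl_singleton (by fun_prop)
      fun t ht => smul_mem_keplerManifold ht (basePoint_mem_keplerManifold (k + 1))
  have hbound : ∀ t : ℂ, t ≠ 0 → ‖t‖ ≤ 1 → ‖h t‖ ≤ M := fun t ht ht1 => by
    obtain ⟨β, hβ⟩ := IsAlgClosed.exists_pow_nat_eq t (n := 2) (by norm_num)
    have hβ0 : β ≠ 0 := fun h0 => ht (by rw [← hβ, h0]; norm_num)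
    have hβ1 : ‖β‖ ≤ 1 := by
      have : ‖β‖ ^ 2 ≤ 1 := by rw [← norm_pow, hβ]; exact ht1
      nlinarith [norm_nonneg β]
    have hd : Differentiable ℂ fun α => f (ψ (α, β)) := by
      rw [← differentiableOn_univ]
      refine hf.differentiableOn_comp isOpen_univ ?_ fun α _ => hψm _ (Or.inr hβ0)
      refine differentiable_isoMk (by fun_prop) (by fun_prop) fun j => ?_
      rcases eq_or_ne j 0 with rfl | hj
      · simp
      · simp [Pi.single_eq_of_ne hj]
    have h0 : f (ψ (0, β)) = h t := by
      rw [hh, ← hβ]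
      simp only [hψ, ← isoMk_zero_zero]
      congr 2
      · simp
      · simp
    rw [← h0]
    refine Complex.norm_le_of_forall_mem_frontier_norm_le (f := fun α => f (ψ (α, β)))
      (U := Metric.ball 0 1) Metric.isBounded_ball
      hd.diffContOnCl (fun α hα => ?_) (subset_closure (Metric.mem_ball_self one_pos))
    rw [frontier_ball _ one_ne_zero] at hα
    exact hM (α, β) ⟨hα, by simpa using hβ1⟩
  refine ⟨Function.update h 0 (limUnder (𝓝[≠] 0) h), fun t => ?_, fun t ht => by
    rw [Function.update_of_ne ht]⟩
  rcases eq_or_ne t 0 with rfl | ht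
  · refine (Complex.differentiableOn_update_limUnder_of_bddAbove (s := Metric.ball 0 1)
      (Metric.ball_mem_nhds 0 one_pos) (hhd.mono fun x hx => hx.2) ?_).differentiableAt
      (Metric.ball_mem_nhds 0 one_pos)
    refine ⟨M, ?_⟩
    rintro _ ⟨x, hx, rfl⟩
    exact hbound x hx.2 (mem_ball_zero_iff.1 hx.1).le
  · refine (hhd.differentiableAt (isOpen_compl_singleton.mem_nhds ht)).congr_of_eventuallyEq ?_
    filter_upwards [isOpen_compl_singleton.mem_nhds ht] with x hx
    rw [Function.update_of_ne hx]

theorem circleMap_zero_one (θ : ℝ) : circleMap 0 1 θ = Complex.exp (θ * Complex.I) := by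
  simp [circleMap]

/-- A null rotation fixes `U` and sends `ξ_j` to `ξ_j - tU` and `V` to `V + tξ_j - t²U/2`. It
preserves the quadratic form and moves `V` off zero when `ξ_j` or `U` is nonzero. -/
theorem exists_perturbation_isoV_ne_zero {k : ℕ} {w : KSpace (k + 2)}
    (hw : w ∈ keplerManifold (k + 2)) (hV : isoV w = 0) :
    ∃ γ : ℝ → KSpace (k + 2), Continuous γ ∧ γ 0 = w ∧ (∀ t, γ t ∈ keplerManifold (k + 2)) ∧
      ∀ᶠ t : ℝ in 𝓝[≠] 0, isoV (γ t) ≠ 0 := by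
  obtain ⟨j, hj⟩ : ∃ j, isoXi j w ≠ 0 ∨ isoU w ≠ 0 := by
    by_contra! hcon
    exact hw.2 (iso_ext (by rw [(hcon 0).2]; simp [isoU]) (by rw [hV]; simp [isoV])
      fun j => (hcon j).1)
  set γ : ℝ → KSpace (k + 2) := fun t => isoMk (isoU w)
    (t * isoXi j w - t ^ 2 * isoU w / 2) fun i => isoXi i w - if i = j then t * isoU w else 0
    with hγ
  have hγV : ∀ t, isoV (γ t) = t * (isoXi j w - t * isoU w / 2) := fun t => by
    rw [hγ, isoV_isoMk]; ring
  have hγm : ∀ t, γ t ∈ keplerManifold (k + 2) := fun t => by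
    have hsum : ∑ i, (isoXi i w - if i = j then t * isoU w else 0) ^ 2 =
        ∑ i, isoXi i w ^ 2 - 2 * t * isoXi j w * isoU w + t ^ 2 * isoU w ^ 2 := by
      have : ∀ i, (isoXi i w - if i = j then (t : ℂ) * isoU w else 0) ^ 2 =
          isoXi i w ^ 2 + if i = j then -2 * t * isoXi i w * isoU w + t ^ 2 * isoU w ^ 2 else 0 :=
        fun i => by split_ifs <;> ring
      simp_rw [this, Finset.sum_add_distrib, Finset.sum_ite_eq']
      simp
      ring
    refine isoMk_mem_keplerManifold ?_ ?_
    · rw [hsum, sum_isoXi_sq hw, hV]; ring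
    · rcases eq_or_ne (isoU w) 0 with hU | hU
      · right; right
        exact ⟨j, by simpa [hU] using hj⟩
      · exact Or.inl hU
  have hγc : Continuous γ := by
    refine continuous_isoMk continuous_const (by fun_prop) fun i => ?_
    by_cases hij : i = j
    · simp only [hij, if_true]; fun_prop
    · simp only [hij, if_false]; fun_prop
  have hγ0 : γ 0 = w := by
    refine iso_ext ?_ ?_ fun i => ?_
    · rw [hγ, isoU_isoMk]
    · rw [hγV, hV]; simp
    · simp [hγ]
  refine ⟨γ, hγc, hγ0, hγm, ?_⟩
  rcases eq_or_ne (isoXi j w) 0 with hX | hX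
  · have hU := hj.resolve_left (not_not.2 hX)
    filter_upwards [self_mem_nhdsWithin] with t ht
    have ht' : (t : ℂ) ≠ 0 := by exact_mod_cast ht
    rw [hγV, hX]
    simp [hU, ht']
  · have hc : ∀ x u : ℂ, ContinuousAt (fun t : ℝ => x - t * u / 2) 0 := fun x u => by fun_prop
    have h1 := (hc (isoXi j w) (isoU w)).eventually_ne (y := 0) (by simpa using hX)
    filter_upwards [self_mem_nhdsWithin, mem_nhdsWithin_of_mem_nhds h1] with t ht ht2
    have ht' : (t : ℂ) ≠ 0 := by exact_mod_cast ht
    rw [hγV]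
    exact mul_ne_zero ht' ht2

/-- The mean of a holomorphic function over the conic `isoCurve`. -/
theorem integral_isoCurve {k : ℕ} {f : KSpace (k + 2) → ℂ}
    (hf : HolomorphicOnKepler (k + 2) (keplerManifold (k + 2)) f) {G : ℂ → ℂ}
    (hG : Differentiable ℂ G) (hGf : ∀ t : ℂ, t ≠ 0 → G t = f (t • basePoint (k + 2)))
    {w : KSpace (k + 2)} (hw : w ∈ keplerManifold (k + 2)) :
    ∫ θ in (0 : ℝ)..2 * Real.pi, f (isoCurve (Complex.exp (θ * Complex.I)) w) =
      2 * Real.pi * G (isoV w) := by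
  have main : ∀ w ∈ keplerManifold (k + 2), isoV w ≠ 0 →
      ∫ θ in (0 : ℝ)..2 * Real.pi, f (isoCurve (Complex.exp (θ * Complex.I)) w) =
        2 * Real.pi * G (isoV w) := fun w hw hV => by
    have hd : Differentiable ℂ fun ζ => f (isoCurve ζ w) := by
      rw [← differentiableOn_univ]
      exact hf.differentiableOn_comp isOpen_univ (differentiable_isoCurve w) fun ζ _ =>
        isoCurve_mem hw (Or.inr hV)
    -- Mean value property in `ζ`: the value at the centre is `f` at `V(w)` times the base point.
    have h := (hd.diffContOnCl (s := Metric.ball 0 |1|)).circleAverage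
    rw [Real.circleAverage_def, isoCurve_zero, ← hGf _ hV, Complex.real_smul] at h
    simp only [circleMap_zero_one] at h
    have h2 : (2 * Real.pi : ℂ) * ((2 * Real.pi)⁻¹ : ℝ) = 1 := by
      push_cast
      exact mul_inv_cancel₀ (by exact_mod_cast Real.two_pi_pos.ne')
    rw [← h, ← mul_assoc, h2, one_mul]
  by_cases hV : isoV w = 0
  swap
  · exact main w hw hV
  -- When `V(w) = 0` the disc passes through the vertex, where `f` is not controlled; both sides are
  -- continuous in `w`, so a limit along `γ` suffices.
  obtain ⟨γ, hγc, hγ0, hγm, hev⟩ := exists_perturbation_isoV_ne_zero hw hV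
  have hL : Continuous fun t : ℝ =>
      ∫ θ in (0 : ℝ)..2 * Real.pi, f (isoCurve (Complex.exp (θ * Complex.I)) (γ t)) := by
    have hc1 : Continuous fun p : ℝ × ℝ => Complex.exp (p.2 * Complex.I) := by fun_prop
    have hc2 : Continuous fun p : ℝ × ℝ => isoCurve (Complex.exp (p.2 * Complex.I)) (γ p.1) :=
      hc1.isoCurve (hγc.comp continuous_fst)
    have hc3 : Continuous fun p : ℝ × ℝ => f (isoCurve (Complex.exp (p.2 * Complex.I)) (γ p.1)) :=
      hf.continuousOn.comp_continuous hc2 fun p =>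
        isoCurve_mem (hγm p.1) (Or.inl (Complex.exp_ne_zero _))
    exact intervalIntegral.continuous_parametric_intervalIntegral_of_continuous' hc3 _ _
  have hR : Continuous fun t : ℝ => 2 * Real.pi * G (isoV (γ t)) :=
    continuous_const.mul (hG.continuous.comp (continuous_isoV.comp hγc))
  have heq : (fun t : ℝ => 2 * Real.pi * G (isoV (γ t))) =ᶠ[𝓝[≠] 0] fun t : ℝ =>
      ∫ θ in (0 : ℝ)..2 * Real.pi, f (isoCurve (Complex.exp (θ * Complex.I)) (γ t)) := by
    filter_upwards [hev] with t ht
    exact (main _ (hγm t) ht).symm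
  have l1 := (hL.tendsto 0).mono_left (nhdsWithin_le_nhds (s := {0}ᶜ))
  have l2 := ((hR.tendsto 0).mono_left (nhdsWithin_le_nhds (s := {0}ᶜ))).congr' heq
  have := tendsto_nhds_unique l1 l2
  rwa [hγ0] at this

/-- Transitivity: on the cone the real and imaginary parts are orthogonal of equal length. Scaled by
`√2/‖z‖` they become an orthonormal pair, and any completion to an orthonormal basis gives the
columns of the matrix sought. -/
theorem exists_eq_norm_smul_orbitPoint {k : ℕ} {z : KSpace (k + 1)}
    (hz : z ∈ keplerManifold (k + 1)) : ∃ g, z = (‖z‖ : ℂ) • orbitPoint (k + 1) g := by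
  have hz0 : 0 < ‖z‖ := norm_pos_iff.2 hz.2
  set c : ℝ := Real.sqrt 2 / ‖z‖ with hc
  have hc0 : 0 < c := by positivity
  set a : EuclideanSpace ℝ (Fin (k + 2)) := WithLp.toLp 2 fun i => c * (z i).re with ha
  set b : EuclideanSpace ℝ (Fin (k + 2)) := WithLp.toLp 2 fun i => c * (z i).im with hb
  have hre : ∑ i, ((z i).re * (z i).re - (z i).im * (z i).im) = 0 := by
    have := congrArg Complex.re hz.1
    simpa using this
  have him : ∑ i, (z i).re * (z i).im = 0 := by
    have h1 := congrArg Complex.im hz.1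
    simp only [Complex.im_sum, Complex.mul_im, Complex.zero_im] at h1
    have h2 : ∑ i, ((z i).re * (z i).im + (z i).im * (z i).re) = 2 * ∑ i, (z i).re * (z i).im := by
      rw [Finset.mul_sum]; exact Finset.sum_congr rfl fun i _ => by ring
    linarith
  have hn : ∑ i, ((z i).re * (z i).re + (z i).im * (z i).im) = ‖z‖ ^ 2 := by
    rw [EuclideanSpace.norm_sq_eq]
    exact Finset.sum_congr rfl fun i _ => by rw [Complex.sq_norm, Complex.normSq_apply]
  rw [Finset.sum_sub_distrib] at hre
  rw [Finset.sum_add_distrib] at hn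
  have hc2 : c ^ 2 * ‖z‖ ^ 2 = 2 := by
    rw [hc, div_pow, Real.sq_sqrt two_pos.le]; field_simp
  have haa : inner ℝ a a = 1 := by
    have : inner ℝ a a = c ^ 2 * ∑ i, (z i).re * (z i).re := by
      rw [PiLp.inner_apply, Finset.mul_sum]
      exact Finset.sum_congr rfl fun i _ => by
        simp only [ha, RCLike.inner_apply, conj_trivial]; ring
    rw [this]; nlinarith
  have hbb : inner ℝ b b = 1 := by
    have : inner ℝ b b = c ^ 2 * ∑ i, (z i).im * (z i).im := by
      rw [PiLp.inner_apply, Finset.mul_sum]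
      exact Finset.sum_congr rfl fun i _ => by
        simp only [hb, RCLike.inner_apply, conj_trivial]; ring
    rw [this]; nlinarith
  have hab : inner ℝ a b = 0 := by
    have : inner ℝ a b = c ^ 2 * ∑ i, (z i).re * (z i).im := by
      rw [PiLp.inner_apply, Finset.mul_sum]
      exact Finset.sum_congr rfl fun i _ => by
        simp only [ha, hb, RCLike.inner_apply, conj_trivial]; ring
    rw [this, him, mul_zero]
  set v : Fin (k + 2) → EuclideanSpace ℝ (Fin (k + 2)) := fun i => if i = 0 then a else b with hv
  have hon : Orthonormal ℝ (({0, 1} : Set (Fin (k + 2))).domRestrict v) := by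
    rw [orthonormal_iff_ite]
    rintro ⟨i, hi⟩ ⟨j, hj⟩
    have hv0 : v 0 = a := by simp [hv]
    have hv1 : v 1 = b := by simp [hv]
    have hba : inner ℝ b a = 0 := by rw [real_inner_comm, hab]
    change inner ℝ (v i) (v j) = _
    simp only [mem_insert_iff, mem_singleton_iff] at hi hj
    rcases hi with rfl | rfl <;> rcases hj with rfl | rfl <;>
      simp only [hv0, hv1, haa, hbb, hab, hba] <;> simp
  obtain ⟨e, he⟩ := hon.exists_orthonormalBasis_extension_of_card_eq (by simp)
  have he0 : e 0 = a := by rw [he 0 (by simp)]; simp [hv]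
  have he1 : e 1 = b := by rw [he 1 (by simp)]; simp [hv]
  set M : Matrix (Fin (k + 2)) (Fin (k + 2)) ℝ := Matrix.of fun i j => e j i with hM
  have hMM : star M * M = 1 := by
    ext i j
    rw [Matrix.star_eq_conjTranspose, Matrix.conjTranspose_eq_transpose_of_trivial,
      Matrix.mul_apply, Matrix.one_apply, ← orthonormal_iff_ite.1 e.orthonormal i j,
      PiLp.inner_apply]
    exact Finset.sum_congr rfl fun x _ => by simp [hM, mul_comm]
  refine ⟨⟨M, Unitary.mem_iff.2 ⟨hMM, mul_eq_one_comm.1 hMM⟩⟩, ?_⟩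
  ext i
  rw [PiLp.smul_apply, orbitPoint, orthAct_apply, Fin.sum_univ_succ, Fin.sum_univ_succ]
  have : ∀ j : Fin k, basePoint (k + 1) j.succ.succ = 0 := fun j => by
    simp [basePoint]
  have hb0 : basePoint (k + 1) 0 = (Real.sqrt 2 : ℂ)⁻¹ := by simp [basePoint]
  have hb1 : basePoint (k + 1) 1 = (Real.sqrt 2 : ℂ)⁻¹ * Complex.I := by simp [basePoint]
  simp only [this, mul_zero, Finset.sum_const_zero, add_zero, Fin.succ_zero_eq_one, hb0, hb1]
  have hM0 : M i 0 = c * (z i).re := by simp [hM, he0, ha]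
  have hM1 : M i 1 = c * (z i).im := by simp [hM, he1, hb]
  simp only [hM0, hM1, smul_eq_mul]
  have hz' : (‖z‖ : ℂ) ≠ 0 := by exact_mod_cast hz0.ne'
  have hs' : (Real.sqrt 2 : ℂ) ≠ 0 := by exact_mod_cast (Real.sqrt_pos.2 two_pos).ne'
  have hcc : (c : ℂ) = (Real.sqrt 2 : ℂ) / ‖z‖ := by rw [hc]; push_cast; rfl
  push_cast
  rw [hcc]
  field_simp
  exact (Complex.re_add_im (z i)).symm

theorem inner_basePoint {k : ℕ} (w : KSpace (k + 2)) : inner ℂ (basePoint (k + 2)) w = isoV w := by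
  have : ∀ j : Fin (k + 1), basePoint (k + 2) j.succ.succ = 0 := fun j => by
    simp [basePoint]
  have hb0 : basePoint (k + 2) 0 = (Real.sqrt 2 : ℂ)⁻¹ := by simp [basePoint]
  have hb1 : basePoint (k + 2) 1 = (Real.sqrt 2 : ℂ)⁻¹ * Complex.I := by simp [basePoint]
  rw [PiLp.inner_apply, Fin.sum_univ_succ, Fin.sum_univ_succ]
  simp only [this, RCLike.inner_apply, map_zero, mul_zero, Finset.sum_const_zero, add_zero,
    Fin.succ_zero_eq_one, hb0, hb1, isoV, map_mul, map_inv₀, Complex.conj_ofReal, Complex.conj_I]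
  ring

/-! ### Averages over the circle -/

theorem integral_exp_int_mul_I (m : ℤ) :
    ∫ θ in (0 : ℝ)..2 * Real.pi, Complex.exp (m * θ * Complex.I) =
      if m = 0 then 2 * Real.pi else 0 := by
  split_ifs with h
  · simp [h]
  · have hc : (m : ℂ) * Complex.I ≠ 0 := mul_ne_zero (by exact_mod_cast h) Complex.I_ne_zero
    have := integral_exp_mul_complex (a := 0) (b := 2 * Real.pi) hc
    rw [show (fun θ : ℝ => Complex.exp (m * θ * Complex.I)) =
      fun θ : ℝ => Complex.exp (m * Complex.I * θ) by funext θ; ring_nf, this]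
    have h1 : Complex.exp (m * Complex.I * ((2 * Real.pi : ℝ) : ℂ)) = 1 := by
      rw [← Complex.exp_int_mul_two_pi_mul_I m]; push_cast; ring_nf
    rw [h1]
    simp

/-- Expand `G` in its Taylor series; orthogonality of characters keeps only degree `l`. -/
theorem integral_entire_circle {G : ℂ → ℂ} (hG : Differentiable ℂ G) (v : ℂ) (l : ℕ) :
    ∫ θ in (0 : ℝ)..2 * Real.pi, G (Complex.exp (θ * Complex.I) * v) *
        starRingEnd ℂ (Complex.exp (θ * Complex.I)) ^ l =
      2 * Real.pi * (((l.factorial : ℂ)⁻¹ * iteratedDeriv l G 0) * v ^ l) := by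
  set a : ℕ → ℂ := fun i => (i.factorial : ℂ)⁻¹ * iteratedDeriv i G 0 with ha
  have hsum : ∀ x, HasSum (fun i => a i * x ^ i) (G x) := fun x => by
    have h := Complex.hasSum_taylorSeries_of_entire hG 0 x
    have e : (fun i => a i * x ^ i) =
        fun i : ℕ => (i.factorial : ℂ)⁻¹ • (x - 0) ^ i • iteratedDeriv i G 0 := by
      funext i; simp [ha]; ring
    rw [e]; exact h
  set F : ℕ → ℝ → ℂ := fun i θ => a i * v ^ i * Complex.exp (((i : ℤ) - l : ℤ) * θ * Complex.I)
    with hF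
  have hFn : ∀ i θ, ‖F i θ‖ = ‖a i * v ^ i‖ := fun i θ => by
    rw [hF, norm_mul]
    have : ((((i : ℤ) - l : ℤ) : ℂ) * θ * Complex.I) =
        (((((i : ℤ) - l : ℤ) : ℝ) * θ : ℝ) : ℂ) * Complex.I := by push_cast; ring
    rw [this, Complex.norm_exp_ofReal_mul_I, mul_one]
  have hFc : ∀ i, Continuous (F i) := fun i => by rw [hF]; fun_prop
  have hpt : ∀ θ : ℝ, ∑' i, F i θ = G (Complex.exp (θ * Complex.I) * v) *
        starRingEnd ℂ (Complex.exp (θ * Complex.I)) ^ l := fun θ => by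
    rw [← (hsum _).tsum_eq, ← tsum_mul_right]
    congr 1 with i
    have h1 : starRingEnd ℂ (Complex.exp (θ * Complex.I)) = Complex.exp (-(θ * Complex.I)) := by
      rw [← Complex.exp_conj]; simp
    rw [hF, h1, mul_pow, ← Complex.exp_nat_mul, ← Complex.exp_nat_mul]
    have : Complex.exp (((i : ℤ) - l : ℤ) * θ * Complex.I) =
        Complex.exp (i * (θ * Complex.I)) * Complex.exp (l * -(θ * Complex.I)) := by
      rw [← Complex.exp_add]; congr 1; push_cast; ring
    simp only [this]
    ring
  have hs : Summable fun i => ∫ θ in Ioc (0 : ℝ) (2 * Real.pi), ‖F i θ‖ := by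
    simp only [hFn, integral_const]
    exact ((hsum v).summable.norm).const_smul _
  have h := hasSum_integral_of_summable_integral_norm
    (μ := volume.restrict (Ioc (0 : ℝ) (2 * Real.pi)))
    (fun i => ((hFc i).integrableOn_Icc (a := 0) (b := 2 * Real.pi)).mono_set
      Ioc_subset_Icc_self) hs
  have e : ∀ i, ∫ θ in Ioc (0 : ℝ) (2 * Real.pi), F i θ =
      if i = l then 2 * Real.pi * (a l * v ^ l) else 0 := fun i => by
    rw [← intervalIntegral.integral_of_le Real.two_pi_pos.le, hF]
    simp only
    rw [intervalIntegral.integral_const_mul, integral_exp_int_mul_I]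
    by_cases hil : i = l
    · subst hil; simp; ring
    · have : ¬ ((i : ℤ) - l = 0) := by omega
      simp [hil, this]
  simp only [e] at h
  have h2 := h.unique (hasSum_ite_eq l (2 * Real.pi * (a l * v ^ l) : ℂ))
  rw [intervalIntegral.integral_of_le Real.two_pi_pos.le, ← h2]
  simp only [hpt]

/-- Fubini: averaging over `θ` changes nothing when the integral over the group does not depend on
`θ`. -/
theorem eq_integral_of_circle_average {N : ℕ} {Φ : ℝ → RealOrthogonal N → ℂ}
    (hΦ : Continuous fun p : ℝ × RealOrthogonal N => Φ p.1 p.2) {I : ℂ} {Ψ : RealOrthogonal N → ℂ}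
    (hI : ∀ θ, ∫ g, Φ θ g ∂orthHaar N = I)
    (hΨ : ∀ g, ∫ θ in (0 : ℝ)..2 * Real.pi, Φ θ g = 2 * Real.pi * Ψ g) :
    I = ∫ g, Ψ g ∂orthHaar N := by
  have hint : Integrable (fun p : ℝ × RealOrthogonal N => Φ p.1 p.2)
      ((volume.restrict (Ioc (0 : ℝ) (2 * Real.pi))).prod (orthHaar N)) := by
    obtain ⟨C, hC⟩ := ((isCompact_Icc (a := (0 : ℝ)) (b := 2 * Real.pi)).prod
      (isCompact_univ (X := RealOrthogonal N))).exists_bound_of_continuousOn hΦ.continuousOn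
    have hr : (volume.restrict (Ioc (0 : ℝ) (2 * Real.pi))).prod (orthHaar N) =
        (volume.prod (orthHaar N)).restrict (Ioc (0 : ℝ) (2 * Real.pi) ×ˢ univ) := by
      rw [← Measure.prod_restrict, Measure.restrict_univ]
    refine Integrable.of_bound hΦ.aestronglyMeasurable C ?_
    rw [hr]
    filter_upwards [ae_restrict_mem (measurableSet_Ioc.prod MeasurableSet.univ)] with p hp
    exact hC p ⟨Ioc_subset_Icc_self hp.1, mem_univ _⟩
  have h := integral_integral_swap hint
  simp only [hI, ← intervalIntegral.integral_of_le Real.two_pi_pos.le, hΨ,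
    integral_const_mul, intervalIntegral.integral_const] at h
  have hp : (2 * Real.pi : ℂ) ≠ 0 := by exact_mod_cast Real.two_pi_pos.ne'
  apply mul_left_cancel₀ hp
  rw [← h]
  simp

/-- Two averages. Over the conics, `V` is constant, so the weight `V̄^l` is unaffected while `f`
becomes `G(tV)`. Over phases, only the Taylor term of degree `l` survives, and its integral is the
moment in `integral_V_pow`. -/
theorem integral_sphere_reproducing_base {k : ℕ} {f : KSpace (k + 2) → ℂ}
    (hf : HolomorphicOnKepler (k + 2) (keplerManifold (k + 2)) f) {G : ℂ → ℂ}
    (hG : Differentiable ℂ G) (hGf : ∀ t : ℂ, t ≠ 0 → G t = f (t • basePoint (k + 2)))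
    {t : ℂ} (ht : t ≠ 0) (l : ℕ) :
    ∫ g, f (t • orbitPoint (k + 2) g) * starRingEnd ℂ (isoV (orbitPoint (k + 2) g)) ^ l
        ∂orthHaar (k + 3) =
      t ^ l * ((l.factorial : ℂ)⁻¹ * iteratedDeriv l G 0) * ((keplerDim k l)⁻¹ : ℝ) := by
  have ho := continuous_orbitPoint (k + 2)
  have hom := orbitPoint_mem_keplerManifold (k + 1)
  have cV : Continuous fun g => isoV (orbitPoint (k + 2) g) := continuous_isoV.comp ho
  have cE : Continuous fun p : ℝ × RealOrthogonal (k + 3) => Complex.exp (p.1 * Complex.I) := by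
    fun_prop
  have h1 : ∫ g, f (t • orbitPoint (k + 2) g) * starRingEnd ℂ (isoV (orbitPoint (k + 2) g)) ^ l
      ∂orthHaar (k + 3) = ∫ g, G (t * isoV (orbitPoint (k + 2) g)) *
        starRingEnd ℂ (isoV (orbitPoint (k + 2) g)) ^ l ∂orthHaar (k + 3) := by
    refine eq_integral_of_circle_average (Φ := fun θ g =>
      f (isoCurve (Complex.exp (θ * Complex.I)) (t • orbitPoint (k + 2) g)) *
        starRingEnd ℂ (isoV (orbitPoint (k + 2) g)) ^ l) ?_ (fun θ => ?_) fun g => ?_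
    · have c1 : Continuous fun p : ℝ × RealOrthogonal (k + 3) =>
          isoCurve (Complex.exp (p.1 * Complex.I)) (t • orbitPoint (k + 2) p.2) :=
        cE.isoCurve ((ho.comp continuous_snd).const_smul t)
      have c2 : Continuous fun p : ℝ × RealOrthogonal (k + 3) =>
          f (isoCurve (Complex.exp (p.1 * Complex.I)) (t • orbitPoint (k + 2) p.2)) :=
        hf.continuousOn.comp_continuous c1 fun p =>
          isoCurve_mem (smul_mem_keplerManifold ht (hom _)) (Or.inl (Complex.exp_ne_zero _))
      exact c2.mul ((continuous_conj_comp (cV.comp continuous_snd)).pow l)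
    · have e : ∀ w : KSpace (k + 2), isoV w = isoV (Complex.exp (θ * Complex.I) •
          orthAct (k + 2) (orthRotation 0 1 zero_ne_one θ) w) := fun w => by
        rw [isoV_smul, isoV_orthAct_rotation, ← mul_assoc, ← Complex.exp_add,
          add_neg_cancel, Complex.exp_zero, one_mul]
      simp only [isoCurve_exp, orthAct_smul]
      calc _ = ∫ g, (fun w => f (t • w) * starRingEnd ℂ (isoV w) ^ l)
            (Complex.exp (θ * Complex.I) • orthAct (k + 2) (orthRotation 0 1 zero_ne_one θ)
              (orbitPoint (k + 2) g)) ∂orthHaar (k + 3) := by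
            congr 1 with g
            simp only
            rw [← e, smul_comm t]
        _ = ∫ g, (fun w => f (t • w) * starRingEnd ℂ (isoV w) ^ l)
            (Complex.exp (θ * Complex.I) • orbitPoint (k + 2) g) ∂orthHaar (k + 3) :=
            integral_orbitPoint_orthAct (fun w => (fun w => f (t • w) *
              starRingEnd ℂ (isoV w) ^ l) (Complex.exp (θ * Complex.I) • w)) _
        _ = _ := integral_orbitPoint_smul (fun w => f (t • w) * starRingEnd ℂ (isoV w) ^ l) θ
    · rw [intervalIntegral.integral_mul_const, integral_isoCurve hf hG hGf
        (smul_mem_keplerManifold ht (hom g)), isoV_smul, mul_assoc]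
  have h2 : ∫ g, G (t * isoV (orbitPoint (k + 2) g)) *
        starRingEnd ℂ (isoV (orbitPoint (k + 2) g)) ^ l ∂orthHaar (k + 3) =
      ∫ g, ((l.factorial : ℂ)⁻¹ * iteratedDeriv l G 0) * (t * isoV (orbitPoint (k + 2) g)) ^ l *
        starRingEnd ℂ (isoV (orbitPoint (k + 2) g)) ^ l ∂orthHaar (k + 3) := by
    refine eq_integral_of_circle_average (Φ := fun θ g =>
      G (Complex.exp (θ * Complex.I) * (t * isoV (orbitPoint (k + 2) g))) *
        starRingEnd ℂ (Complex.exp (θ * Complex.I)) ^ l *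
        starRingEnd ℂ (isoV (orbitPoint (k + 2) g)) ^ l) ?_ (fun θ => ?_) fun g => ?_
    · have c1 : Continuous fun p : ℝ × RealOrthogonal (k + 3) =>
          G (Complex.exp (p.1 * Complex.I) * (t * isoV (orbitPoint (k + 2) p.2))) :=
        hG.continuous.comp (cE.mul (continuous_const.mul (cV.comp continuous_snd)))
      exact (c1.mul ((continuous_conj_comp cE).pow l)).mul
        ((continuous_conj_comp (cV.comp continuous_snd)).pow l)
    · rw [← integral_orbitPoint_smul (fun w => G (t * isoV w) * starRingEnd ℂ (isoV w) ^ l) θ]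
      congr 1 with g
      rw [isoV_smul, map_mul, mul_pow, mul_left_comm t]
      ring
    · rw [intervalIntegral.integral_mul_const, integral_entire_circle hG]
      ring
  rw [h1, h2, ← integral_V_pow, ← integral_const_mul]
  congr 1 with g
  rw [mul_pow, mul_pow]
  ring

/-- Integration against a power of the pairing with `z` extracts the homogeneous component
of `f` at `z`. -/
theorem exists_homogeneous_components {k : ℕ} {f : KSpace (k + 2) → ℂ}
    (hf : HolomorphicOnKepler (k + 2) (keplerManifold (k + 2)) f) {z : KSpace (k + 2)}
    (hz : z ∈ keplerManifold (k + 2)) :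
    ∃ A : ℕ → ℂ, HasSum A (f z) ∧ ∀ t : ℂ, t ≠ 0 → ∀ l : ℕ,
      ∫ g, f (t • orbitPoint (k + 2) g) * inner ℂ (orbitPoint (k + 2) g) z ^ l
        ∂orthHaar (k + 3) = t ^ l * A l * ((keplerDim k l)⁻¹ : ℝ) := by
  -- Rotate so that `z` becomes `‖z‖` times the base point; the components are then the Taylor terms
  -- of the entire extension at `‖z‖`.
  obtain ⟨h, hh⟩ := exists_eq_norm_smul_orbitPoint hz
  have hz0 : (‖z‖ : ℂ) ≠ 0 := by exact_mod_cast (norm_pos_iff.2 hz.2).ne'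
  have hf' := hf.comp_orthAct h
  obtain ⟨G, hG, hGf⟩ := exists_entire_extension hf'
  have hfz : G ‖z‖ = f z := by
    rw [hGf _ hz0, orthAct_smul]
    exact congrArg f hh.symm
  refine ⟨fun l => ((l.factorial : ℂ)⁻¹ * iteratedDeriv l G 0) * (‖z‖ : ℂ) ^ l, ?_,
    fun t ht l => ?_⟩
  · rw [← hfz]
    have h := Complex.hasSum_taylorSeries_of_entire hG 0 (‖z‖ : ℂ)
    have e : (fun i : ℕ => (i.factorial : ℂ)⁻¹ * iteratedDeriv i G 0 * (‖z‖ : ℂ) ^ i) =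
        fun i : ℕ => (i.factorial : ℂ)⁻¹ • ((‖z‖ : ℂ) - 0) ^ i • iteratedDeriv i G 0 := by
      funext i; simp; ring
    rw [e]; exact h
  · rw [← integral_orbitPoint_orthAct (fun w => f (t • w) * inner ℂ w z ^ l) h]
    have e : ∀ g, f (t • orthAct (k + 2) h (orbitPoint (k + 2) g)) *
        inner ℂ (orthAct (k + 2) h (orbitPoint (k + 2) g)) z ^ l =
        (‖z‖ : ℂ) ^ l * (f (orthAct (k + 2) h (t • orbitPoint (k + 2) g)) *
          starRingEnd ℂ (isoV (orbitPoint (k + 2) g)) ^ l) := fun g => by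
      have e1 : inner ℂ (orthAct (k + 2) h (orbitPoint (k + 2) g)) z =
          (‖z‖ : ℂ) * starRingEnd ℂ (isoV (orbitPoint (k + 2) g)) := by
        conv_lhs => rw [hh]
        rw [inner_smul_right, ← inner_basePoint, inner_conj_symm]
        exact congrArg _ (inner_orthAct h _ _)
      rw [e1, orthAct_smul, mul_pow]
      ring
    simp only [e]
    rw [integral_const_mul, integral_sphere_reproducing_base hf' hG hGf ht]
    ring

/-! ### The measure on the cone -/

theorem measurableSet_keplerManifold (n : ℕ) : MeasurableSet (keplerManifold n) := by
  have h : keplerManifold n = {z : KSpace n | ∑ i, z i * z i = 0} ∩ {0}ᶜ := rfl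
  rw [h]
  refine (isClosed_eq ?_ continuous_const).measurableSet.inter (measurableSet_singleton _).compl
  fun_prop

theorem continuous_ofReal_smul_orbitPoint (n : ℕ) :
    Continuous fun p : ℝ × RealOrthogonal (n + 1) => (p.1 : ℂ) • orbitPoint n p.2 :=
  (Complex.continuous_ofReal.comp continuous_fst).smul
    ((continuous_orbitPoint n).comp continuous_snd)

theorem coneMeasure_eq_map (n : ℕ) (ρ : Measure ℝ) [SFinite ρ] :
    coneMeasure n ρ =
      (ρ.prod (orthHaar (n + 1))).map fun p => (p.1 : ℂ) • orbitPoint n p.2 := by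
  have h : ρ.prod (sphereMeasure n) =
      (ρ.prod (orthHaar (n + 1))).map (Prod.map id (orbitPoint n)) := by
    rw [← Measure.map_prod_map _ _ measurable_id (continuous_orbitPoint n).measurable,
      Measure.map_id]
    rfl
  rw [coneMeasure, h, Measure.map_map (by fun_prop)
    (measurable_id.prodMap (continuous_orbitPoint n).measurable)]
  rfl

theorem ae_coneMeasure_mem (k : ℕ) {ρ : Measure ℝ} [SFinite ρ] (hρ : ∀ᵐ t ∂ρ, 0 < t) :
    ∀ᵐ w ∂coneMeasure (k + 1) ρ, w ∈ keplerManifold (k + 1) := by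
  rw [coneMeasure_eq_map]
  refine (ae_map_iff (continuous_ofReal_smul_orbitPoint _).aemeasurable
    (measurableSet_keplerManifold _)).2 ?_
  filter_upwards [Measure.quasiMeasurePreserving_fst.ae hρ] with p hp
  exact smul_mem_keplerManifold (by exact_mod_cast hp.ne') (orbitPoint_mem_keplerManifold k _)

theorem integral_coneMeasure {n : ℕ} {ρ : Measure ℝ} [SFinite ρ] {F : KSpace n → ℂ}
    (hF : Integrable F (coneMeasure n ρ)) :
    ∫ w, F w ∂coneMeasure n ρ =
      ∫ t, ∫ g, F ((t : ℂ) • orbitPoint n g) ∂orthHaar (n + 1) ∂ρ := by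
  have hm := (continuous_ofReal_smul_orbitPoint n).aemeasurable (μ := ρ.prod (orthHaar (n + 1)))
  rw [coneMeasure_eq_map] at hF ⊢
  rw [integral_map hm hF.aestronglyMeasurable]
  exact integral_prod _ (hF.comp_aemeasurable hm)

theorem norm_ofReal_smul_orbitPoint (k : ℕ) (t : ℝ) (g : RealOrthogonal (k + 2)) :
    ‖(t : ℂ) • orbitPoint (k + 1) g‖ = |t| := by
  rw [norm_smul, norm_orbitPoint, mul_one, Complex.norm_real, Real.norm_eq_abs]

theorem integrable_norm_pow_coneMeasure (k : ℕ) {ρ : Measure ℝ} [SFinite ρ] {l : ℕ}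
    (h : Integrable (fun t => t ^ (2 * l)) ρ) :
    Integrable (fun w => ‖w‖ ^ (2 * l)) (coneMeasure (k + 1) ρ) := by
  rw [coneMeasure_eq_map, integrable_map_measure (by fun_prop)
    (continuous_ofReal_smul_orbitPoint _).aemeasurable]
  have : ((fun w => ‖w‖ ^ (2 * l)) ∘ fun p : ℝ × RealOrthogonal (k + 2) =>
      (p.1 : ℂ) • orbitPoint (k + 1) p.2) = fun p => p.1 ^ (2 * l) := by
    funext p
    simp only [Function.comp_apply, norm_ofReal_smul_orbitPoint]
    exact (even_two_mul l).pow_abs p.1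
  rw [this]
  exact h.comp_fst _

theorem integral_norm_pow_coneMeasure (k : ℕ) {ρ : Measure ℝ} [SFinite ρ] {l : ℕ}
    (h : Integrable (fun t => t ^ (2 * l)) ρ) :
    ∫ w, ‖w‖ ^ (2 * l) ∂coneMeasure (k + 1) ρ = ∫ t, t ^ (2 * l) ∂ρ := by
  have h1 := integral_coneMeasure (F := fun w => ((‖w‖ ^ (2 * l) : ℝ) : ℂ))
    (integrable_norm_pow_coneMeasure k h).ofReal
  have e : ∀ t : ℝ, |t| ^ (2 * l) = t ^ (2 * l) := fun t => (even_two_mul l).pow_abs t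
  simp only [norm_ofReal_smul_orbitPoint, e, integral_const, probReal_univ, one_smul] at h1
  rw [integral_complex_ofReal, integral_complex_ofReal] at h1
  exact_mod_cast h1

/-! ### Series in `L^p` -/

/-- Absolute convergence in `L^p` identifies the `L^p` sum almost everywhere with the pointwise one.
-/
theorem memLp_tsum {α E : Type*} [MeasurableSpace α] {μ : Measure α} [NormedAddCommGroup E]
    [CompleteSpace E] {p : ENNReal} [Fact (1 ≤ p)] {F : ℕ → α → E} (hF : ∀ l, MemLp (F l) p μ)
    (hs : ∑' l, eLpNorm (F l) p μ ≠ ⊤) : MemLp (fun x => ∑' l, F l x) p μ := by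
  have h := Lp.hasSum_coeFn_tsum (f := fun l => (hF l).toLp (F l))
    (by simpa [Lp.enorm_toLp] using hs)
  have h2 : ∀ᵐ x ∂μ, ∀ l, (hF l).toLp (F l) x = F l x := ae_all_iff.2 fun l => (hF l).coeFn_toLp
  refine (memLp_congr_ae ?_).1 (Lp.memLp (∑' l, (hF l).toLp (F l)))
  filter_upwards [h, h2] with x hx hx2
  rw [← hx.tsum_eq]
  simp only [hx2]

/-- The inequality `√N ≤ 2^(-l) + 2^l N` trades the norm for its square at the price of a geometric
factor, which the kernel series can afford. -/
theorem eLpNorm_two_le_of_integral_sq_le {α : Type*} [MeasurableSpace α] {μ : Measure α}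
    {F : α → ℝ} (hF : MemLp F 2 μ) (l : ℕ) :
    eLpNorm F 2 μ ≤ ENNReal.ofReal ((1 / 2) ^ l + 2 ^ l * ∫ x, F x ^ 2 ∂μ) := by
  rw [hF.eLpNorm_eq_integral_rpow_norm (by simp) (by simp)]
  apply ENNReal.ofReal_le_ofReal
  have e : ∀ x, ‖F x‖ ^ (2 : ENNReal).toReal = F x ^ 2 := fun x => by simp
  simp only [e]
  have h0 : 0 ≤ ∫ x, F x ^ 2 ∂μ := integral_nonneg fun x => sq_nonneg _
  set N := ∫ x, F x ^ 2 ∂μ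
  have h2 : (2 : ENNReal).toReal⁻¹ = 1 / 2 := by simp
  rw [h2, ← Real.sqrt_eq_rpow]
  apply Real.sqrt_le_iff.2 ⟨by positivity, ?_⟩
  have h3 : (1 / 2 : ℝ) ^ l * 2 ^ l = 1 := by rw [← mul_pow]; norm_num
  nlinarith [sq_nonneg ((1 / 2 : ℝ) ^ l), sq_nonneg (2 ^ l * N)]

/-! ### The reproducing kernel as a power series -/

theorem keplerDim_le_exp (k l : ℕ) :
    keplerDim k l ≤ Real.exp (2 * (k + 1)) * Real.exp 2 ^ l := by
  have h1 : ∏ i ∈ Finset.range k, ((l : ℝ) + (i + 1)) ≤ (2 * (l + k + 1)) ^ k := by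
    have h := Finset.prod_le_prod (s := Finset.range k) (f := fun i : ℕ => (l : ℝ) + (i + 1))
      (g := fun _ : ℕ => 2 * ((l : ℝ) + k + 1)) (fun i _ => by positivity) fun i hi => by
        have : (i : ℝ) < k := by exact_mod_cast Finset.mem_range.1 hi
        have : (0 : ℝ) ≤ l := by positivity
        linarith
    simpa using h
  have h0 : 0 ≤ ∏ i ∈ Finset.range k, ((l : ℝ) + (i + 1)) :=
    Finset.prod_nonneg fun i _ => by positivity
  have h2 : keplerDim k l ≤ (2 * ((l : ℝ) + k + 1)) ^ (k + 1) / (k + 1).factorial := by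
    unfold keplerDim
    refine div_le_div_of_nonneg_right ?_ (by positivity)
    rw [pow_succ']
    refine mul_le_mul ?_ h1 h0 (by positivity)
    have : (0 : ℝ) ≤ k := by positivity
    linarith
  refine h2.trans ((Real.pow_div_factorial_le_exp _ (by positivity) _).trans ?_)
  rw [← Real.exp_nat_mul, ← Real.exp_add]
  apply le_of_eq
  congr 1
  ring

/-- The even moments of a measure on the half-line. -/
def radialMoment (ρ : Measure ℝ) (l : ℕ) : ℝ := ∫ t, t ^ (2 * l) ∂ρ

/-- The Taylor coefficients of the reproducing kernel in the variable `⟪y, x⟫`. -/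
def kernelCoeff (k : ℕ) (ρ : Measure ℝ) (l : ℕ) : ℝ := keplerDim k l / radialMoment ρ l

/-- The reproducing kernel of the weighted Bergman space, as a power series in `⟪y, x⟫`. -/
def keplerKernel (k : ℕ) (ρ : Measure ℝ) (x y : KSpace (k + 2)) : ℂ :=
  ∑' l : ℕ, (kernelCoeff k ρ l : ℂ) * inner ℂ y x ^ l

theorem differentiable_tsum_mul_pow {a : ℕ → ℝ} (ha0 : ∀ l, 0 ≤ a l)
    (ha : ∀ R : ℝ, 0 < R → Summable fun l => a l * R ^ l) :
    Differentiable ℂ fun x : ℂ => ∑' l : ℕ, (a l : ℂ) * x ^ l := fun x => by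
  have hR : 0 < ‖x‖ + 1 := by positivity
  refine (Complex.differentiableOn_tsum_of_summable_norm (U := Metric.ball 0 (‖x‖ + 1)) (ha _ hR)
    (fun l => ?_) Metric.isOpen_ball fun l w hw => ?_).differentiableAt
    (Metric.isOpen_ball.mem_nhds (by simp))
  · fun_prop
  · rw [norm_mul, norm_pow, Complex.norm_real, Real.norm_of_nonneg (ha0 l)]
    have : ‖w‖ ≤ ‖x‖ + 1 := by simpa using (mem_ball_zero_iff.1 hw).le
    have := ha0 l
    gcongr

/-! ### Radial weights and the reproducing property. -/

/-- Radial measures of unbounded support on `(0, ∞)` whose moments exist and grow so fast that the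
kernel series converges everywhere. -/
structure RadialWeight (k : ℕ) (ρ : Measure ℝ) : Prop where
  pos : ∀ᵐ t ∂ρ, 0 < t
  support : ∀ R : ℝ, ∃ t ∈ ρ.support, R < t
  integrable : ∀ l : ℕ, Integrable (fun t => t ^ (2 * l)) ρ
  moment_pos : ∀ l : ℕ, 0 < radialMoment ρ l
  summable : ∀ R : ℝ, 0 < R → Summable fun l => kernelCoeff k ρ l * R ^ l

theorem RadialWeight.coeff_pos {k : ℕ} {ρ : Measure ℝ} (h : RadialWeight k ρ)
    (l : ℕ) : 0 < kernelCoeff k ρ l := div_pos (keplerDim_pos k l) (h.moment_pos l)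

theorem RadialWeight.bergmanDomain_eq {k : ℕ} {ρ : Measure ℝ} (h : RadialWeight k ρ)
    (n : ℕ) :
    bergmanDomain n ρ = keplerManifold n :=
  Set.ext fun z => ⟨fun hz => hz.1, fun hz => ⟨hz, h.support ‖z‖⟩⟩

theorem RadialWeight.summable_norm {k : ℕ} {ρ : Measure ℝ} (h : RadialWeight k ρ)
    (x : ℂ) : Summable fun l => ‖(kernelCoeff k ρ l : ℂ) * x ^ l‖ := by
  refine Summable.of_nonneg_of_le (fun _ => norm_nonneg _) (fun l => ?_)
    (h.summable (‖x‖ + 1) (by positivity))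
  rw [norm_mul, norm_pow, Complex.norm_real, Real.norm_of_nonneg (h.coeff_pos l).le]
  have := h.coeff_pos l
  gcongr
  linarith

theorem RadialWeight.restrict_eq {k : ℕ} {ρ : Measure ℝ} [SFinite ρ]
    (h : RadialWeight k ρ)
    : (coneMeasure (k + 2) ρ).restrict (bergmanDomain (k + 2) ρ) =
    coneMeasure (k + 2) ρ := by
  rw [h.bergmanDomain_eq]
  exact Measure.restrict_eq_self_of_ae_mem (ae_coneMeasure_mem (k + 1) h.pos)

theorem RadialWeight.memLp_norm_pow {k : ℕ} {ρ : Measure ℝ} [SFinite ρ]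
    (h : RadialWeight k ρ)
    (l : ℕ) : MemLp (fun w => ‖w‖ ^ l) 2 (coneMeasure (k + 2) ρ) := by
  rw [memLp_two_iff_integrable_sq (by fun_prop)]
  have e : (fun w : KSpace (k + 2) => (‖w‖ ^ l) ^ 2) = fun w => ‖w‖ ^ (2 * l) := by
    funext w; rw [← pow_mul, mul_comm]
  rw [e]
  exact integrable_norm_pow_coneMeasure (k + 1) (h.integrable l)

/-- In the squared norm of the term of degree `l` the moment cancels one coefficient, leaving
`keplerDim k l * kernelCoeff k ρ l * R^(2l)`, which is summable even with extra geometric factors.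
This majorant serves both for membership in the Bergman space and for dominated convergence. -/
theorem RadialWeight.memLp_majorant {k : ℕ} {ρ : Measure ℝ} [SFinite ρ]
    (h : RadialWeight k ρ)
    (R : ℝ) (hR : 0 < R) :
    MemLp (fun w => ∑' l : ℕ, kernelCoeff k ρ l * (‖w‖ * R) ^ l) 2 (coneMeasure (k + 2) ρ) := by
  have hF : ∀ l, MemLp (fun w : KSpace (k + 2) => kernelCoeff k ρ l * (‖w‖ * R) ^ l) 2
      (coneMeasure (k + 2) ρ) := fun l => by
    have e : (fun w : KSpace (k + 2) => kernelCoeff k ρ l * (‖w‖ * R) ^ l) =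
        fun w => (kernelCoeff k ρ l * R ^ l) * ‖w‖ ^ l := by
      funext w; rw [mul_pow]; ring
    rw [e]
    exact (h.memLp_norm_pow l).const_mul _
  have hN : ∀ l, ∫ w : KSpace (k + 2), (kernelCoeff k ρ l * (‖w‖ * R) ^ l) ^ 2
      ∂coneMeasure (k + 2) ρ = keplerDim k l * (kernelCoeff k ρ l * (R ^ 2) ^ l) := fun l => by
    have e : (fun w : KSpace (k + 2) => (kernelCoeff k ρ l * (‖w‖ * R) ^ l) ^ 2) =
        fun w => (kernelCoeff k ρ l * R ^ l) ^ 2 * ‖w‖ ^ (2 * l) := by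
      funext w; rw [mul_pow, mul_pow, mul_pow, pow_mul' ‖w‖]; ring
    have h3 : ∫ t, t ^ (2 * l) ∂ρ = radialMoment ρ l := rfl
    rw [e, integral_const_mul, integral_norm_pow_coneMeasure (k + 1) (h.integrable l), h3]
    have := (h.moment_pos l).ne'
    unfold kernelCoeff
    field_simp
    ring
  refine memLp_tsum hF ?_
  have hs : Summable fun l : ℕ => (1 / 2 : ℝ) ^ l +
      2 ^ l * (keplerDim k l * (kernelCoeff k ρ l * (R ^ 2) ^ l)) := by
    refine summable_geometric_two.add ?_
    refine Summable.of_nonneg_of_le (fun l => ?_) (fun l => ?_)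
      ((h.summable (2 * Real.exp 2 * R ^ 2) (by positivity)).mul_left (Real.exp (2 * (k + 1))))
    · have := keplerDim_pos k l
      have := h.coeff_pos l
      positivity
    · have := keplerDim_pos k l
      have := h.coeff_pos l
      calc _ ≤ 2 ^ l * ((Real.exp (2 * (k + 1)) * Real.exp 2 ^ l) *
            (kernelCoeff k ρ l * (R ^ 2) ^ l)) := by
            gcongr
            exact keplerDim_le_exp k l
        _ = _ := by rw [mul_pow, mul_pow]; ring
  refine ne_top_of_le_ne_top hs.tsum_ofReal_ne_top (ENNReal.tsum_le_tsum fun l => ?_)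
  rw [← hN l]
  exact eLpNorm_two_le_of_integral_sq_le (hF l) l

theorem RadialWeight.norm_term_le {k : ℕ} {ρ : Measure ℝ} (h : RadialWeight k ρ)
    (l : ℕ) (z w : KSpace (k + 2)) :
    ‖(kernelCoeff k ρ l : ℂ) * inner ℂ w z ^ l‖ ≤ kernelCoeff k ρ l * (‖w‖ * ‖z‖) ^ l := by
  rw [norm_mul, norm_pow, Complex.norm_real, Real.norm_of_nonneg (h.coeff_pos l).le]
  have := h.coeff_pos l
  have := norm_inner_le_norm (𝕜 := ℂ) w z
  gcongr

theorem RadialWeight.summable_majorant {k : ℕ} {ρ : Measure ℝ} (h : RadialWeight k ρ)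
    {z : KSpace (k + 2)} (hz : z ≠ 0) (w : KSpace (k + 2)) :
    Summable fun l : ℕ => kernelCoeff k ρ l * (‖w‖ * ‖z‖) ^ l := by
  refine Summable.of_nonneg_of_le (fun l => ?_) (fun l => ?_)
    (h.summable ((‖w‖ + 1) * ‖z‖) (by have := norm_pos_iff.2 hz; positivity))
  · have := h.coeff_pos l
    positivity
  · have := h.coeff_pos l
    gcongr
    linarith

theorem RadialWeight.keplerKernel_mem {k : ℕ} {ρ : Measure ℝ} [SFinite ρ]
    (h : RadialWeight k ρ)
    {y : KSpace (k + 2)} (hy : y ∈ keplerManifold (k + 2)) :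
    (fun x => keplerKernel k ρ x y) ∈ bergmanSpace (k + 2) ρ := by
  have hd : Differentiable ℂ fun x => keplerKernel k ρ x y :=
    (differentiable_tsum_mul_pow (fun l => (h.coeff_pos l).le) h.summable).comp
      (innerSL ℂ y).differentiable
  refine ⟨fun z _ => ⟨univ, isOpen_univ, mem_univ _, _, hd.differentiableOn, fun _ _ => rfl⟩, ?_⟩
  rw [h.restrict_eq]
  refine (h.memLp_majorant ‖y‖ (norm_pos_iff.2 hy.2)).mono' hd.continuous.aestronglyMeasurable
    (Eventually.of_forall fun x => ?_)
  refine tsum_of_norm_bounded (h.summable_majorant hy.2 x).hasSum fun l => ?_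
  rw [mul_comm ‖x‖]
  exact h.norm_term_le l x y

theorem RadialWeight.hasSum_keplerKernel {k : ℕ} {ρ : Measure ℝ} (h : RadialWeight k ρ)
    (x y : KSpace (k + 2)) :
    HasSum (fun l : ℕ => (kernelCoeff k ρ l : ℂ) * inner ℂ y x ^ l) (keplerKernel k ρ x y) :=
  (h.summable_norm _).of_norm.hasSum

theorem RadialWeight.keplerKernel_conj {k : ℕ} {ρ : Measure ℝ} (h : RadialWeight k ρ)
    (x y : KSpace (k + 2)) :
    keplerKernel k ρ y x = starRingEnd ℂ (keplerKernel k ρ x y) := by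
  have h1 := (Complex.hasSum_conj').2 (h.hasSum_keplerKernel x y)
  simp only [map_mul, map_pow, Complex.conj_ofReal, inner_conj_symm] at h1
  exact (h.hasSum_keplerKernel y x).unique h1

/-- Integrate term by term in polar coordinates: the sphere contributes `A l / keplerDim k l`, the
radius contributes the moment, and the coefficient cancels both. The sum of the `A l` is `f z`. -/
theorem RadialWeight.integral_mul_keplerKernel {k : ℕ} {ρ : Measure ℝ} [SFinite ρ]
    (h : RadialWeight k ρ)
    {f : KSpace (k + 2) → ℂ} (hf : f ∈ bergmanSpace (k + 2) ρ)
    {z : KSpace (k + 2)} (hz : z ∈ keplerManifold (k + 2)) :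
    f z = ∫ w, f w * keplerKernel k ρ z w ∂coneMeasure (k + 2) ρ := by
  obtain ⟨hf1, hf2⟩ := hf
  rw [h.restrict_eq] at hf2
  rw [h.bergmanDomain_eq] at hf1
  obtain ⟨A, hA, hA2⟩ := exists_homogeneous_components hf1 hz
  set F : ℕ → KSpace (k + 2) → ℂ := fun l w =>
    f w * ((kernelCoeff k ρ l : ℂ) * inner ℂ w z ^ l) with hF
  have hFm : ∀ l, AEStronglyMeasurable (F l) (coneMeasure (k + 2) ρ) := fun l =>
    hf2.aestronglyMeasurable.mul (Continuous.aestronglyMeasurable (by fun_prop))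
  -- The common majorant is a product of two square-integrable functions.
  have hb : Integrable (fun w => ∑' l : ℕ, ‖f w‖ * (kernelCoeff k ρ l * (‖w‖ * ‖z‖) ^ l))
      (coneMeasure (k + 2) ρ) := by
    simp only [tsum_mul_left]
    exact hf2.norm.integrable_mul (h.memLp_majorant ‖z‖ (norm_pos_iff.2 hz.2))
  have hFb : ∀ l w, ‖F l w‖ ≤ ‖f w‖ * (kernelCoeff k ρ l * (‖w‖ * ‖z‖) ^ l) := fun l w => by
    rw [hF, norm_mul]
    exact mul_le_mul_of_nonneg_left (h.norm_term_le l z w) (norm_nonneg _)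
  have hFi : ∀ l, Integrable (F l) (coneMeasure (k + 2) ρ) := fun l => by
    refine hb.mono' (hFm l) (Eventually.of_forall fun w => (hFb l w).trans ?_)
    exact ((h.summable_majorant hz.2 w).mul_left _).le_tsum l fun j _ => by
      have := h.coeff_pos j
      positivity
  have hsum := hasSum_integral_of_dominated_convergence
    (f := fun w => f w * keplerKernel k ρ z w)
    (fun l w => ‖f w‖ * (kernelCoeff k ρ l * (‖w‖ * ‖z‖) ^ l)) hFm
    (fun l => Eventually.of_forall fun w => hFb l w)
    (Eventually.of_forall fun w => (h.summable_majorant hz.2 w).mul_left _) hb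
    (Eventually.of_forall fun w => (h.hasSum_keplerKernel z w).mul_left _)
  have hFA : ∀ l, ∫ w, F l w ∂coneMeasure (k + 2) ρ = A l := fun l => by
    rw [integral_coneMeasure (hFi l)]
    have e : ∀ᵐ t : ℝ ∂ρ, ∫ g, F l ((t : ℂ) • orbitPoint (k + 2) g) ∂orthHaar (k + 3) =
        ((t ^ (2 * l) : ℝ) : ℂ) * ((kernelCoeff k ρ l * (keplerDim k l)⁻¹ : ℝ) * A l) := by
      filter_upwards [h.pos] with t ht
      have e2 : ∀ g, F l ((t : ℂ) • orbitPoint (k + 2) g) = (kernelCoeff k ρ l * (t : ℂ) ^ l) *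
          (f ((t : ℂ) • orbitPoint (k + 2) g) * inner ℂ (orbitPoint (k + 2) g) z ^ l) :=
        fun g => by
          rw [hF]
          simp only
          rw [inner_smul_left, Complex.conj_ofReal, mul_pow]
          ring
      simp only [e2]
      rw [integral_const_mul, hA2 _ (by exact_mod_cast ht.ne')]
      push_cast
      rw [two_mul, pow_add]
      ring
    have h3 : ∫ t, t ^ (2 * l) ∂ρ = radialMoment ρ l := rfl
    rw [integral_congr_ae e, integral_mul_const, integral_complex_ofReal, h3, ← mul_assoc,
      ← Complex.ofReal_mul]
    have h4 : radialMoment ρ l * (kernelCoeff k ρ l * (keplerDim k l)⁻¹) = 1 := by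
      have := (h.moment_pos l).ne'
      have := (keplerDim_pos k l).ne'
      unfold kernelCoeff
      field_simp
    rw [h4]
    simp
  simp only [hFA] at hsum
  exact hA.unique hsum

theorem RadialWeight.isBergmanKernel_keplerKernel {k : ℕ} {ρ : Measure ℝ} [SFinite ρ]
    (h : RadialWeight k ρ)
    : IsBergmanKernel (k + 2) ρ (keplerKernel k ρ) := by
  refine ⟨fun y hy => h.keplerKernel_mem hy.1, fun x _ y _ => h.keplerKernel_conj x y,
    fun f hf z hz => ?_⟩
  rw [h.restrict_eq]
  exact h.integral_mul_keplerKernel hf hz.1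


/-- The reproducing kernel is unique. -/
theorem IsBergmanKernel.eq {n : ℕ} {ρ : Measure ℝ} {K L : KSpace n → KSpace n → ℂ}
    (hK : IsBergmanKernel n ρ K) (hL : IsBergmanKernel n ρ L) {x y : KSpace n}
    (hx : x ∈ bergmanDomain n ρ) (hy : y ∈ bergmanDomain n ρ)
    (hm : MeasurableSet (bergmanDomain n ρ)) :
    K x y = L x y := by
  -- Each kernel reproduces the other's sections; Hermitian symmetry then matches the two integrals.
  have h1 := hK.2.2 _ (hL.1 y hy) x hx
  have h2 := hL.2.2 _ (hK.1 x hx) y hy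
  rw [hK.2.1 y hy x hx, h2, h1, ← integral_conj]
  refine setIntegral_congr_fun hm fun w hw => ?_
  rw [map_mul, hK.2.1 w hw x hx, hL.2.1 y hy w hw, mul_comm]

/-! ### The weights `2cm exp(-s t^(2m)) t^(2mn-1)` -/

theorem ae_radialMeasure_pos (n : ℕ) (m c s : ℝ) : ∀ᵐ t ∂radialMeasure n m c s, 0 < t :=
  (withDensity_absolutelyContinuous _ _).ae_le (ae_restrict_mem measurableSet_Ioi)

theorem measurable_radialDensity (n : ℕ) (m c s : ℝ) : Measurable fun t : ℝ =>
    ENNReal.ofReal (2 * c * m * Real.exp (-s * t ^ (2 * m)) * t ^ (2 * m * n - 1)) := by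
  fun_prop

theorem mem_support_radialMeasure {n : ℕ} {m c s : ℝ} (hm : 0 < m) (hc : 0 < c) {t : ℝ}
    (ht : 0 < t) : t ∈ (radialMeasure n m c s).support := by
  rw [Measure.mem_support_iff_forall]
  intro U hU
  by_contra h0
  have h1 : radialMeasure n m c s U = 0 := by simpa using h0
  have hac : volume.restrict (Ioi (0 : ℝ)) ≪ radialMeasure n m c s := by
    refine withDensity_absolutelyContinuous' (measurable_radialDensity n m c s).aemeasurable ?_
    filter_upwards [ae_restrict_mem measurableSet_Ioi] with x hx
    have hx : 0 < x := hx
    exact (ENNReal.ofReal_pos.2 (by positivity)).ne'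
  have h2 : volume (U ∩ Ioi (0 : ℝ)) = 0 := by
    rw [← Measure.restrict_apply' measurableSet_Ioi]
    exact hac h1
  exact (Measure.measure_pos_of_mem_nhds volume (inter_mem hU (Ioi_mem_nhds ht))).ne' h2

theorem radialDensity_mul_pow {n : ℕ} {m c s : ℝ} (l : ℕ) {t : ℝ} (ht : 0 < t) (hm : 0 < m)
    (hc : 0 < c) :
    (ENNReal.ofReal (2 * c * m * Real.exp (-s * t ^ (2 * m)) * t ^ (2 * m * n - 1))).toReal •
      t ^ (2 * l) =
    2 * c * m * (t ^ (2 * (l : ℝ) + 2 * m * n - 1) * Real.exp (-s * t ^ (2 * m))) := by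
  rw [ENNReal.toReal_ofReal (by positivity), smul_eq_mul, ← Real.rpow_natCast,
    show 2 * (l : ℝ) + 2 * m * n - 1 = (2 * m * n - 1) + ((2 * l : ℕ) : ℝ) by push_cast; ring,
    Real.rpow_add ht]
  ring

theorem radial_exponent {n : ℕ} (hn : 0 < n) {m : ℝ} (hm : 0 < m) (l : ℕ) :
    -1 < 2 * (l : ℝ) + 2 * m * n - 1 := by
  have : (0 : ℝ) < n := by exact_mod_cast hn
  have : 0 < 2 * m * n := by positivity
  have : (0 : ℝ) ≤ l := by positivity
  linarith

theorem integrable_pow_radialMeasure {n : ℕ} (hn : 0 < n) {m c s : ℝ} (hm : 0 < m) (hc : 0 < c)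
    (hs : 0 < s) (l : ℕ) : Integrable (fun t => t ^ (2 * l)) (radialMeasure n m c s) := by
  rw [radialMeasure, integrable_withDensity_iff_integrable_smul' (measurable_radialDensity n m c s)
    (by simp)]
  refine IntegrableOn.congr_fun ((integrableOn_rpow_mul_exp_neg_mul_rpow
    (radial_exponent hn hm l) (by positivity : 0 < 2 * m) hs).const_mul (2 * c * m))
    (fun t ht => ?_) measurableSet_Ioi
  exact (radialDensity_mul_pow l ht hm hc).symm

theorem radialMoment_radialMeasure {n : ℕ} (hn : 0 < n) {m c s : ℝ} (hm : 0 < m) (hc : 0 < c)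
    (hs : 0 < s) (l : ℕ) : radialMoment (radialMeasure n m c s) l =
      c * Real.Gamma (l / m + n) / s ^ ((l : ℝ) / m + n) := by
  rw [radialMoment, radialMeasure, integral_withDensity_eq_integral_toReal_smul
    (measurable_radialDensity n m c s) (by simp),
    setIntegral_congr_fun measurableSet_Ioi fun t ht => radialDensity_mul_pow l ht hm hc,
    integral_const_mul, integral_rpow_mul_exp_neg_mul_rpow (by positivity : 0 < 2 * m)
    (radial_exponent hn hm l) hs]
  have e : (2 * (l : ℝ) + 2 * m * n - 1 + 1) / (2 * m) = l / m + n := by field_simp; ring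
  rw [e, neg_div, e, Real.rpow_neg hs.le]
  field_simp

/-- With `R = ‖z‖²` the variable `s R^m` is `s‖z‖^(2m)`, so the diagonal series depends on `s` and
`z` only through it, up to the prefactor. -/
theorem kernelCoeff_mul_pow (k : ℕ) {m c s R : ℝ} (hm : 0 < m) (hc : 0 < c) (hs : 0 < s)
    (hR : 0 < R) (l : ℕ) : kernelCoeff k (radialMeasure (k + 2) m c s) l * R ^ l =
      s ^ (k + 2) / c * ((s * R ^ m) ^ ((l : ℝ) / m) *
        (keplerDim k l / Real.Gamma (l / m + (k + 2)))) := by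
  have e : ((k + 2 : ℕ) : ℝ) = (k : ℝ) + 2 := by push_cast; ring
  have hR' : (R ^ m) ^ ((l : ℝ) / m) = R ^ l := by
    rw [← Real.rpow_mul hR.le, mul_div_cancel₀ _ hm.ne', Real.rpow_natCast]
  rw [kernelCoeff, radialMoment_radialMeasure (by omega) hm hc hs, Real.rpow_add hs,
    Real.rpow_natCast, Real.mul_rpow hs.le (by positivity), hR', e]
  field_simp

theorem radialWeight_radialMeasure (k : ℕ) {m c s : ℝ} (hm : 0 < m) (hc : 0 < c) (hs : 0 < s) :
    RadialWeight k (radialMeasure (k + 2) m c s) where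
  pos := ae_radialMeasure_pos _ _ _ _
  support R := ⟨|R| + 1, mem_support_radialMeasure hm hc (by positivity),
    by linarith [le_abs_self R]⟩
  integrable := integrable_pow_radialMeasure (by omega) hm hc hs
  moment_pos l := by
    rw [radialMoment_radialMeasure (by omega) hm hc hs]
    have := Real.Gamma_pos_of_pos (s := (l : ℝ) / m + (k + 2 : ℕ)) (by positivity)
    positivity
  summable R hR := by
    obtain ⟨b, hb, -⟩ := exists_keplerDim_expansion k hm
    simp only [kernelCoeff_mul_pow k hm hc hs hR]
    exact (hasSum_keplerDim_series hm (by positivity) hb).summable.mul_left _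

instance sFinite_radialMeasure (n : ℕ) (m c s : ℝ) : SFinite (radialMeasure n m c s) := by
  unfold radialMeasure; infer_instance

theorem isBergmanKernel_bergmanKernel (k : ℕ) {m c s : ℝ} (hm : 0 < m) (hc : 0 < c)
    (hs : 0 < s) : IsBergmanKernel (k + 2) (radialMeasure (k + 2) m c s)
      (bergmanKernel (k + 2) (radialMeasure (k + 2) m c s)) := by
  have h : ∃ K, IsBergmanKernel (k + 2) (radialMeasure (k + 2) m c s) K :=
    ⟨_, (radialWeight_radialMeasure k hm hc hs).isBergmanKernel_keplerKernel⟩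
  rw [bergmanKernel, dif_pos h]
  exact h.choose_spec

theorem bergmanKernel_self (k : ℕ) {m c s : ℝ} (hm : 0 < m) (hc : 0 < c) (hs : 0 < s)
    {z : KSpace (k + 2)} (hz : z ∈ keplerManifold (k + 2)) :
    bergmanKernel (k + 2) (radialMeasure (k + 2) m c s) z z =
      ((s ^ (k + 2) / c * ∑' l : ℕ, (s * ‖z‖ ^ (2 * m)) ^ ((l : ℝ) / m) *
        (keplerDim k l / Real.Gamma (l / m + (k + 2))) : ℝ) : ℂ) := by
  have h := radialWeight_radialMeasure k hm hc hs
  have hz' : z ∈ bergmanDomain (k + 2) (radialMeasure (k + 2) m c s) := by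
    rwa [h.bergmanDomain_eq]
  rw [(isBergmanKernel_bergmanKernel k hm hc hs).eq h.isBergmanKernel_keplerKernel hz' hz'
    (by rw [h.bergmanDomain_eq]; exact measurableSet_keplerManifold _), keplerKernel,
    ← tsum_mul_left, Complex.ofReal_tsum]
  have hz0 := norm_pos_iff.2 hz.2
  congr 1 with l
  have e : (‖z‖ ^ 2) ^ m = ‖z‖ ^ (2 * m) := by
    rw [← Real.rpow_natCast, ← Real.rpow_mul hz0.le]; norm_num
  rw [← e, ← kernelCoeff_mul_pow k hm hc hs (by positivity), inner_self_eq_norm_sq_to_K]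
  push_cast
  rfl

/-! ### The expansion with its exponentially small remainder. -/

theorem ExpSmallRemainder.congr {n : ℕ} {m : ℝ} {R R' : ℝ → KSpace n → ℂ}
    (h : ExpSmallRemainder n m R)
    (hR : ∀ s : ℝ, 0 < s → ∀ z ∈ keplerManifold n, R' s z = R s z) : ExpSmallRemainder n m R' := by
  obtain ⟨δ, hδ, h⟩ := h
  refine ⟨δ, hδ, fun r hr => ?_⟩
  obtain ⟨C, s₀, h⟩ := h r hr
  refine ⟨C, max s₀ 1, fun s hs z hz hrz => ?_⟩
  rw [hR s (by linarith [le_max_right s₀ 1]) z hz]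
  exact h s ((le_max_left _ _).trans hs) z hz hrz

/-- The exponentially small remainder in the expansion of the distortion function. -/
theorem expSmallRemainder_distortion {k : ℕ} {m : ℝ} (hm : 0 < m) {b : ℕ → ℝ}
    (hb : ∀ l : ℕ, keplerDim k l = 2 * m ^ (k + 1) / (k + 1).factorial *
        ∑ j ∈ Finset.range (k + 2), b j * ∏ i ∈ Finset.Ico (j + 1) (k + 2), (l / m + i))
    {c : ℝ} (hc : 0 < c) :
    ExpSmallRemainder (k + 2) m (fun s z => distortion (k + 2) m c s z -
      ((2 * m ^ (k + 2) / (((k + 1).factorial : ℝ) * c) * s ^ (k + 2) *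
        ∑ j ∈ Finset.range (k + 2), b j / (s ^ j * ‖z‖ ^ (2 * m * (j : ℝ))) : ℝ) : ℂ)) := by
  obtain ⟨a, C, ha0, ha1, hC, h⟩ := keplerDim_series_asymptotics hm hb
  -- Half of the gap `1 - a` absorbs the prefactor `s^n`; the other half remains as the decay rate
  -- and does not involve `r`.
  set δ := (1 - a) / 2 with hδ
  have hδ0 : 0 < δ := by rw [hδ]; linarith
  obtain ⟨C', hC', h'⟩ := exists_rpow_le_exp (p := (k + 2 : ℕ)) hδ0
  refine ⟨δ, hδ0, fun r hr => ?_⟩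
  set q := r ^ (2 * m) with hq
  have hq0 : 0 < q := by positivity
  -- The threshold `s ≥ 1/q` forces `T ≥ 1`, the range where the series asymptotics hold.
  refine ⟨C * C' / (c * q ^ (k + 2)), q⁻¹, fun s hs z hz hrz => ?_⟩
  have hs0 : 0 < s := (inv_pos.2 hq0).trans_le hs
  have hz0 : 0 < ‖z‖ := norm_pos_iff.2 hz.2
  set T := s * ‖z‖ ^ (2 * m) with hT
  have hqz : q ≤ ‖z‖ ^ (2 * m) := Real.rpow_le_rpow hr.le hrz (by positivity)
  have hsq : s * q ≤ T := mul_le_mul_of_nonneg_left hqz hs0.le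
  have hT1 : 1 ≤ T := by
    refine le_trans ?_ hsq
    calc 1 = q⁻¹ * q := (inv_mul_cancel₀ hq0.ne').symm
      _ ≤ s * q := by gcongr
  have hTj : ∀ j : ℕ, s ^ j * ‖z‖ ^ (2 * m * (j : ℝ)) = T ^ j := fun j => by
    rw [hT, mul_pow, Real.rpow_mul hz0.le, Real.rpow_natCast]
  have hsn : s ^ (k + 2) ≤ C' / q ^ (k + 2) * Real.exp (δ * T) := by
    rw [div_mul_eq_mul_div, le_div_iff₀ (by positivity), ← mul_pow]
    refine (pow_le_pow_left₀ (by positivity) hsq _).trans ?_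
    have := h' T hT1
    rwa [Real.rpow_natCast] at this
  simp only [distortion, bergmanKernel_self k hm hc hs0 hz, hTj, ← hT, neg_mul]
  set S := ∑' l : ℕ, T ^ ((l : ℝ) / m) * (keplerDim k l / Real.Gamma (l / m + (k + 2))) with hS
  have e : Real.exp (-T) * (s ^ (k + 2) / c * S) - 2 * m ^ (k + 2) / (((k + 1).factorial : ℝ) * c) *
      s ^ (k + 2) * ∑ j ∈ Finset.range (k + 2), b j / T ^ j = Real.exp (-T) * (s ^ (k + 2) / c) *
        (S - 2 * m ^ (k + 2) / (k + 1).factorial * Real.exp T *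
          ∑ j ∈ Finset.range (k + 2), b j / T ^ j) := by
    have : Real.exp (-T) * Real.exp T = 1 := by rw [← Real.exp_add]; simp
    linear_combination (2 * m ^ (k + 2) / (((k + 1).factorial : ℝ) * c) *
      s ^ (k + 2) * ∑ j ∈ Finset.range (k + 2), b j / T ^ j) * this
  rw [← Complex.ofReal_mul, ← Complex.ofReal_sub, e, Complex.norm_real, Real.norm_eq_abs, abs_mul,
    abs_of_nonneg (by positivity : 0 ≤ Real.exp (-T) * (s ^ (k + 2) / c))]
  calc _ ≤ Real.exp (-T) * (C' / q ^ (k + 2) * Real.exp (δ * T) / c) * (C * Real.exp (a * T)) := by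
        gcongr
        exact h T hT1
    _ = C * C' / (c * q ^ (k + 2)) * (Real.exp (-T) * Real.exp (δ * T) * Real.exp (a * T)) := by
        field_simp
    _ = C * C' / (c * q ^ (k + 2)) * Real.exp (-(δ * s * ‖z‖ ^ (2 * m))) := by
        rw [← Real.exp_add, ← Real.exp_add]
        congr 2
        rw [mul_assoc δ, ← hT, hδ]
        ring
    _ = _ := by ring_nf

/-- The hypotheses sit inside the existential so that `choose` yields coefficients as a function of
`n` and `m` alone, before `c` is given. -/
theorem exists_expansion_coefficients (n : ℕ) (m : ℝ) : ∃ b : ℕ → ℝ, 2 ≤ n → 0 < m →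
    b 0 = 1 ∧ b 1 = (1 - (n : ℝ)) * (m * n - n + 1) / (2 * m) ∧
    (m = 1 / 2 → b (n - 1) = 0) ∧
    ∀ c : ℝ, 0 < c → ExpSmallRemainder n m (fun s z => distortion n m c s z -
      ((2 * m ^ n / ((Nat.factorial (n - 1) : ℝ) * c) * s ^ n *
        ∑ j ∈ Finset.range n, b j / (s ^ j * ‖z‖ ^ (2 * m * (j : ℝ))) : ℝ) : ℂ)) := by
  by_cases hn : 2 ≤ n
  · by_cases hm : 0 < m
    · obtain ⟨k, rfl⟩ := Nat.exists_eq_add_of_le' hn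
      obtain ⟨b, hb, hb0, hb1, hbl⟩ := exists_keplerDim_expansion k hm
      refine ⟨b, fun _ _ => ⟨hb0, ?_, hbl, fun c hc => expSmallRemainder_distortion hm hb hc⟩⟩
      rw [hb1]
      push_cast
      field_simp
      ring
    · exact ⟨0, fun _ h => absurd h hm⟩
  · exact ⟨0, fun h => absurd h hn⟩

/-- The expansion for `m = 1/2`, with its leading constant normalized and its last term dropped. -/
theorem half_expansion_eq {n : ℕ} (hn : 2 ≤ n) {b : ℕ → ℝ} (hb0 : b 0 = 1)
    (hb1 : b 1 = (1 - (n : ℝ)) * (1 / 2 * n - n + 1) / (2 * (1 / 2))) (hbl : b (n - 1) = 0)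
    {s x : ℝ} (hs : 0 < s) (hx : 0 < x) :
    2 * (1 / 2 : ℝ) ^ n / ((Nat.factorial (n - 1) : ℝ) *
        ((2 : ℝ) ^ (1 - (n : ℤ)) / (Nat.factorial (n - 1) : ℝ))) * s ^ n *
        ∑ j ∈ Finset.range n, b j / (s ^ j * x ^ (2 * (1 / 2 : ℝ) * (j : ℝ))) =
      s ^ n + ((n : ℝ) - 2) * ((n : ℝ) - 1) / (2 * x) * s ^ (n - 1) +
        ∑ k ∈ Finset.Icc 2 (n - 2), b k / x ^ k * s ^ (n - k) := by
  obtain ⟨k, rfl⟩ := Nat.exists_eq_add_of_le' hn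
  -- The value of `c` is chosen precisely to make the leading constant `1`.
  have hpre : 2 * (1 / 2 : ℝ) ^ (k + 2) / ((Nat.factorial (k + 2 - 1) : ℝ) *
        ((2 : ℝ) ^ (1 - ((k + 2 : ℕ) : ℤ)) / (Nat.factorial (k + 2 - 1) : ℝ))) = 1 := by
    have h1 : (1 - ((k + 2 : ℕ) : ℤ)) = -((k + 1 : ℕ) : ℤ) := by push_cast; ring
    have h2 : ((k + 2 - 1).factorial : ℝ) ≠ 0 := by positivity
    rw [h1, zpow_neg, zpow_natCast, mul_div_cancel₀ _ h2, pow_succ]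
    have : (2 : ℝ) ^ (k + 1) ≠ 0 := by positivity
    field_simp
    rw [← mul_pow]
    norm_num
  have hterm : ∀ j ∈ Finset.range (k + 2), s ^ (k + 2) *
      (b j / (s ^ j * x ^ (2 * (1 / 2 : ℝ) * (j : ℝ)))) = b j / x ^ j * s ^ (k + 2 - j) := by
    intro j hj
    have hj : j ≤ k + 2 := (Finset.mem_range.1 hj).le
    have e : 2 * (1 / 2 : ℝ) * j = j := by ring
    rw [e, Real.rpow_natCast, ← Nat.sub_add_cancel hj, pow_add, Nat.sub_add_cancel hj]
    field_simp
  rw [hpre, one_mul, Finset.mul_sum, Finset.sum_congr rfl hterm]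
  have h01 : b 0 / x ^ 0 * s ^ (k + 2 - 0) + b 1 / x ^ 1 * s ^ (k + 2 - 1) = s ^ (k + 2) +
      (((k + 2 : ℕ) : ℝ) - 2) * (((k + 2 : ℕ) : ℝ) - 1) / (2 * x) * s ^ (k + 2 - 1) := by
    rw [hb0, hb1]
    push_cast
    field_simp
    ring
  rw [← h01]
  -- For `n = 2` the sum on the right is empty and `h01` already accounts for both terms; otherwise
  -- the term `j = n - 1` drops out because `b (n - 1) = 0`.
  rcases k with _ | k
  · have hb1' : b 1 = 0 := hbl
    simp [Finset.sum_range_succ]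
  · have hI : Finset.Icc 2 (k + 1 + 2 - 2) = Finset.Ico 2 (k + 2) := by
      ext i; simp only [Finset.mem_Icc, Finset.mem_Ico]; omega
    have hbl' : b (k + 2) = 0 := hbl
    rw [hI, Finset.sum_range_succ, hbl', Finset.sum_Ico_eq_sub _ (by omega : 2 ≤ k + 2)]
    simp [Finset.sum_range_succ]

end

theorem mainTheorem2 :
    ∃ b : ℕ → ℝ → ℕ → ℝ,
      (∀ (n : ℕ) (m : ℝ), 2 ≤ n → 0 < m →
        b n m 0 = 1 ∧
        b n m 1 = (1 - (n : ℝ)) * (m * n - n + 1) / (2 * m) ∧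
        ∀ c : ℝ, 0 < c →
          (∀ s : ℝ, 0 < s →
            IsBergmanKernel n (radialMeasure n m c s)
              (bergmanKernel n (radialMeasure n m c s))) ∧
          ExpSmallRemainder n m (fun s z =>
            distortion n m c s z -
              ((2 * m ^ n / ((Nat.factorial (n - 1) : ℝ) * c) * s ^ n *
                ∑ j ∈ Finset.range n, b n m j / (s ^ j * ‖z‖ ^ (2 * m * (j : ℝ))) : ℝ) : ℂ))) ∧
      (∀ n : ℕ, 2 ≤ n →
        b n (1 / 2) (n - 1) = 0 ∧
        ExpSmallRemainder n (1 / 2) (fun s z =>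
          distortion n (1 / 2) ((2 : ℝ) ^ (1 - (n : ℤ)) / (Nat.factorial (n - 1) : ℝ)) s z -
            ((s ^ n + ((n : ℝ) - 2) * ((n : ℝ) - 1) / (2 * ‖z‖) * s ^ (n - 1) +
              ∑ k ∈ Finset.Icc 2 (n - 2), b n (1 / 2) k / ‖z‖ ^ k * s ^ (n - k) : ℝ) : ℂ))) := by
  choose b hb using exists_expansion_coefficients
  refine ⟨b, fun n m hn hm => ?_, fun n hn => ?_⟩
  · obtain ⟨h0, h1, -, h3⟩ := hb n m hn hm
    refine ⟨h0, h1, fun c hc => ⟨fun s hs => ?_, h3 c hc⟩⟩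
    obtain ⟨k, rfl⟩ := Nat.exists_eq_add_of_le' hn
    exact isBergmanKernel_bergmanKernel k hm hc hs
  · obtain ⟨h0, h1, h2, h3⟩ := hb n (1 / 2) hn (by norm_num)
    have hc : 0 < (2 : ℝ) ^ (1 - (n : ℤ)) / (Nat.factorial (n - 1) : ℝ) := by positivity
    refine ⟨h2 rfl, (h3 _ hc).congr fun s hs z hz => ?_⟩
    rw [half_expansion_eq hn h0 h1 (h2 rfl) hs (norm_pos_iff.2 hz.2)]
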